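/- Let $k\ge 1$, $I=[a,b]$ with $a<b$, and let $w=(w_1,\dots,w_k)$ be positive weights with $w_i\in C^{k-i+1}(I)$. Put $u_i(x)=w_1(x)\int_a^x w_2(s_2)\int_a^{s_2}\cdots\int_a^{s_{i-1}} w_i(s_i)\,ds_i\cdots ds_2$ for $1\le i\le k$ and $\mathcal U_k=\operatorname{span}\{u_1,\dots,u_k\}$; let $u_1^*=1$ and $u_i^*(x)=\int_a^x w_k(s_1)\int_a^{s_1}w_{k-1}(s_2)\cdots\int_a^{s_{i-2}}w_{k-i+2}(s_{i-1})\,ds_{i-1}\cdots ds_1$ for $2\le i\le k+1$. Put $L_0^*f=f$ and $L_d^*f=(L_{d-1}^*f)'/w_{k-d+1}$ for $1\le d\le k$. For $\Delta=\{a=t_0=\cdots=t_{k-1}<t_k<\cdots<t_n<t_{n+1}=\cdots=t_{n+k}=b\}$ let $S(\mathcal U_k;\Delta)$ be the space of all $s\in C^{k-2}(I)$ (no continuity condition if $k=1$) that agree with an element of $\mathcal U_k$ on each interval $(t_j,t_{j+1})$, $k-1\le j\le n$, and let $P_\Delta$ be the orthogonal projection of $L^2(I)$ (Lebesgue measure)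 onto $S(\mathcal U_k;\Delta)$. For $0\le i\le n$ let $M_i(x)=(-1)^k[t_i,\dots,t_{i+k}]\,g_k(x,\cdot)$, extended continuously to the endpoints of $I$, where $g_k(x,y)=w_1(x)\int_y^x w_2(s_2)\int_y^{s_2}\cdots\int_y^{s_{k-1}}w_k(s_k)\,ds_k\cdots ds_2$ for $x\ge y$ and $g_k(x,y)=0$ for $x<y$. The divided difference is $$[\tau_1,\dots,\tau_{k+1}]f=\frac{\det\big(L^*_{d_i}u_1^*(\tau_i),\dots,L^*_{d_i}u_k^*(\tau_i),\,L^*_{d_i}f(\tau_i)\big)_{i=1}^{k+1}}{\det\big(L^*_{d_i}u_j^*(\tau_i)\big)_{i,j=1}^{k+1}},$$ with $d_i$ the number of $j<i$ such that $\tau_j=\tau_i$. Let $\phi_{i,r}\in u_r^*+\operatorname{span}\{u_1^*,\dots,u_{r-1}^*\}$ be the function that vanishes at $t_i,\dots,t_{i+r-2}$ including multiplicities (a zero of multiplicity $\mu$ meaning that $L_0^*,\dots,L_{\mu-1}^*$ of the function vanish there), let $\alpha_i$ be the number with $\phi_{i,k+1}-\phi_{i+1,k+1}=\alpha_i\phi_{i+1,k}$,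 and let $N_i=\alpha_iM_i$ be the renormalized B-splines. Let $m>0$ and $B,K\in\mathbb R$. Then there exist constants $C>0$ and $0<q<1$, depending only on $K$, $k$, $I$, $m$ and $B$, such that the following holds for all weights $w$ as above with $w_i\ge m$ and $|D^jw_i|\le B$ on $I$ for $1\le i\le k$, $0\le j\le k-i+1$, and for all $\Delta$: if $\|P_\Delta:L^\infty(I)\to L^\infty(I)\|\le K$, then the Gram matrix $\big(\int_I N_iN_j\,dx\big)_{i,j=0}^n$ is invertible and its inverse $(a_{ij})$ satisfies $$|a_{ij}|\le\frac{C\,q^{|i-j|}}{\alpha_i+\alpha_j},\qquad 0\le i,j\le n.$$ In particular, for a fixed weight vector $w$ on $I$, the constants depend on $\Delta$ only through $K$. -/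

import Mathlib

open MeasureTheory Set Filter Topology
open scoped ENNReal

noncomputable section

namespace ChebSpline

/-! Throughout, `w 1, …, w k` are the weights, `I = [a, b]`, and the knots are
`t 0 ≤ … ≤ t (n + k)`. Values of `w`, `t` at other indices and of functions outside `I`
play no role. -/

/-- The weights are positive with `w i ∈ C^{k-i+1}(I)`, bounded below by `m`, and all their
derivatives of order `0, …, k-i+1` are bounded by `B` in absolute value on `I`. -/
def WeightsBounded (a b : ℝ) (k : ℕ) (m B : ℝ) (w : ℕ → ℝ → ℝ) : Prop :=
  ∀ i, 1 ≤ i → i ≤ k →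
    ContDiffOn ℝ ((k - i + 1 : ℕ) : WithTop ℕ∞) (w i) (Icc a b) ∧
    (∀ x ∈ Icc a b, m ≤ w i x) ∧
    ∀ j ≤ k - i + 1, ∀ x ∈ Icc a b, |iteratedDerivWithin j (w i) (Icc a b) x| ≤ B

/-- `a = t 0 = ⋯ = t (k-1) < t k < ⋯ < t n < t (n+1) = ⋯ = t (n+k) = b`. -/
structure IsPartition (a b : ℝ) (k n : ℕ) (t : ℕ → ℝ) : Prop where
  le : k ≤ n + 1
  left : ∀ i < k, t i = a
  lt : ∀ i, k ≤ i + 1 → i ≤ n → t i < t (i + 1)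
  right : ∀ i, n + 1 ≤ i → i ≤ n + k → t i = b

/-- `iterInt w y p r x = w_p(x) ∫_y^x w_{p+1}(s₁) ∫_y^{s₁} ⋯ w_{p+r}(s_r) ds_r ⋯ ds₁`. -/
def iterInt (w : ℕ → ℝ → ℝ) (y : ℝ) : ℕ → ℕ → ℝ → ℝ
  | p, 0, x => w p x
  | p, r + 1, x => w p x * ∫ s in y..x, iterInt w y (p + 1) r s

/-- The function `h_j(x, y)`, `j ≥ 1`. -/
def hFun (w : ℕ → ℝ → ℝ) (j : ℕ) (x y : ℝ) : ℝ := iterInt w y 1 (j - 1) x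

/-- The analogue `g_j(x, y)` of the truncated power function. -/
def gFun (w : ℕ → ℝ → ℝ) (j : ℕ) (x y : ℝ) : ℝ := if y ≤ x then hFun w j x y else 0

/-- The canonical system `u_1, …, u_k`; `u_i(x) = h_i(x, a)`. -/
def uFun (w : ℕ → ℝ → ℝ) (a : ℝ) (i : ℕ) (x : ℝ) : ℝ := hFun w i x a

/-- `dualInt w a p r x = ∫_a^x w_p(s₁) ∫_a^{s₁} w_{p-1}(s₂) ⋯ ∫ w_{p-r+1}(s_r) ds_r ⋯ ds₁`. -/
def dualInt (w : ℕ → ℝ → ℝ) (a : ℝ) : ℕ → ℕ → ℝ → ℝ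
  | _, 0, _ => 1
  | p, r + 1, x => ∫ s in a..x, w p s * dualInt w a (p - 1) r s

/-- The dual canonical system `u*_1, …, u*_{k+1}`. -/
def uStar (w : ℕ → ℝ → ℝ) (a : ℝ) (k i : ℕ) : ℝ → ℝ := dualInt w a k (i - 1)

/-- `L*_0 f = f` and `L*_{d+1} f = (L*_d f)' / w_{k-d}` on `[a, b]`, that is
`L*_d = D*_{k-d+1} ⋯ D*_k` with `D*_i f = f' / w_i`. -/
def LStar (w : ℕ → ℝ → ℝ) (a b : ℝ) (k : ℕ) : ℕ → (ℝ → ℝ) → ℝ → ℝ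
  | 0, f => f
  | d + 1, f => fun y => derivWithin (LStar w a b k d f) (Icc a b) y / w (k - d) y

/-- The number of `j < i` with `τ j = τ i`; for non-decreasing `τ` this is the largest
`j ≤ i` with `τ i = τ (i-1) = ⋯ = τ (i-j)`. -/
def mult (τ : ℕ → ℝ) (i : ℕ) : ℕ := ((Finset.range i).filter fun j => τ j = τ i).card

/-- The determinant of `L*_{d_i} F_j (τ_i)`, with points `τ 0, …, τ (r-1)` and functions
`F 1, …, F r`. -/
def detLStar (w : ℕ → ℝ → ℝ) (a b : ℝ) (k r : ℕ) (τ : ℕ → ℝ) (F : ℕ → ℝ → ℝ) : ℝ :=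
  (Matrix.of fun i j : Fin r => LStar w a b k (mult τ i) (F (j + 1)) (τ i)).det

/-- The divided difference `[τ 0, …, τ (r-1)] f` with respect to `u*_1, …, u*_r`. At repeated
points the derivatives are the `L*_d`: `D^d` differs from a positive multiple of `L*_d` by a
combination of the lower ones, so the quotient is the one with `D^d` whenever those exist, and
`L*_d` needs no more smoothness of the weights than is assumed. -/
def divDiff (w : ℕ → ℝ → ℝ) (a b : ℝ) (k r : ℕ) (τ : ℕ → ℝ) (f : ℝ → ℝ) : ℝ :=
  detLStar w a b k r τ (Function.update (uStar w a k) r f) /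
    detLStar w a b k r τ (uStar w a k)

/-- The formula `(-1)^k [t_i, …, t_{i+k}] g_k(x, ·)` for the B-spline. -/
def bSplineAux (w : ℕ → ℝ → ℝ) (a b : ℝ) (k : ℕ) (t : ℕ → ℝ) (i : ℕ) (x : ℝ) : ℝ :=
  (-1) ^ k * divDiff w a b k (k + 1) (fun l => t (i + l)) (fun y => gFun w k x y)

/-- The Chebyshevian B-spline `M_i`, extended continuously to the endpoints of `[a, b]`. -/
def bSpline (w : ℕ → ℝ → ℝ) (a b : ℝ) (k : ℕ) (t : ℕ → ℝ) (i : ℕ) (x : ℝ) : ℝ :=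
  if x = a then limUnder (𝓝[>] a) (bSplineAux w a b k t i)
  else if x = b then limUnder (𝓝[<] b) (bSplineAux w a b k t i)
  else bSplineAux w a b k t i x

/-- `φ = φ_{i,r}` on `[a, b]`: it lies in the span of `u*_1, …, u*_r`, has leading coefficient
`1`, and vanishes at `t_i, …, t_{i+r-2}` including multiplicities. -/
def IsPhi (w : ℕ → ℝ → ℝ) (a b : ℝ) (k : ℕ) (t : ℕ → ℝ) (i r : ℕ) (φ : ℝ → ℝ) : Prop :=
  (∃ c : ℕ → ℝ, ∀ x ∈ Icc a b,
    φ x = uStar w a k r x + ∑ j ∈ Finset.Ico 1 r, c j * uStar w a k j x) ∧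
  ∀ l < r - 1, LStar w a b k (mult (fun l => t (i + l)) l) φ (t (i + l)) = 0

/-- `α_i` is the number with `φ_{i,k+1} - φ_{i+1,k+1} = α_i φ_{i+1,k}`. -/
def alpha (w : ℕ → ℝ → ℝ) (a b : ℝ) (k : ℕ) (t : ℕ → ℝ) (i : ℕ) : ℝ :=
  Classical.epsilon fun α : ℝ => ∃ φ₀ φ₁ φ₂ : ℝ → ℝ,
    IsPhi w a b k t i (k + 1) φ₀ ∧ IsPhi w a b k t (i + 1) (k + 1) φ₁ ∧
    IsPhi w a b k t (i + 1) k φ₂ ∧ ∀ x ∈ Icc a b, φ₀ x - φ₁ x = α * φ₂ x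

/-- The renormalized B-spline `N_i = α_i M_i`. -/
def nSpline (w : ℕ → ℝ → ℝ) (a b : ℝ) (k : ℕ) (t : ℕ → ℝ) (i : ℕ) (x : ℝ) : ℝ :=
  alpha w a b k t i * bSpline w a b k t i x

/-- The Gram matrix `⟨N_i, N_j⟩`, `0 ≤ i, j ≤ n`. -/
def gram (w : ℕ → ℝ → ℝ) (a b : ℝ) (k n : ℕ) (t : ℕ → ℝ) :
    Matrix (Fin (n + 1)) (Fin (n + 1)) ℝ :=
  Matrix.of fun i j => ∫ x in a..b, nSpline w a b k t i x * nSpline w a b k t j x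

/-- The space `U_k`, the span of `u_1, …, u_k`. -/
def uSpace (w : ℕ → ℝ → ℝ) (a : ℝ) (k : ℕ) : Submodule ℝ (ℝ → ℝ) :=
  Submodule.span ℝ (uFun w a '' Icc 1 k)

/-- The Chebyshevian spline space `S(U_k; Δ)`: functions in `C^{k-2}(I)` (no condition if
`k = 1`) that agree with an element of `U_k` on each open grid interval. -/
def splineSpace (w : ℕ → ℝ → ℝ) (a b : ℝ) (k n : ℕ) (t : ℕ → ℝ) : Submodule ℝ (ℝ → ℝ) where
  carrier := {s | (2 ≤ k → ContDiffOn ℝ ((k - 2 : ℕ) : WithTop ℕ∞) s (Icc a b)) ∧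
    ∀ j, k ≤ j + 1 → j ≤ n → ∃ v ∈ uSpace w a k, EqOn s v (Ioo (t j) (t (j + 1)))}
  zero_mem' := ⟨fun _ => contDiffOn_const, fun _ _ _ => ⟨0, Submodule.zero_mem _, fun _ _ => rfl⟩⟩
  add_mem' := by
    rintro f g ⟨hf, hf'⟩ ⟨hg, hg'⟩
    refine ⟨fun h => (hf h).add (hg h), fun j h₁ h₂ => ?_⟩
    obtain ⟨v, hv, hfv⟩ := hf' j h₁ h₂
    obtain ⟨v', hv', hgv⟩ := hg' j h₁ h₂
    exact ⟨v + v', Submodule.add_mem _ hv hv', fun x hx => by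
      simp only [Pi.add_apply, hfv hx, hgv hx]⟩
  smul_mem' := by
    rintro c f ⟨hf, hf'⟩
    refine ⟨fun h => (hf h).const_smul c, fun j h₁ h₂ => ?_⟩
    obtain ⟨v, hv, hfv⟩ := hf' j h₁ h₂
    exact ⟨c • v, Submodule.smul_mem _ c hv, fun x hx => by
      simp only [Pi.smul_apply, hfv hx]⟩

/-- Lebesgue measure on `I = [a, b]`. -/
abbrev measI (a b : ℝ) : Measure ℝ := volume.restrict (Icc a b)

/-- `S(U_k; Δ)` as a subspace of `L²(I)`. -/
def splineL2 (w : ℕ → ℝ → ℝ) (a b : ℝ) (k n : ℕ) (t : ℕ → ℝ) :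
    Submodule ℝ (Lp ℝ 2 (measI a b)) where
  carrier := {f | ∃ s ∈ splineSpace w a b k n t, f =ᵐ[measI a b] s}
  zero_mem' := ⟨0, Submodule.zero_mem _, Lp.coeFn_zero _ _ _⟩
  add_mem' := by
    rintro f g ⟨s, hs, hfs⟩ ⟨s', hs', hgs⟩
    exact ⟨s + s', Submodule.add_mem _ hs hs', (Lp.coeFn_add f g).trans (hfs.add hgs)⟩
  smul_mem' := by
    rintro c f ⟨s, hs, hfs⟩
    exact ⟨c • s, Submodule.smul_mem _ c hs, (Lp.coeFn_smul c f).trans (hfs.const_smul c)⟩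

/-- The orthogonal projection `P_Δ` of `L²(I)` onto `S(U_k; Δ)`. For a partition `Δ` this space
is finite-dimensional, hence equal to its closure; the closure is written only so that the
projection is defined for all parameters. -/
def proj (w : ℕ → ℝ → ℝ) (a b : ℝ) (k n : ℕ) (t : ℕ → ℝ) :
    Lp ℝ 2 (measI a b) →L[ℝ] Lp ℝ 2 (measI a b) :=
  (splineL2 w a b k n t).topologicalClosure.starProjection

/-- The norm `‖P_Δ : L^∞(I) → L^∞(I)‖`. -/
def projNorm (w : ℕ → ℝ → ℝ) (a b : ℝ) (k n : ℕ) (t : ℕ → ℝ) : ℝ≥0∞ :=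
  ⨆ (f : Lp ℝ 2 (measI a b)) (_ : eLpNorm f ∞ (measI a b) ≤ 1),
    eLpNorm (proj w a b k n t f) ∞ (measI a b)

end ChebSpline

end

/-!
# Exponential decay of the inverse Gram matrix of Chebyshevian B-splines

Only three features of the weights matter: they are bounded below by `m`, above by `B`, and smooth
enough for the splines to be the functions spanned by the B-splines. No bound on derivatives of the
weights enters the constants.

**The B-splines.** A combination of `u*_1, …, u*_r` comes with its derivatives `L*_e`, a tower of
functions each of which is a weighted derivative of the one before. Rolle's theorem with
multiplicities (`exists_interlacing_zeros`) shows that such combinations form a Chebyshev system and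
gives a mean value property of divided differences. Integrating `M_i` against `f` is the divided
difference of a `k`-fold weighted primitive of `f`, hence equals a value of `f`
(`exists_integral_bForm_mul`). Therefore `M_i ≥ 0` and `∫ M_i = 1`, with support in
`[t_i, t_{i+k}]`. Throughout, `M_i` is handled through the explicit formula `bForm`, which agrees
with it on `(a, b)`.

**Stability.** On a grid interval inside `[t_l, t_{l+k}]` the functional built from the values
`L*_e φ_{l+1,k}(z)` picks out the coefficient of `α_l M_l` in a spline (`sum_localCoeff_mul`). Taken
on the longest grid interval, and combined with a Markov inequality in `L¹`
(`exists_markov_bound`), it gives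
`|c_l| (t_{l+k} - t_l) ≤ D α_l ∫_{t_l}^{t_{l+k}} |∑ c_i M_i|`, with `D` depending only on `k`, `m`
and `B` (`exists_stability_bound`). Since `α_l ≤ 2 B (t_{l+k} - t_l)`, the sum `∑ |c_i|` is at
most a constant times the `L¹` norm of `∑ c_i M_i`. Stability also gives linear independence, and
comparison with the truncated power basis shows that the `M_i` span the spline space.

**The `ℓ¹` bound.** The sum `∑ α_i M_i` is the weight `w_1`, so `0 ≤ α_l M_l ≤ B` and the matrix
`A = (⟨N_l, M_i⟩)` is nonnegative with column sums at most `B`. For `s = ∑ c_i M_i` let `σ` be its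
sign. Then `∫ |s| = ⟨σ, s⟩ = ⟨P_Δ σ, s⟩`, and `P_Δ σ = ∑ b_l N_l` is bounded by `K`, so stability
bounds the `b_l` and gives `∫ |s| ≤ (max |b_l|) ‖A c‖₁`. Hence `‖c‖₁ ≤ κ ‖A c‖₁` with `κ`
depending only on `k`, `m`, `B`, `K` (`exists_l1_bound`).

**Decay.** A band matrix with bounded column sums that is bounded below on `ℓ¹` has an inverse with
exponentially decaying entries: for a column `x` of the inverse, the tail sum `T_s` of `|x_i|` over
indices at distance at least `s` from the diagonal satisfies
`T_s ≤ κ B (T_s - T_{s+2k})`, because the rows of `A` at distance at least `s + k` do not tell the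
tail from `x`, while the other rows only see entries at distance less than `s + 2k`
(`exists_decay_of_l1_bound`). As `⟨N_i, N_j⟩ = A_{ij} α_j`, the entries of the inverse Gram matrix
satisfy `α_i |a_{ij}| ≤ C q^{|i-j|}`, and symmetry adds the same bound with `α_j`.
-/

namespace ChebSpline

/-! ### Weights and one-sided calculus on a compact interval -/

/-- The part of `WeightsBounded` that the quantitative estimates use: `w 1, …, w k` are continuous
on `[a, b]` and take values in `[m, B]` there, with `0 < m` and `a < b`. -/
structure WeightsIn (a b : ℝ) (k : ℕ) (m B : ℝ) (w : ℕ → ℝ → ℝ) : Prop where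
  lt : a < b
  pos : 0 < m
  cont : ∀ i, 1 ≤ i → i ≤ k → ContinuousOn (w i) (Icc a b)
  ge : ∀ i, 1 ≤ i → i ≤ k → ∀ x ∈ Icc a b, m ≤ w i x
  le : ∀ i, 1 ≤ i → i ≤ k → ∀ x ∈ Icc a b, w i x ≤ B

section Basics

variable {a b : ℝ}

theorem hasDerivWithinAt_integral_Icc {g : ℝ → ℝ} (hg : ContinuousOn g (Icc a b)) {z y : ℝ}
    (hz : z ∈ Icc a b) (hy : y ∈ Icc a b) :
    HasDerivWithinAt (fun y => ∫ s in z..y, g s) (g y) (Icc a b) y := by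
  have : Fact (y ∈ Icc a b) := ⟨hy⟩
  refine intervalIntegral.integral_hasDerivWithinAt_right ?_ ?_ (hg y hy)
  · exact (hg.mono (uIcc_subset_Icc hz hy)).intervalIntegrable
  · exact hg.stronglyMeasurableAtFilter_nhdsWithin measurableSet_Icc y

theorem continuousOn_integral_Icc {g : ℝ → ℝ} (hg : ContinuousOn g (Icc a b)) {z : ℝ}
    (hz : z ∈ Icc a b) : ContinuousOn (fun y => ∫ s in z..y, g s) (Icc a b) :=
  fun _ hy => (hasDerivWithinAt_integral_Icc hg hz hy).continuousWithinAt

theorem integral_eq_sub_of_hasDerivWithinAt {f f' : ℝ → ℝ}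
    (hf : ∀ y ∈ Icc a b, HasDerivWithinAt f (f' y) (Icc a b) y)
    (hf' : ContinuousOn f' (Icc a b)) {z y : ℝ} (hz : z ∈ Icc a b) (hy : y ∈ Icc a b) :
    ∫ s in z..y, f' s = f y - f z := by
  have hsub : uIcc z y ⊆ Icc a b := uIcc_subset_Icc hz hy
  refine intervalIntegral.integral_eq_sub_of_hasDeriv_right
    (fun x hx => ((hf x (hsub hx)).continuousWithinAt).mono hsub) (fun x hx => ?_)
    ((hf'.mono hsub).intervalIntegrable)
  have hx1 : x ∈ Icc a b := hsub (Ioo_subset_Icc_self hx)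
  have hxb : x < b := hx.2.trans_le (max_le hz.2 hy.2)
  exact ((hf x hx1).mono_of_mem_nhdsWithin
    (mem_of_superset (Ioo_mem_nhdsGT hxb) fun s hs => ⟨hx1.1.trans hs.1.le, hs.2.le⟩))

end Basics

/-! ### Towers of derivatives and Rolle's theorem -/

/-- `F 0, …, F K` are a function and its successive derivatives `L*_e (F 0)` on `[a, b]`, in the
sense that `(F e)' = w_{k-e} F (e+1)`. Working with towers keeps the linearity of `L*` explicit. -/
def IsTower (w : ℕ → ℝ → ℝ) (a b : ℝ) (k K : ℕ) (F : ℕ → ℝ → ℝ) : Prop :=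
  ∀ e < K, ∀ y ∈ Icc a b, HasDerivWithinAt (F e) (w (k - e) y * F (e + 1) y) (Icc a b) y

section Towers

variable {w : ℕ → ℝ → ℝ} {a b m B : ℝ} {k K : ℕ}

theorem IsTower.shift {F : ℕ → ℝ → ℝ} (h : IsTower w a b k (K + 1) F) :
    IsTower w a b (k - 1) K (fun e => F (e + 1)) := by
  intro e he y hy
  have := h (e + 1) (by omega) y hy
  rwa [show k - (e + 1) = k - 1 - e by omega] at this

theorem IsTower.mono {F : ℕ → ℝ → ℝ} (h : IsTower w a b k K F) {K' : ℕ} (hK : K' ≤ K) :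
    IsTower w a b k K' F := fun e he => h e (by omega)

theorem IsTower.sub {F G : ℕ → ℝ → ℝ} (hF : IsTower w a b k K F) (hG : IsTower w a b k K G) :
    IsTower w a b k K (fun e y => F e y - G e y) := by
  intro e he y hy
  refine ((hF e he y hy).sub (hG e he y hy)).congr_deriv ?_
  ring

theorem IsTower.const_mul {F : ℕ → ℝ → ℝ} (hF : IsTower w a b k K F) (c : ℝ) :
    IsTower w a b k K (fun e y => c * F e y) := by
  intro e he y hy
  refine ((hF e he y hy).const_mul c).congr_deriv ?_
  ring

theorem IsTower.sum {ι : Type*} (s : Finset ι) {F : ι → ℕ → ℝ → ℝ}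
    (hF : ∀ i ∈ s, IsTower w a b k K (F i)) :
    IsTower w a b k K (fun e y => ∑ i ∈ s, F i e y) := by
  intro e he y hy
  refine (HasDerivWithinAt.fun_sum fun i hi => hF i hi e he y hy).congr_deriv ?_
  rw [Finset.mul_sum]

theorem IsTower.continuousOn {F : ℕ → ℝ → ℝ} (hF : IsTower w a b k K F) {e : ℕ} (he : e < K) :
    ContinuousOn (F e) (Icc a b) := fun y hy => (hF e he y hy).continuousWithinAt

theorem IsTower.LStar_eq {F : ℕ → ℝ → ℝ} (hw : WeightsIn a b k m B w) (hF : IsTower w a b k K F)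
    (hK : K ≤ k) {f : ℝ → ℝ} (hf : EqOn f (F 0) (Icc a b)) :
    ∀ e ≤ K, ∀ y ∈ Icc a b, LStar w a b k e f y = F e y := by
  intro e
  induction e with
  | zero => intro _ y hy; exact hf hy
  | succ e ih =>
    intro he y hy
    have hd : HasDerivWithinAt (LStar w a b k e f) (w (k - e) y * F (e + 1) y) (Icc a b) y :=
      (hF e (by omega) y hy).congr (fun x hx => ih (by omega) x hx) (ih (by omega) y hy)
    have hpos : 0 < w (k - e) y := hw.pos.trans_le (hw.ge _ (by omega) (by omega) y hy)
    change derivWithin (LStar w a b k e f) (Icc a b) y / w (k - e) y = _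
    rw [hd.derivWithin (uniqueDiffOn_Icc hw.lt y hy)]
    field_simp

theorem IsTower.integral_eq {F : ℕ → ℝ → ℝ} (hw : WeightsIn a b k m B w)
    (hF : IsTower w a b k K F) (hK : K ≤ k) {e : ℕ} (he : e < K)
    (hc : ContinuousOn (F (e + 1)) (Icc a b)) {z y : ℝ} (hz : z ∈ Icc a b) (hy : y ∈ Icc a b) :
    ∫ s in z..y, w (k - e) s * F (e + 1) s = F e y - F e z :=
  integral_eq_sub_of_hasDerivWithinAt (fun x hx => hF e he x hx)
    ((hw.cont (k - e) (by omega) (by omega)).mul hc) hz hy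

theorem mult_le (τ : ℕ → ℝ) (i : ℕ) : mult τ i ≤ i :=
  (Finset.card_filter_le _ _).trans (by simp)

theorem mult_eq_zero {τ : ℕ → ℝ} {i : ℕ} (h : ∀ j < i, τ j ≠ τ i) : mult τ i = 0 := by
  rw [mult, Finset.card_eq_zero, Finset.filter_eq_empty_iff]
  intro j hj
  exact h j (Finset.mem_range.1 hj)

theorem mult_succ_of_ne {τ : ℕ → ℝ} {i : ℕ} (h : ∀ j ≤ i, τ j ≠ τ (i + 1)) :
    mult τ (i + 1) = 0 := mult_eq_zero fun j hj => h j (by omega)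

theorem mono_of_le_succ {τ : ℕ → ℝ} {r : ℕ} (hτ : ∀ i < r, τ i ≤ τ (i + 1)) {i j : ℕ}
    (hij : i ≤ j) (hj : j ≤ r) : τ i ≤ τ j := by
  induction j, hij using Nat.le_induction with
  | base => exact le_rfl
  | succ j hij ih => exact (ih (by omega)).trans (hτ j (by omega))

/-- A point list vanishing with multiplicities vanishes in particular without them. -/
theorem tower_zero_of_mult {F : ℕ → ℝ → ℝ} {τ : ℕ → ℝ} {r : ℕ} (hτ : ∀ i < r, τ i ≤ τ (i + 1))
    (h : ∀ i ≤ r, F (mult τ i) (τ i) = 0) : ∀ i ≤ r, F 0 (τ i) = 0 := by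
  intro i
  induction i with
  | zero => intro _; simpa [mult] using h 0 (by omega)
  | succ i ihi =>
    intro hi
    rcases (hτ i (by omega)).eq_or_lt with he | hlt
    · rw [← he]; exact ihi (by omega)
    · have := h (i + 1) hi
      rwa [mult_succ_of_ne fun j hj =>
        ((mono_of_le_succ hτ hj (by omega)).trans_lt hlt).ne] at this

theorem WeightsIn.mono (hw : WeightsIn a b k m B w) {k' : ℕ} (hk : k' ≤ k) :
    WeightsIn a b k' m B w :=
  ⟨hw.lt, hw.pos, fun i h1 h2 => hw.cont i h1 (by omega), fun i h1 h2 => hw.ge i h1 (by omega),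
    fun i h1 h2 => hw.le i h1 (by omega)⟩

theorem mult_succ_of_eq {τ : ℕ → ℝ} {i : ℕ} (he : τ i = τ (i + 1)) :
    mult τ (i + 1) = mult τ i + 1 := by
  rw [mult, mult, Finset.range_add_one, Finset.filter_insert, if_pos he,
    Finset.card_insert_of_notMem (by simp), he]

/-- One step of Rolle's theorem with multiplicities: the zeros `τ` of `F 0` are interlaced by zeros
`σ` of `F 1`, again counted with multiplicities. -/
theorem exists_interlacing_zeros {r : ℕ} {F : ℕ → ℝ → ℝ} {τ : ℕ → ℝ}
    (hw : WeightsIn a b k m B w) (hrk : r + 1 ≤ k) (hF : IsTower w a b k (r + 1) F)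
    (hτ : ∀ i < r + 1, τ i ≤ τ (i + 1)) (ha : a ≤ τ 0) (hb : τ (r + 1) ≤ b)
    (h : ∀ i ≤ r + 1, F (mult τ i) (τ i) = 0) :
    ∃ σ : ℕ → ℝ, (∀ i ≤ r, σ i ∈ Icc (τ i) (τ (i + 1))) ∧
      ∀ i ≤ r, F (mult σ i + 1) (σ i) = 0 := by
  have hmem : ∀ i ≤ r + 1, τ i ∈ Icc a b := fun i hi =>
    ⟨ha.trans (mono_of_le_succ hτ (Nat.zero_le i) hi), (mono_of_le_succ hτ hi le_rfl).trans hb⟩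
  have hzero := tower_zero_of_mult hτ h
  have hex : ∀ i, ∃ σ, i ≤ r → ((τ i = τ (i + 1) → σ = τ i) ∧
      (τ i < τ (i + 1) → σ ∈ Ioo (τ i) (τ (i + 1)) ∧ F 1 σ = 0)) := by
    intro i
    by_cases hi : i ≤ r
    swap; · exact ⟨0, fun h => absurd h hi⟩
    rcases (hτ i (by omega)).eq_or_lt with he | hlt
    · exact ⟨τ i, fun _ => ⟨fun _ => rfl, fun h => absurd he h.ne⟩⟩
    have hsub : Icc (τ i) (τ (i + 1)) ⊆ Icc a b :=
      Icc_subset_Icc (hmem i (by omega)).1 (hmem (i + 1) (by omega)).2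
    obtain ⟨σ, hσ, hσ0⟩ := exists_hasDerivAt_eq_zero (f := F 0)
      (f' := fun y => w k y * F 1 y) hlt
      ((hF.continuousOn (by omega)).mono hsub) (by rw [hzero i (by omega), hzero _ (by omega)])
      (fun x hx => by
        have := hF 0 (by omega) x (hsub (Ioo_subset_Icc_self hx))
        exact this.hasDerivAt (mem_of_superset (Ioo_mem_nhds hx.1 hx.2)
          (Ioo_subset_Icc_self.trans hsub)))
    refine ⟨σ, fun _ => ⟨fun h => absurd h hlt.ne, fun _ => ⟨hσ, ?_⟩⟩⟩
    have hpos : 0 < w k σ := hw.pos.trans_le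
      (hw.ge _ (by omega) le_rfl σ (hsub (Ioo_subset_Icc_self hσ)))
    exact (mul_eq_zero.1 hσ0).resolve_left hpos.ne'
  choose σ hσ using hex
  have hσI : ∀ i ≤ r, σ i ∈ Icc (τ i) (τ (i + 1)) := by
    intro i hi
    rcases (hτ i (by omega)).eq_or_lt with he | hlt
    · rw [(hσ i hi).1 he]; exact ⟨le_rfl, hτ i (by omega)⟩
    · exact Ioo_subset_Icc_self ((hσ i hi).2 hlt).1
  refine ⟨σ, hσI, fun i hi => ?_⟩
  rcases (hτ i (by omega)).eq_or_lt with he | hlt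
  · have hs := (hσ i hi).1 he
    -- a repeated `τ i` stays a zero with multiplicity one less; the zeros strictly between
    -- distinct `τ j` do not meet it
    have hmul : mult τ (i + 1) = mult σ i + 1 := by
      rw [mult_succ_of_eq he, mult, mult]
      congr 2
      refine Finset.filter_congr fun j hj => ?_
      rw [Finset.mem_range] at hj
      rw [hs]
      have hji : τ (j + 1) ≤ τ i := mono_of_le_succ hτ (by omega) (by omega)
      have hτj := hτ j (by omega)
      constructor
      · intro hje
        have : τ j = τ (j + 1) := le_antisymm hτj (hji.trans hje.ge)
        rw [(hσ j (by omega)).1 this, hje]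
      · intro hje
        rcases hτj.eq_or_lt with he' | hlt'
        · rw [← hje, (hσ j (by omega)).1 he']
        · exact absurd hje (((hσ j (by omega)).2 hlt').1.2.trans_le hji).ne
    have := h (i + 1) (by omega)
    rw [hmul, ← he] at this
    rwa [hs]
  · obtain ⟨hin, h0⟩ := (hσ i hi).2 hlt
    rw [mult_eq_zero]
    · exact h0
    · intro j hj
      exact (((hσI j (by omega)).2.trans
        (mono_of_le_succ hτ (by omega : j + 1 ≤ i) (by omega))).trans_lt hin.1).ne

/-- Rolle's theorem counting multiplicities: if `F 0` has `r + 1` zeros in `[a, b]`, where a zero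
of multiplicity `μ` is one of `L*_0, …, L*_{μ-1}`, then `L*_r (F 0)` has a zero between them. -/
theorem exists_zero_of_tower {r : ℕ} : ∀ {k : ℕ} {F : ℕ → ℝ → ℝ} {τ : ℕ → ℝ},
    WeightsIn a b k m B w → r ≤ k → IsTower w a b k r F → (∀ i < r, τ i ≤ τ (i + 1)) →
    a ≤ τ 0 → τ r ≤ b → (∀ i ≤ r, F (mult τ i) (τ i) = 0) → ∃ ξ ∈ Icc (τ 0) (τ r), F r ξ = 0 := by
  induction r with
  | zero =>
    intro k F τ _ _ _ _ _ _ h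
    exact ⟨τ 0, ⟨le_rfl, le_rfl⟩, by simpa [mult] using h 0 le_rfl⟩
  | succ r ih =>
    intro k F τ hw hrk hF hτ ha hb h
    obtain ⟨σ, hσI, hσ0⟩ := exists_interlacing_zeros hw hrk hF hτ ha hb h
    obtain ⟨ξ, hξ, hξ0⟩ := ih (τ := σ) (hw.mono (Nat.sub_le k 1)) (by omega) hF.shift
      (fun i hi => (hσI i (by omega)).2.trans (hσI (i + 1) (by omega)).1)
      (ha.trans (hσI 0 (by omega)).1) ((hσI r le_rfl).2.trans hb) hσ0
    exact ⟨ξ, ⟨(hσI 0 (by omega)).1.trans hξ.1, hξ.2.trans (hσI r le_rfl).2⟩, hξ0⟩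

/-- To the right of its zeros, a function with `r` zeros and `L*_r ≥ 0` has all its `L*_e ≥ 0`. -/
theorem tower_nonneg_of_zeros {r : ℕ} : ∀ {k : ℕ} {F : ℕ → ℝ → ℝ} {τ : ℕ → ℝ},
    WeightsIn a b k m B w → r ≤ k → IsTower w a b k r F →
    (∀ i, i + 1 < r → τ i ≤ τ (i + 1)) → (∀ i < r, τ i ∈ Icc a b) →
    (∀ i < r, F (mult τ i) (τ i) = 0) → (∀ y ∈ Icc a b, 0 ≤ F r y) →
    ∀ e ≤ r, ∀ y ∈ Icc a b, (∀ i < r, τ i ≤ y) → 0 ≤ F e y := by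
  induction r with
  | zero =>
    intro k F τ _ _ _ _ _ _ h e he y hy _
    rw [Nat.le_zero.1 he]; exact h y hy
  | succ r ih =>
    intro k F τ hw hrk hF hτ hI h hpos e he y hy hyτ
    have hshift : ∀ e ≤ r, ∀ y ∈ Icc a b, (∀ i < r + 1, τ i ≤ y) → 0 ≤ F (e + 1) y := by
      intro e he y hy hyτ
      cases r with
      | zero => rw [Nat.le_zero.1 he]; exact hpos y hy
      | succ r =>
        obtain ⟨σ, hσI, hσ0⟩ := exists_interlacing_zeros (r := r) hw (by omega)
          (hF.mono (by omega)) (fun i hi => hτ i (by omega)) (hI 0 (by omega)).1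
          (hI (r + 1) (by omega)).2 (fun i hi => h i (by omega))
        exact ih (τ := σ) (hw.mono (Nat.sub_le k 1)) (by omega) hF.shift
          (fun i hi => (hσI i (by omega)).2.trans (hσI (i + 1) (by omega)).1)
          (fun i hi => ⟨(hI i (by omega)).1.trans (hσI i (by omega)).1,
            (hσI i (by omega)).2.trans (hI (i + 1) (by omega)).2⟩)
          (fun i hi => hσ0 i (by omega)) hpos e he y hy
          (fun i hi => (hσI i (by omega)).2.trans (hyτ (i + 1) (by omega)))
    cases e with
    | succ e => exact hshift e (by omega) y hy hyτ
    | zero =>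
      have hz := tower_zero_of_mult (r := r) (fun i hi => hτ i (by omega))
        (fun i hi => h i (by omega)) r le_rfl
      have hτr := hI r (by omega)
      have hyr := hyτ r (by omega)
      -- the derivative is nonnegative, so `F 0` increases from its zero at `τ r`
      have hmono : MonotoneOn (F 0) (Icc (τ r) y) := by
        refine monotoneOn_of_deriv_nonneg (convex_Icc _ _)
          ((hF.continuousOn (by omega)).mono (Icc_subset_Icc hτr.1 hy.2)) ?_ ?_
        all_goals
          intro x hx
          rw [interior_Icc] at hx
          have hxI : x ∈ Icc a b := ⟨hτr.1.trans hx.1.le, hx.2.le.trans hy.2⟩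
          have hd := (hF 0 (by omega) x hxI).hasDerivAt
            (mem_of_superset (Ioo_mem_nhds hx.1 hx.2)
              fun s hs => ⟨hτr.1.trans hs.1.le, hs.2.le.trans hy.2⟩)
        · exact hd.differentiableAt.differentiableWithinAt
        · rw [hd.deriv]
          have h1 := hshift 0 (by omega) x hxI (fun i hi =>
            (mono_of_le_succ (τ := τ) (r := r) (fun i hi => hτ i (by omega))
              (by omega : i ≤ r) le_rfl).trans hx.1.le)
          exact mul_nonneg (hw.pos.le.trans (hw.ge _ (by omega) (by omega) x hxI)) h1
      rw [← hz]
      exact hmono ⟨le_rfl, hyr⟩ ⟨hyr, le_rfl⟩ hyr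

end Towers

/-! ### The dual canonical system -/

section Dual

variable {w : ℕ → ℝ → ℝ} {a b m B : ℝ} {k : ℕ}

theorem continuousOn_dualInt (hw : WeightsIn a b k m B w) {z : ℝ} (hz : z ∈ Icc a b) (r : ℕ) :
    ∀ p ≤ k, r ≤ p → ContinuousOn (dualInt w z p r) (Icc a b) := by
  induction r with
  | zero => intro p _ _; exact continuousOn_const
  | succ r ih =>
    intro p hp hr
    exact continuousOn_integral_Icc ((hw.cont p (by omega) hp).mul (ih (p - 1) (by omega)
      (by omega))) hz

theorem hasDerivWithinAt_dualInt (hw : WeightsIn a b k m B w) {z y : ℝ} (hz : z ∈ Icc a b)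
    (hy : y ∈ Icc a b) {p r : ℕ} (hp : p ≤ k) (hr : r + 1 ≤ p) :
    HasDerivWithinAt (dualInt w z p (r + 1)) (w p y * dualInt w z (p - 1) r y) (Icc a b) y :=
  hasDerivWithinAt_integral_Icc ((hw.cont p (by omega) hp).mul
    (continuousOn_dualInt hw hz r (p - 1) (by omega) (by omega))) hz hy

/-- The tower `L*_e` of the dual function `dualInt w z k r`; for `z = a` that of `u*_{r+1}`. -/
noncomputable def dualTower (w : ℕ → ℝ → ℝ) (z : ℝ) (k r e : ℕ) (y : ℝ) : ℝ :=
  if e ≤ r then dualInt w z (k - e) (r - e) y else 0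

@[simp] theorem dualTower_self (z : ℝ) (r : ℕ) (y : ℝ) : dualTower w z k r r y = 1 := by
  simp [dualTower, dualInt]

theorem dualTower_of_lt (z : ℝ) {r e : ℕ} (h : r < e) (y : ℝ) : dualTower w z k r e y = 0 := by
  simp [dualTower, h]

theorem dualTower_zero (z : ℝ) (r : ℕ) : dualTower w z k r 0 = dualInt w z k r := by
  ext y; simp [dualTower]

theorem dualTower_base (z : ℝ) (r e : ℕ) :
    dualTower w z k r e z = if e = r then 1 else 0 := by
  rcases lt_trichotomy e r with h | h | h
  · rw [if_neg h.ne, dualTower, if_pos h.le]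
    obtain ⟨s, hs⟩ : ∃ s, r - e = s + 1 := ⟨r - e - 1, by omega⟩
    rw [hs]; simp [dualInt]
  · subst h; simp
  · rw [if_neg h.ne', dualTower_of_lt z h]

theorem isTower_dualTower (hw : WeightsIn a b k m B w) {z : ℝ} (hz : z ∈ Icc a b) {r : ℕ}
    (hr : r ≤ k) (K : ℕ) : IsTower w a b k K (dualTower w z k r) := by
  intro e _ y hy
  rcases lt_trichotomy e r with h | h | h
  · obtain ⟨s, hs⟩ : ∃ s, r - e = s + 1 := ⟨r - e - 1, by omega⟩
    have h1 : dualTower w z k r e = dualInt w z (k - e) (s + 1) := by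
      ext y; simp [dualTower, h.le, hs]
    have h2 : dualTower w z k r (e + 1) y = dualInt w z (k - e - 1) s y := by
      rw [dualTower, if_pos (by omega), show r - (e + 1) = s by omega, Nat.sub_sub]
    rw [h1, h2]
    exact hasDerivWithinAt_dualInt hw hz hy (by omega) (by omega)
  · subst h
    have h1 : dualTower w z k e e = fun _ => 1 := by ext y; simp
    rw [h1, dualTower_of_lt z (Nat.lt_succ_self e), mul_zero]
    exact hasDerivWithinAt_const _ _ _
  · have h1 : dualTower w z k r e = fun _ => 0 := by ext y; exact dualTower_of_lt z h y
    rw [h1, dualTower_of_lt z (by omega), mul_zero]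
    exact hasDerivWithinAt_const _ _ _

/-- The tower of `∑_{r < R} c_r u*_{r+1}`. -/
noncomputable def spanTower (w : ℕ → ℝ → ℝ) (a : ℝ) (k R : ℕ) (c : ℕ → ℝ) (e : ℕ) (y : ℝ) : ℝ :=
  ∑ r ∈ Finset.range R, c r * dualTower w a k r e y

theorem isTower_spanTower (hw : WeightsIn a b k m B w) {R : ℕ} (hR : R ≤ k + 1) (c : ℕ → ℝ)
    (K : ℕ) : IsTower w a b k K (spanTower w a k R c) :=
  IsTower.sum _ fun r hr => (isTower_dualTower hw (left_mem_Icc.2 hw.lt.le)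
    (by rw [Finset.mem_range] at hr; omega) K).const_mul (c r)

theorem spanTower_top (R : ℕ) (c : ℕ → ℝ) (y : ℝ) :
    spanTower w a k (R + 1) c R y = c R := by
  rw [spanTower, Finset.sum_range_succ, dualTower_self, mul_one, Finset.sum_eq_zero, zero_add]
  intro r hr
  rw [dualTower_of_lt a (Finset.mem_range.1 hr), mul_zero]

/-- The dual system is a Chebyshev system, multiplicities included. -/
theorem spanTower_coeff_eq_zero (hw : WeightsIn a b k m B w) {τ : ℕ → ℝ} (c : ℕ → ℝ) (R : ℕ) :
    R ≤ k + 1 → (∀ i, i + 1 < R → τ i ≤ τ (i + 1)) → (∀ i < R, τ i ∈ Icc a b) →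
    (∀ i < R, spanTower w a k R c (mult τ i) (τ i) = 0) → ∀ r < R, c r = 0 := by
  induction R with
  | zero => intro _ _ _ _ r hr; omega
  | succ R ih =>
    intro hR hτ hI h
    obtain ⟨ξ, -, hξ⟩ := exists_zero_of_tower (r := R) (τ := τ) hw (by omega)
      (isTower_spanTower hw hR c R) (fun i hi => hτ i (by omega)) (hI 0 (by omega)).1
      (hI R (by omega)).2 (fun i hi => h i (by omega))
    rw [spanTower_top] at hξ
    intro r hr
    rcases Nat.lt_succ_iff_lt_or_eq.1 hr with hr | rfl
    · refine ih (by omega) (fun i hi => hτ i (by omega)) (fun i hi => hI i (by omega))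
        (fun i hi => ?_) r hr
      have := h i (by omega)
      rwa [spanTower, Finset.sum_range_succ, hξ, zero_mul, add_zero] at this
    · exact hξ

end Dual

/-! ### Divided differences -/

section DivDiff

variable {w : ℕ → ℝ → ℝ} {a b m B : ℝ} {k : ℕ}

/-- The collocation matrix `L*_{d_i} u*_{j+1} (τ_i)`. -/
noncomputable def collocation (w : ℕ → ℝ → ℝ) (a : ℝ) (k R : ℕ) (τ : ℕ → ℝ) :
    Matrix (Fin R) (Fin R) ℝ :=
  Matrix.of fun i j => dualTower w a k j (mult τ i) (τ i)

theorem LStar_uStar (hw : WeightsIn a b k m B w) {j : ℕ} (hj : j ≤ k) {e : ℕ} (he : e ≤ k)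
    {y : ℝ} (hy : y ∈ Icc a b) :
    LStar w a b k e (uStar w a k (j + 1)) y = dualTower w a k j e y :=
  (isTower_dualTower hw (left_mem_Icc.2 hw.lt.le) hj k).LStar_eq hw le_rfl
    (fun x _ => by rw [dualTower_zero, uStar, Nat.add_sub_cancel]) e he y hy

theorem collocation_det_ne_zero (hw : WeightsIn a b k m B w) {R : ℕ} (hR : R ≤ k + 1) {τ : ℕ → ℝ}
    (hτ : ∀ i, i + 1 < R → τ i ≤ τ (i + 1)) (hI : ∀ i < R, τ i ∈ Icc a b) :
    (collocation w a k R τ).det ≠ 0 := by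
  intro h0
  obtain ⟨v, hv, hv0⟩ := Matrix.exists_mulVec_eq_zero_iff.2 h0
  apply hv
  have key := spanTower_coeff_eq_zero hw (fun r => if h : r < R then v ⟨r, h⟩ else 0) R hR hτ hI
    (by
      intro i hi
      have := congrFun hv0 ⟨i, hi⟩
      simp only [Matrix.mulVec, dotProduct, collocation, Matrix.of_apply, Pi.zero_apply] at this
      rw [spanTower, Finset.sum_range, ← this]
      exact Finset.sum_congr rfl fun j _ => by simp [mul_comm])
  ext ⟨r, hr⟩
  simpa [hr] using key r hr

/-- The coefficients of the divided difference `[τ_0, …, τ_k]` as a linear functional of the data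
`L*_{d_l} f (τ_l)`. -/
noncomputable def ddCoeff (w : ℕ → ℝ → ℝ) (a : ℝ) (k : ℕ) (τ : ℕ → ℝ) (l : Fin (k + 1)) : ℝ :=
  (collocation w a k (k + 1) τ)⁻¹ (Fin.last k) l

theorem divDiff_eq_sum (hw : WeightsIn a b k m B w) {τ : ℕ → ℝ}
    (hτ : ∀ i < k, τ i ≤ τ (i + 1)) (hI : ∀ i ≤ k, τ i ∈ Icc a b) (f : ℝ → ℝ) :
    divDiff w a b k (k + 1) τ f =
      ∑ l : Fin (k + 1), ddCoeff w a k τ l * LStar w a b k (mult τ l) f (τ l) := by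
  have hdet := collocation_det_ne_zero hw (le_refl (k + 1)) (τ := τ) (fun i hi => hτ i (by omega))
    (fun i hi => hI i (by omega))
  have h1 : detLStar w a b k (k + 1) τ (uStar w a k) = (collocation w a k (k + 1) τ).det := by
    rw [detLStar]
    congr 1
    ext i j
    have := mult_le τ i
    exact LStar_uStar hw (by omega) (by omega) (hI i (by omega))
  have h2 : detLStar w a b k (k + 1) τ (Function.update (uStar w a k) (k + 1) f) =
      (collocation w a k (k + 1) τ).cramer
        (fun l => LStar w a b k (mult τ l) f (τ l)) (Fin.last k) := by
    rw [detLStar, Matrix.cramer_apply]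
    congr 1
    ext i j
    rw [Matrix.updateCol_apply, Matrix.of_apply]
    split_ifs with hj
    · subst hj; simp
    · have hj' : (j : ℕ) + 1 ≠ k + 1 := fun h => hj (Fin.ext (by simp; omega))
      rw [Function.update_of_ne hj']
      have := mult_le τ i
      exact LStar_uStar hw (by omega) (by omega) (hI i (by omega))
  rw [divDiff, h1, h2, Matrix.cramer_eq_adjugate_mulVec, Matrix.mulVec, dotProduct,
    Finset.sum_div]
  refine Finset.sum_congr rfl fun l _ => ?_
  rw [ddCoeff, Matrix.inv_def, Matrix.smul_apply, Ring.inverse_eq_inv', smul_eq_mul]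
  ring

theorem sum_ddCoeff_dualTower (hw : WeightsIn a b k m B w) {τ : ℕ → ℝ}
    (hτ : ∀ i < k, τ i ≤ τ (i + 1)) (hI : ∀ i ≤ k, τ i ∈ Icc a b) {r : ℕ} (hr : r ≤ k) :
    ∑ l : Fin (k + 1), ddCoeff w a k τ l * dualTower w a k r (mult τ l) (τ l) =
      if r = k then 1 else 0 := by
  have hdet := collocation_det_ne_zero hw (le_refl (k + 1)) (τ := τ) (fun i hi => hτ i (by omega))
    (fun i hi => hI i (by omega))
  have h := congrFun (congrFun (Matrix.nonsing_inv_mul _ (isUnit_iff_ne_zero.2 hdet)) (Fin.last k))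
    ⟨r, by omega⟩
  rw [Matrix.mul_apply, Matrix.one_apply] at h
  simp only [collocation, Matrix.of_apply] at h
  rw [show (if r = k then (1 : ℝ) else 0) = if Fin.last k = (⟨r, by omega⟩ : Fin (k + 1)) then 1
    else 0 by simp [Fin.ext_iff, eq_comm]]
  exact h

theorem sum_ddCoeff_spanTower (hw : WeightsIn a b k m B w) {τ : ℕ → ℝ}
    (hτ : ∀ i < k, τ i ≤ τ (i + 1)) (hI : ∀ i ≤ k, τ i ∈ Icc a b) {R : ℕ} (hR : R ≤ k + 1)
    (c : ℕ → ℝ) :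
    ∑ l : Fin (k + 1), ddCoeff w a k τ l * spanTower w a k R c (mult τ l) (τ l) =
      if R = k + 1 then c k else 0 := by
  simp only [spanTower, Finset.mul_sum]
  rw [Finset.sum_comm]
  have h : ∀ r ∈ Finset.range R, ∑ l : Fin (k + 1), ddCoeff w a k τ l *
      (c r * dualTower w a k r (mult τ l) (τ l)) = if r = k then c r else 0 := by
    intro r hr
    rw [Finset.mem_range] at hr
    have := sum_ddCoeff_dualTower hw hτ hI (r := r) (by omega)
    calc _ = c r * ∑ l : Fin (k + 1), ddCoeff w a k τ l * dualTower w a k r (mult τ l) (τ l) := by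
          rw [Finset.mul_sum]; exact Finset.sum_congr rfl fun l _ => by ring
      _ = _ := by rw [this]; split_ifs <;> simp
  rw [Finset.sum_congr rfl h, Finset.sum_ite_eq']
  have h2 : k ∈ Finset.range R ↔ R = k + 1 := by rw [Finset.mem_range]; omega
  simp only [h2]

/-- The mean value property of divided differences: `[τ_0, …, τ_k] f` is a value of `L*_k f`. -/
theorem exists_sum_ddCoeff_eq (hw : WeightsIn a b k m B w) {τ : ℕ → ℝ}
    (hτ : ∀ i < k, τ i ≤ τ (i + 1)) (hI : ∀ i ≤ k, τ i ∈ Icc a b) {F : ℕ → ℝ → ℝ}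
    (hF : IsTower w a b k k F) :
    ∃ ξ ∈ Icc a b, ∑ l : Fin (k + 1), ddCoeff w a k τ l * F (mult τ l) (τ l) = F k ξ := by
  have hdet := collocation_det_ne_zero hw (le_refl (k + 1)) (τ := τ) (fun i hi => hτ i (by omega))
    (fun i hi => hI i (by omega))
  -- `e` holds the coefficients of the interpolant of `F` from the span of the dual system
  set v : Fin (k + 1) → ℝ := fun l => F (mult τ l) (τ l) with hv
  set e := (collocation w a k (k + 1) τ)⁻¹.mulVec v with he
  have hAe : (collocation w a k (k + 1) τ).mulVec e = v := by
    rw [he, Matrix.mulVec_mulVec, Matrix.mul_nonsing_inv _ (isUnit_iff_ne_zero.2 hdet),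
      Matrix.one_mulVec]
  set c : ℕ → ℝ := fun r => if h : r < k + 1 then e ⟨r, h⟩ else 0 with hc
  obtain ⟨ξ, hξ, h0⟩ := exists_zero_of_tower (r := k) (τ := τ) hw le_rfl
    (hF.sub (isTower_spanTower hw le_rfl c k)) hτ (hI 0 (by omega)).1 (hI k le_rfl).2 (by
      intro i hi
      have := congrFun hAe ⟨i, by omega⟩
      simp only [Matrix.mulVec, dotProduct, collocation, Matrix.of_apply, hv] at this
      rw [← this, spanTower, Finset.sum_range, sub_eq_zero]
      refine Finset.sum_congr rfl fun j _ => ?_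
      simp only [hc, j.2, dite_true, mul_comm])
  refine ⟨ξ, ⟨(hI 0 (by omega)).1.trans hξ.1, hξ.2.trans (hI k le_rfl).2⟩, ?_⟩
  rw [spanTower_top] at h0
  rw [sub_eq_zero.1 h0, hc]
  simp only [Nat.lt_succ_self, dite_true]
  rw [he]
  rfl

end DivDiff

/-! ### The kernels `h_j` and `g_j` -/

section Kernels

variable {w : ℕ → ℝ → ℝ} {a b m B : ℝ} {k : ℕ}

theorem continuousOn_iterInt (hw : WeightsIn a b k m B w) {y : ℝ} (hy : y ∈ Icc a b) (r : ℕ) :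
    ∀ p, 1 ≤ p → p + r ≤ k → ContinuousOn (iterInt w y p r) (Icc a b) := by
  induction r with
  | zero => intro p h1 h2; exact hw.cont p h1 h2
  | succ r ih =>
    intro p h1 h2
    exact (hw.cont p h1 (by omega)).mul
      (continuousOn_integral_Icc (ih (p + 1) (by omega) (by omega)) hy)

/-- `primitives w c f q r` arises from `f` by `r` weighted integrations from `c`, with the weights
`w_{q+1}, …, w_{q+r}` in this order. -/
noncomputable def primitives (w : ℕ → ℝ → ℝ) (c : ℝ) (f : ℝ → ℝ) (q : ℕ) : ℕ → ℝ → ℝ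
  | 0 => f
  | r + 1 => fun y => ∫ s in c..y, w (q + r + 1) s * primitives w c f q r s

theorem continuousOn_primitives (hw : WeightsIn a b k m B w) {c : ℝ} (hc : c ∈ Icc a b)
    {f : ℝ → ℝ} (hf : ContinuousOn f (Icc a b)) {q : ℕ} (r : ℕ) (hr : q + r ≤ k) :
    ContinuousOn (primitives w c f q r) (Icc a b) := by
  induction r with
  | zero => exact hf
  | succ r ih =>
    exact continuousOn_integral_Icc ((hw.cont _ (by omega) (by omega)).mul (ih (by omega))) hc

theorem hasDerivWithinAt_primitives (hw : WeightsIn a b k m B w) {c y : ℝ} (hc : c ∈ Icc a b)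
    (hy : y ∈ Icc a b) {f : ℝ → ℝ} (hf : ContinuousOn f (Icc a b)) {q : ℕ} (r : ℕ)
    (hr : q + r + 1 ≤ k) :
    HasDerivWithinAt (primitives w c f q (r + 1)) (w (q + r + 1) y * primitives w c f q r y)
      (Icc a b) y :=
  hasDerivWithinAt_integral_Icc ((hw.cont _ (by omega) (by omega)).mul
    (continuousOn_primitives hw hc hf r (by omega))) hc hy

theorem isTower_primitives (hw : WeightsIn a b k m B w) {c : ℝ} (hc : c ∈ Icc a b)
    {f : ℝ → ℝ} (hf : ContinuousOn f (Icc a b)) :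
    IsTower w a b k k (fun e => primitives w c f 0 (k - e)) := by
  intro e he y hy
  have := hasDerivWithinAt_primitives hw hc hy hf (q := 0) (k - (e + 1)) (by omega)
  rwa [show 0 + (k - (e + 1)) + 1 = k - e by omega,
    show k - (e + 1) + 1 = k - e by omega] at this

theorem primitives_one (w : ℕ → ℝ → ℝ) (c : ℝ) (q r : ℕ) :
    primitives w c (fun _ => 1) q r = dualInt w c (q + r) r := by
  induction r with
  | zero => ext y; rfl
  | succ r ih =>
    ext y
    simp only [primitives, dualInt, ih]
    rfl

/-- The order of integration in the pairing of `iterInt` with a function can be reversed. -/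
theorem integral_iterInt_mul_primitives (hw : WeightsIn a b k m B w) {c y : ℝ} (hc : c ∈ Icc a b)
    (hy : y ∈ Icc a b) {f : ℝ → ℝ} (hf : ContinuousOn f (Icc a b)) {q : ℕ} (r : ℕ) :
    ∀ j, q + j + 1 + r ≤ k →
      ∫ x in c..y, iterInt w y (q + j + 1) r x * primitives w c f q j x =
        (-1) ^ r * primitives w c f q (j + r + 1) y := by
  induction r with
  | zero => intro j _; simp [iterInt, primitives]
  | succ r ih =>
    intro j hj
    have hsub : uIcc c y ⊆ Icc a b := uIcc_subset_Icc hc hy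
    have hcG := continuousOn_iterInt hw hy r (q + (j + 1) + 1) (by omega) (by omega)
    have hcP := continuousOn_primitives hw hc hf (q := q) (j + 1) (by omega)
    -- integrate by parts: both boundary terms vanish
    have hparts := integral_eq_sub_of_hasDerivWithinAt (a := a) (b := b)
      (f := fun x => primitives w c f q (j + 1) x * ∫ s in y..x, iterInt w y (q + (j + 1) + 1) r s)
      (f' := fun x => (w (q + j + 1) x * primitives w c f q j x) *
        (∫ s in y..x, iterInt w y (q + (j + 1) + 1) r s) +
        primitives w c f q (j + 1) x * iterInt w y (q + (j + 1) + 1) r x)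
      (fun x hx => (hasDerivWithinAt_primitives hw hc hx hf j (by omega)).mul
        (hasDerivWithinAt_integral_Icc hcG hy hx))
      ((((hw.cont _ (by omega) (by omega)).mul (continuousOn_primitives hw hc hf j
        (by omega))).mul (continuousOn_integral_Icc hcG hy)).add (hcP.mul hcG)) hc hy
    rw [intervalIntegral.integral_add] at hparts
    · have h0 : primitives w c f q (j + 1) c = 0 := by simp [primitives]
      rw [h0, intervalIntegral.integral_same, mul_zero, zero_mul, sub_zero] at hparts
      have hih := ih (j + 1) (by omega)
      calc _ = ∫ x in c..y, (w (q + j + 1) x * primitives w c f q j x) *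
            (∫ s in y..x, iterInt w y (q + (j + 1) + 1) r s) := by
            refine intervalIntegral.integral_congr fun x _ => ?_
            simp only [iterInt]
            rw [show q + j + 1 + 1 = q + (j + 1) + 1 by omega]
            ring
        _ = -∫ x in c..y, iterInt w y (q + (j + 1) + 1) r x * primitives w c f q (j + 1) x := by
            rw [eq_neg_iff_add_eq_zero, ← hparts]
            congr 1
            refine intervalIntegral.integral_congr fun x _ => ?_
            simp only [mul_comm]
        _ = _ := by
            rw [hih, show j + 1 + r + 1 = j + (r + 1) + 1 by omega, pow_succ]
            ring
    · exact ((((hw.cont _ (by omega) (by omega)).mul (continuousOn_primitives hw hc hf j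
        (by omega))).mul (continuousOn_integral_Icc hcG hy)).mono hsub).intervalIntegrable
    · exact ((hcP.mul hcG).mono hsub).intervalIntegrable

/-- As a function of its base point, `iterInt` is an iterated integral of the dual kind. -/
theorem iterInt_eq_dualInt (hw : WeightsIn a b k m B w) {x y : ℝ} (hx : x ∈ Icc a b)
    (hy : y ∈ Icc a b) {q r : ℕ} (hr : q + 1 + r ≤ k) :
    iterInt w y (q + 1) r x = (-1) ^ r * (w (q + 1) x * dualInt w x (q + 1 + r) r y) := by
  cases r with
  | zero => simp [iterInt, dualInt]
  | succ r =>
    have h := integral_iterInt_mul_primitives hw hx hy (f := fun _ => 1) continuousOn_const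
      (q := q + 1) r 0 (by omega)
    rw [primitives_one, primitives_one] at h
    have e0 : ∀ s, dualInt w x (q + 1) 0 s = 1 := fun _ => rfl
    simp only [Nat.add_zero, Nat.zero_add, e0, mul_one] at h
    rw [iterInt, intervalIntegral.integral_symm, h, pow_succ]
    ring

theorem hFun_eq_dualInt (hw : WeightsIn a b k m B w) {x y : ℝ} (hx : x ∈ Icc a b)
    (hy : y ∈ Icc a b) {j : ℕ} (hj : j + 1 ≤ k) :
    hFun w (j + 1) x y = (-1) ^ j * (w 1 x * dualInt w x (j + 1) j y) := by
  rw [hFun, Nat.add_sub_cancel, iterInt_eq_dualInt (q := 0) hw hx hy (by omega),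
    show 0 + 1 + j = j + 1 by omega]

/-- The tower of `h_k(x, ·)`. -/
noncomputable def hTower (w : ℕ → ℝ → ℝ) (k : ℕ) (x : ℝ) (e : ℕ) (y : ℝ) : ℝ :=
  (-1) ^ (k - 1) * w 1 x * dualTower w x k (k - 1) e y

theorem isTower_hTower (hw : WeightsIn a b k m B w) {x : ℝ} (hx : x ∈ Icc a b) (K : ℕ) :
    IsTower w a b k K (hTower w k x) :=
  (isTower_dualTower hw hx (by omega) K).const_mul _

theorem hTower_eq (hw : WeightsIn a b k m B w) {x y : ℝ} (hx : x ∈ Icc a b)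
    (hy : y ∈ Icc a b) {e : ℕ} (he : e < k) :
    hTower w k x e y = (-1) ^ e * hFun w (k - e) x y := by
  have h := hFun_eq_dualInt hw hx hy (j := k - e - 1) (by omega)
  rw [show k - e - 1 + 1 = k - e by omega] at h
  rw [h, hTower, dualTower, if_pos (by omega), show k - 1 - e = k - e - 1 by omega,
    show k - 1 = e + (k - e - 1) by omega, pow_add]
  ring

theorem hTower_top (hk : 1 ≤ k) (x y : ℝ) : hTower w k x k y = 0 := by
  rw [hTower, dualTower_of_lt x (by omega), mul_zero]

theorem LStar_eventuallyEq {f g : ℝ → ℝ} {y : ℝ}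
    (hfg : f =ᶠ[𝓝[Icc a b] y] g) (e : ℕ) :
    LStar w a b k e f =ᶠ[𝓝[Icc a b] y] LStar w a b k e g := by
  induction e with
  | zero => exact hfg
  | succ e ih =>
    filter_upwards [eventually_eventually_nhdsWithin.2 ih, self_mem_nhdsWithin] with x hx hxI
    change derivWithin _ _ _ / _ = derivWithin _ _ _ / _
    rw [Filter.EventuallyEq.derivWithin_eq hx (hx.self_of_nhdsWithin hxI)]

/-- Away from the diagonal, `L*_e` lowers the order of `g_k(x, ·)` up to sign. -/
theorem LStar_gFun (hw : WeightsIn a b k m B w) {x y : ℝ} (hx : x ∈ Icc a b)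
    (hy : y ∈ Icc a b) {e : ℕ} (he : e < k) (hxy : e = 0 ∨ x ≠ y) :
    LStar w a b k e (fun y => gFun w k x y) y = (-1) ^ e * gFun w (k - e) x y := by
  rcases hxy with rfl | hne
  · simp [LStar]
  rcases lt_or_gt_of_ne hne with h | h
  · have h1 : (fun y => gFun w k x y) =ᶠ[𝓝[Icc a b] y] fun _ => 0 := by
      filter_upwards [mem_nhdsWithin_of_mem_nhds (Ioi_mem_nhds h)] with s hs
      rw [gFun, if_neg (not_le.2 hs)]
    rw [(LStar_eventuallyEq h1 e).self_of_nhdsWithin hy]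
    have h0 : IsTower w a b k k (fun _ _ => 0) := fun _ _ y _ => by
      simpa using hasDerivWithinAt_const y (Icc a b) (0 : ℝ)
    rw [h0.LStar_eq hw le_rfl (fun _ _ => rfl) e he.le y hy, gFun, if_neg (not_le.2 h), mul_zero]
  · have h1 : (fun y => gFun w k x y) =ᶠ[𝓝[Icc a b] y] fun y => hFun w k x y := by
      filter_upwards [mem_nhdsWithin_of_mem_nhds (Iio_mem_nhds h)] with s hs
      rw [gFun, if_pos (le_of_lt hs)]
    rw [(LStar_eventuallyEq h1 e).self_of_nhdsWithin hy,
      (isTower_hTower hw hx k).LStar_eq hw le_rfl (fun y hy => by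
        rw [hTower_eq hw hx hy (by omega)]; simp) e he.le y hy,
      hTower_eq hw hx hy he, gFun, if_pos h.le]

/-- Taylor's formula for the dual system. -/
theorem IsTower.taylor (hw : WeightsIn a b k m B w) {F : ℕ → ℝ → ℝ} (hF : IsTower w a b k k F)
    (h0 : ∀ y ∈ Icc a b, F k y = 0) {z : ℝ} (hz : z ∈ Icc a b) {e : ℕ} (he : e ≤ k) :
    ∀ y ∈ Icc a b, F e y = ∑ r ∈ Finset.range k, F r z * dualTower w z k r e y := by
  set G : ℕ → ℝ → ℝ := fun e y =>
    F e y - ∑ r ∈ Finset.range k, F r z * dualTower w z k r e y with hG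
  have hGt : IsTower w a b k k G := hF.sub (IsTower.sum _ fun r hr =>
    (isTower_dualTower hw hz (Finset.mem_range.1 hr).le k).const_mul _)
  have hGk : ∀ y ∈ Icc a b, G k y = 0 := by
    intro y hy
    simp only [hG]
    rw [h0 y hy, Finset.sum_eq_zero, sub_zero]
    intro r hr
    rw [dualTower_of_lt z (Finset.mem_range.1 hr), mul_zero]
  have hGz : ∀ e < k, G e z = 0 := by
    intro e he
    simp only [hG, dualTower_base]
    simp [he]
  have key : ∀ d ≤ k, ∀ y ∈ Icc a b, G (k - d) y = 0 := by
    intro d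
    induction d with
    | zero => intro _; simpa using hGk
    | succ d ih =>
      intro hd y hy
      have hz' : ∀ s ∈ Icc a b, G (k - (d + 1) + 1) s = 0 := by
        rw [show k - (d + 1) + 1 = k - d by omega]; exact ih (by omega)
      have := hGt.integral_eq hw le_rfl (e := k - (d + 1)) (by omega)
        (continuousOn_const.congr hz') hz hy
      rw [intervalIntegral.integral_congr (g := fun _ => 0), intervalIntegral.integral_zero,
        hGz _ (by omega), sub_zero] at this
      · exact this.symm
      · intro s hs
        simp only
        rw [hz' s (uIcc_subset_Icc hz hy hs), mul_zero]
  intro y hy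
  have := key (k - e) (by omega) y hy
  rw [show k - (k - e) = e by omega] at this
  exact sub_eq_zero.1 this

/-- The addition formula, which moves the base point of `h_k(x, ·)` and its derivatives. -/
theorem hFun_addition (hw : WeightsIn a b k m B w) {x y z : ℝ} (hx : x ∈ Icc a b)
    (hy : y ∈ Icc a b) (hz : z ∈ Icc a b) {d : ℕ} (hd : d < k) :
    (-1) ^ d * hFun w (k - d) x y =
      ∑ e ∈ Finset.range k, (-1) ^ e * hFun w (k - e) x z * dualTower w z k e d y := by
  rw [← hTower_eq hw hx hy hd, (isTower_hTower hw hx k).taylor hw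
    (fun y _ => hTower_top (by omega) x y) hz hd.le y hy]
  refine Finset.sum_congr rfl fun e he => ?_
  rw [hTower_eq hw hx hz (Finset.mem_range.1 he)]

theorem integral_gFun_mul (hw : WeightsIn a b k m B w) {y : ℝ} (hy : y ∈ Icc a b) {f : ℝ → ℝ}
    (hf : ContinuousOn f (Icc a b)) {j : ℕ} (hj1 : 1 ≤ j) (hj : j ≤ k) :
    IntervalIntegrable (fun x => gFun w j x y * f x) volume a b ∧
    ∫ x in a..b, gFun w j x y * f x = (-1) ^ j * primitives w b f 0 j y := by
  have hb : b ∈ Icc a b := right_mem_Icc.2 hw.lt.le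
  have ha : a ∈ Icc a b := left_mem_Icc.2 hw.lt.le
  have hc : ContinuousOn (fun x => hFun w j x y * f x) (Icc a b) :=
    (continuousOn_iterInt hw hy (j - 1) 1 le_rfl (by omega)).mul hf
  have hi1 : IntervalIntegrable (fun x => gFun w j x y * f x) volume a y := by
    refine (intervalIntegrable_const (c := (0 : ℝ))).congr_ae ?_
    rw [uIoc_of_le hy.1]
    refine (ae_restrict_iff' measurableSet_Ioc).2 ?_
    filter_upwards [compl_mem_ae_iff.2 (measure_singleton y)] with x hx1 hx2
    rw [gFun, if_neg (not_le.2 (lt_of_le_of_ne hx2.2 hx1)), zero_mul]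
  have hi2 : IntervalIntegrable (fun x => gFun w j x y * f x) volume y b := by
    refine ((hc.mono (uIcc_subset_Icc hy hb)).intervalIntegrable).congr fun x hx => ?_
    rw [uIoc_of_le hy.2] at hx
    simp only [gFun, if_pos hx.1.le]
  refine ⟨hi1.trans hi2, ?_⟩
  rw [← intervalIntegral.integral_add_adjacent_intervals hi1 hi2]
  have e1 : ∫ x in a..y, gFun w j x y * f x = 0 := by
    rw [intervalIntegral.integral_of_le hy.1, integral_Ioc_eq_integral_Ioo]
    refine setIntegral_eq_zero_of_forall_eq_zero fun x hx => ?_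
    rw [gFun, if_neg (not_le.2 hx.2), zero_mul]
  have e2 : ∫ x in y..b, gFun w j x y * f x = ∫ x in y..b, hFun w j x y * f x := by
    refine intervalIntegral.integral_congr fun x hx => ?_
    rw [uIcc_of_le hy.2] at hx
    simp only [gFun, if_pos hx.1]
  have h := integral_iterInt_mul_primitives hw hb hy hf (q := 0) (j - 1) 0 (by omega)
  have p0 : primitives w b f 0 0 = f := rfl
  simp only [p0, Nat.zero_add] at h
  rw [show j - 1 + 1 = j by omega] at h
  rw [e1, e2, zero_add, intervalIntegral.integral_symm]
  simp only [hFun]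
  rw [h]
  obtain ⟨i, rfl⟩ : ∃ i, j = i + 1 := ⟨j - 1, by omega⟩
  rw [Nat.add_sub_cancel, pow_succ]
  ring

end Kernels

/-! ### The functions `φ` and the numbers `α` -/

section Phi

variable {w : ℕ → ℝ → ℝ} {a b m B : ℝ} {k : ℕ}

/-- `c` holds the coefficients of the function with leading coefficient `1` in the span of
`u*_1, …, u*_{s+1}` that vanishes at `τ_0, …, τ_{s-1}`, multiplicities included. -/
def IsPhiCoeff (w : ℕ → ℝ → ℝ) (a : ℝ) (k s : ℕ) (τ : ℕ → ℝ) (c : ℕ → ℝ) : Prop :=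
  c s = 1 ∧ ∀ l < s, spanTower w a k (s + 1) c (mult τ l) (τ l) = 0

theorem exists_isPhiCoeff (hw : WeightsIn a b k m B w) {s : ℕ} (hs : s ≤ k) {τ : ℕ → ℝ}
    (hτ : ∀ i, i + 1 < s → τ i ≤ τ (i + 1)) (hI : ∀ i < s, τ i ∈ Icc a b) :
    ∃ c, IsPhiCoeff w a k s τ c := by
  have hdet := collocation_det_ne_zero hw (R := s) (by omega) hτ hI
  set v : Fin s → ℝ := fun l => -dualTower w a k s (mult τ l) (τ l) with hv
  set e := (collocation w a k s τ)⁻¹.mulVec v with he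
  have hAe : (collocation w a k s τ).mulVec e = v := by
    rw [he, Matrix.mulVec_mulVec, Matrix.mul_nonsing_inv _ (isUnit_iff_ne_zero.2 hdet),
      Matrix.one_mulVec]
  refine ⟨fun r => if h : r < s then e ⟨r, h⟩ else 1, by simp, fun l hl => ?_⟩
  have := congrFun hAe ⟨l, hl⟩
  simp only [Matrix.mulVec, dotProduct, collocation, Matrix.of_apply, hv] at this
  rw [spanTower, Finset.sum_range_succ, Finset.sum_range]
  simp only [Fin.is_lt, dite_true, Fin.eta, lt_irrefl, dite_false, one_mul]
  rw [← eq_neg_iff_add_eq_zero, ← this]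
  exact Finset.sum_congr rfl fun j _ => mul_comm _ _

theorem isPhi_iff (hw : WeightsIn a b k m B w) {t : ℕ → ℝ} {i s : ℕ} (hs : s ≤ k)
    (hI : ∀ l < s, t (i + l) ∈ Icc a b) {φ : ℝ → ℝ} :
    IsPhi w a b k t i (s + 1) φ ↔ ∃ c, IsPhiCoeff w a k s (fun l => t (i + l)) c ∧
      EqOn φ (spanTower w a k (s + 1) c 0) (Icc a b) := by
  have hL : ∀ c, EqOn φ (spanTower w a k (s + 1) c 0) (Icc a b) → ∀ l < s,
      LStar w a b k (mult (fun l => t (i + l)) l) φ (t (i + l)) =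
        spanTower w a k (s + 1) c (mult (fun l => t (i + l)) l) (t (i + l)) := by
    intro c hc l hl
    have := mult_le (fun l => t (i + l)) l
    exact (isTower_spanTower hw (by omega) c k).LStar_eq hw le_rfl hc _ (by omega) _ (hI l hl)
  have hu : ∀ (j : ℕ) (x : ℝ), uStar w a k (1 + j) x = dualTower w a k j 0 x := by
    intro j x
    rw [dualTower_zero, uStar, Nat.add_sub_cancel_left]
  constructor
  · rintro ⟨⟨c, hc⟩, h0⟩
    have hEq : EqOn φ (spanTower w a k (s + 1) (fun r => if r = s then 1 else c (1 + r)) 0)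
        (Icc a b) := by
      intro x hx
      rw [hc x hx, spanTower, Finset.sum_range_succ, if_pos rfl, one_mul, add_comm s 1, hu,
        Finset.sum_Ico_eq_sum_range, add_comm]
      congr 1
      refine Finset.sum_congr (by simp) fun r hr => ?_
      rw [hu, if_neg (Finset.mem_range.1 hr).ne]
    refine ⟨_, ⟨by simp, fun l hl => ?_⟩, hEq⟩
    rw [← hL _ hEq l hl]
    exact h0 l (by omega)
  · rintro ⟨c, ⟨hc1, hc0⟩, hEq⟩
    refine ⟨⟨fun j => c (j - 1), fun x hx => ?_⟩, fun l hl => ?_⟩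
    · rw [hEq hx, spanTower, Finset.sum_range_succ, hc1, one_mul, add_comm s 1, hu,
        Finset.sum_Ico_eq_sum_range, add_comm]
      congr 1
      refine Finset.sum_congr (by simp) fun r hr => ?_
      simp only [hu, Nat.add_sub_cancel_left]
    · rw [hL c hEq l (by omega)]
      exact hc0 l (by omega)

/-- `L*_e φ` has a zero among the `τ_i` for each `e < s` and `L*_s φ = 1`, so integrating `s - e`
times bounds `L*_e φ`. -/
theorem IsPhiCoeff.abs_le (hw : WeightsIn a b k m B w) {s : ℕ} (hs : s ≤ k) {τ c : ℕ → ℝ}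
    (hc : IsPhiCoeff w a k s τ c) (hτ : ∀ i, i + 1 < s → τ i ≤ τ (i + 1)) {p q : ℝ}
    (hpq : Icc p q ⊆ Icc a b) (hI : ∀ i < s, τ i ∈ Icc p q) {e : ℕ} (he : e ≤ s) :
    ∀ y ∈ Icc p q, |spanTower w a k (s + 1) c e y| ≤ (B * (q - p)) ^ (s - e) := by
  have hT := isTower_spanTower hw (R := s + 1) (by omega) c k
  obtain ⟨d, hd⟩ : ∃ d, d = s - e := ⟨_, rfl⟩
  induction d generalizing e with
  | zero =>
    intro y _
    obtain rfl : e = s := by omega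
    rw [spanTower_top, hc.1]; simp
  | succ d ih =>
    intro y hy
    obtain ⟨ξ, hξ, hξ0⟩ := exists_zero_of_tower (r := e) (τ := τ) hw (by omega)
      (hT.mono (by omega)) (fun i hi => hτ i (by omega)) (hpq (hI 0 (by omega))).1
      (hpq (hI e (by omega))).2 (fun i hi => hc.2 i (by omega))
    have hξI : ξ ∈ Icc p q :=
      ⟨(hI 0 (by omega)).1.trans hξ.1, hξ.2.trans (hI e (by omega)).2⟩
    have hcont : ContinuousOn (spanTower w a k (s + 1) c (e + 1)) (Icc a b) :=
      (isTower_spanTower hw (R := s + 1) (by omega) c (e + 2)).continuousOn (by omega)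
    have hint := hT.integral_eq hw le_rfl (e := e) (by omega) hcont (hpq hξI) (hpq hy)
    rw [hξ0, sub_zero] at hint
    have hB : 0 ≤ B := by
      have h1 := hw.ge k (by omega) le_rfl y (hpq hy)
      have h2 := hw.le k (by omega) le_rfl y (hpq hy)
      linarith [hw.pos]
    have hpq' : 0 ≤ q - p := sub_nonneg.2 (hy.1.trans hy.2)
    rw [← hint, ← Real.norm_eq_abs]
    refine (intervalIntegral.norm_integral_le_of_norm_le_const
      (C := B * (B * (q - p)) ^ (s - (e + 1))) fun x hx => ?_).trans ?_
    · have hxI : x ∈ Icc p q := uIcc_subset_Icc hξI hy (uIoc_subset_uIcc hx)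
      have h1 := hw.ge (k - e) (by omega) (by omega) x (hpq hxI)
      have h2 := hw.le (k - e) (by omega) (by omega) x (hpq hxI)
      rw [norm_mul, Real.norm_eq_abs, Real.norm_eq_abs, abs_of_pos (hw.pos.trans_le h1)]
      exact mul_le_mul h2 (ih (by omega) (by omega) x hxI) (abs_nonneg _) hB
    · rw [show s - e = s - (e + 1) + 1 by omega, pow_succ]
      have : |y - ξ| ≤ q - p := abs_sub_le_iff.2 ⟨by linarith [hy.2, hξI.1], by
        linarith [hy.1, hξI.2]⟩
      have h3 : 0 ≤ B * (B * (q - p)) ^ (s - (e + 1)) := by positivity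
      calc _ ≤ B * (B * (q - p)) ^ (s - (e + 1)) * (q - p) := by gcongr
        _ = _ := by ring

theorem IsPhiCoeff.nonneg (hw : WeightsIn a b k m B w) {s : ℕ} (hs : s ≤ k) {τ c : ℕ → ℝ}
    (hc : IsPhiCoeff w a k s τ c) (hτ : ∀ i, i + 1 < s → τ i ≤ τ (i + 1))
    (hI : ∀ i < s, τ i ∈ Icc a b) {e : ℕ} (he : e ≤ s) {y : ℝ} (hy : y ∈ Icc a b)
    (hyτ : ∀ i < s, τ i ≤ y) : 0 ≤ spanTower w a k (s + 1) c e y :=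
  tower_nonneg_of_zeros hw hs (isTower_spanTower hw (by omega) c s) hτ hI hc.2
    (fun y _ => by rw [spanTower_top, hc.1]; exact zero_le_one) e he y hy hyτ

theorem mult_succ_eq_shift (τ : ℕ → ℝ) (l : ℕ) :
    mult τ (l + 1) = mult (fun l => τ (l + 1)) l + if τ 0 = τ (l + 1) then 1 else 0 := by
  simp only [mult, Finset.card_filter]
  rw [Finset.sum_range_succ']

theorem mult_eq_of_le {τ : ℕ → ℝ} {l s : ℕ} (hτ : ∀ i, i + 1 < s → τ i ≤ τ (i + 1))
    (hl : l + 1 < s) (h : τ 0 = τ (l + 1)) : mult (fun l => τ (l + 1)) l = mult τ l ∧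
      τ l = τ (l + 1) := by
  have hmono : ∀ {i j}, i ≤ j → j ≤ s - 1 → τ i ≤ τ j := fun h1 h2 =>
    mono_of_le_succ (fun i hi => hτ i (by omega)) h1 h2
  have h1 : τ l = τ (l + 1) :=
    le_antisymm (hτ l hl) (h ▸ hmono (Nat.zero_le l) (by omega))
  have h2 := mult_succ_eq_shift τ l
  rw [mult_succ_of_eq h1, if_pos h] at h2
  exact ⟨by omega, h1⟩

/-- Dropping the first point of a list keeps the other zeros, as their multiplicities only drop. -/
theorem zeros_tail {F : ℕ → ℝ → ℝ} {τ : ℕ → ℝ} {s : ℕ} (hτ : ∀ i, i + 1 < s → τ i ≤ τ (i + 1))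
    (h : ∀ l < s, F (mult τ l) (τ l) = 0) {l : ℕ} (hl : l + 1 < s) :
    F (mult (fun l => τ (l + 1)) l) (τ (l + 1)) = 0 := by
  by_cases h0 : τ 0 = τ (l + 1)
  · obtain ⟨h1, h2⟩ := mult_eq_of_le hτ hl h0
    rw [h1, ← h2]
    exact h l (by omega)
  · have h1 := mult_succ_eq_shift τ l
    rw [if_neg h0, add_zero] at h1
    rw [← h1]
    exact h (l + 1) hl

end Phi

section Partition

variable {a b : ℝ} {k n : ℕ} {t : ℕ → ℝ}

theorem IsPartition.le_succ (h : IsPartition a b k n t) {i : ℕ} (hi : i < n + k) :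
    t i ≤ t (i + 1) := by
  by_cases h1 : k ≤ i + 1
  · by_cases h2 : i ≤ n
    · exact (h.lt i h1 h2).le
    · rw [h.right i (by omega) (by omega), h.right (i + 1) (by omega) (by omega)]
  · rw [h.left i (by omega), h.left (i + 1) (by omega)]

theorem IsPartition.mono (h : IsPartition a b k n t) {i j : ℕ} (hij : i ≤ j) (hj : j ≤ n + k) :
    t i ≤ t j := mono_of_le_succ (τ := t) (fun _ hi => h.le_succ hi) hij hj

theorem IsPartition.mem_Icc (h : IsPartition a b k n t) (hk : 1 ≤ k) {i : ℕ} (hi : i ≤ n + k) :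
    t i ∈ Icc a b := by
  rw [← h.left 0 (by omega), ← h.right (n + k) (by omega) le_rfl]
  exact ⟨h.mono (Nat.zero_le i) hi, h.mono hi le_rfl⟩

theorem IsPartition.lt_add (h : IsPartition a b k n t) (hk : 1 ≤ k) {i : ℕ} (hi : i ≤ n) :
    t i < t (i + k) := by
  have hn := h.le
  calc t i ≤ t (max i (k - 1)) := h.mono (le_max_left _ _) (by omega)
    _ < t (max i (k - 1) + 1) := h.lt _ (by omega) (by omega)
    _ ≤ t (i + k) := h.mono (by omega) (by omega)

end Partition

section Alpha

variable {w : ℕ → ℝ → ℝ} {a b m B : ℝ} {k n : ℕ} {t : ℕ → ℝ}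

/-- The defining property of `α_i`, for all `L*_e` of the functions `φ` involved. -/
theorem exists_alpha_spec (hw : WeightsIn a b k m B w) (hk : 1 ≤ k) (ht : IsPartition a b k n t)
    {i : ℕ} (hi : i ≤ n) : ∃ c₀ c₁ c₂ : ℕ → ℝ,
      IsPhiCoeff w a k k (fun l => t (i + l)) c₀ ∧
      IsPhiCoeff w a k k (fun l => t (i + 1 + l)) c₁ ∧
      IsPhiCoeff w a k (k - 1) (fun l => t (i + 1 + l)) c₂ ∧
      ∀ e ≤ k, ∀ y ∈ Icc a b, spanTower w a k (k + 1) c₀ e y - spanTower w a k (k + 1) c₁ e y =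
        alpha w a b k t i * spanTower w a k k c₂ e y := by
  obtain ⟨K, rfl⟩ : ∃ K, k = K + 1 := ⟨k - 1, by omega⟩
  have hmono0 : ∀ l, l + 1 < K + 1 → t (i + l) ≤ t (i + (l + 1)) := fun l hl =>
    ht.le_succ (by omega)
  have hmono1 : ∀ l, l + 1 < K + 1 → t (i + 1 + l) ≤ t (i + 1 + (l + 1)) := fun l hl =>
    ht.le_succ (by omega)
  have hI0 : ∀ l < K + 1, t (i + l) ∈ Icc a b := fun l hl => ht.mem_Icc hk (by omega)
  have hI1 : ∀ l < K + 1, t (i + 1 + l) ∈ Icc a b := fun l hl => ht.mem_Icc hk (by omega)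
  have hex : ∃ α : ℝ, ∃ φ₀ φ₁ φ₂ : ℝ → ℝ,
      IsPhi w a b (K + 1) t i (K + 1 + 1) φ₀ ∧ IsPhi w a b (K + 1) t (i + 1) (K + 1 + 1) φ₁ ∧
      IsPhi w a b (K + 1) t (i + 1) (K + 1) φ₂ ∧ ∀ x ∈ Icc a b, φ₀ x - φ₁ x = α * φ₂ x := by
    obtain ⟨c₀, h₀⟩ := exists_isPhiCoeff hw le_rfl hmono0 hI0
    obtain ⟨c₁, h₁⟩ := exists_isPhiCoeff hw le_rfl hmono1 hI1
    obtain ⟨c₂, h₂⟩ := exists_isPhiCoeff hw (s := K) (by omega)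
      (τ := fun l => t (i + 1 + l)) (fun l hl => hmono1 l (by omega))
      (fun l hl => hI1 l (by omega))
    -- `d` has no component along the last two dual functions, and `K` zeros
    set d : ℕ → ℝ := fun r => c₀ r - c₁ r - (c₀ K - c₁ K) * c₂ r with hd
    have hsplit : ∀ e y, spanTower w a (K + 1) K d e y =
        spanTower w a (K + 1) (K + 1 + 1) c₀ e y - spanTower w a (K + 1) (K + 1 + 1) c₁ e y -
          (c₀ K - c₁ K) * spanTower w a (K + 1) (K + 1) c₂ e y := by
      intro e y
      simp only [spanTower, Finset.sum_range_succ, h₀.1, h₁.1, h₂.1]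
      have : ∑ r ∈ Finset.range K, d r * dualTower w a (K + 1) r e y =
          ∑ r ∈ Finset.range K, c₀ r * dualTower w a (K + 1) r e y -
          ∑ r ∈ Finset.range K, c₁ r * dualTower w a (K + 1) r e y -
          (c₀ K - c₁ K) * ∑ r ∈ Finset.range K, c₂ r * dualTower w a (K + 1) r e y := by
        rw [Finset.mul_sum, ← Finset.sum_sub_distrib, ← Finset.sum_sub_distrib]
        exact Finset.sum_congr rfl fun r _ => by simp only [hd]; ring
      rw [this]; ring
    have hd0 := spanTower_coeff_eq_zero hw (τ := fun l => t (i + 1 + l)) d K (by omega)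
      (fun l hl => hmono1 l (by omega)) (fun l hl => hI1 l (by omega)) (by
        intro l hl
        have e0 := zeros_tail (τ := fun l => t (i + l)) hmono0 h₀.2 (l := l) (by omega)
        have e1 : (fun l => t (i + (l + 1))) = fun l => t (i + 1 + l) := by
          ext l; rw [add_comm l 1, add_assoc]
        rw [e1] at e0
        rw [show i + (l + 1) = i + 1 + l by omega] at e0
        rw [hsplit, e0, h₁.2 l (by omega), h₂.2 l hl]
        ring)
    refine ⟨c₀ K - c₁ K, _, _, _, (isPhi_iff hw le_rfl hI0).2 ⟨c₀, h₀, fun _ _ => rfl⟩,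
      (isPhi_iff hw le_rfl hI1).2 ⟨c₁, h₁, fun _ _ => rfl⟩,
      (isPhi_iff hw (by omega) (fun l hl => hI1 l (by omega))).2 ⟨c₂, h₂, fun _ _ => rfl⟩,
      fun x _ => ?_⟩
    have := hsplit 0 x
    rw [spanTower, Finset.sum_eq_zero (fun r hr => by
      rw [hd0 r (Finset.mem_range.1 hr), zero_mul])] at this
    linarith
  obtain ⟨φ₀, φ₁, φ₂, p₀, p₁, p₂, hφ⟩ := Classical.epsilon_spec hex
  change ∀ x ∈ Icc a b, φ₀ x - φ₁ x = alpha w a b (K + 1) t i * φ₂ x at hφ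
  obtain ⟨c₀, h₀, e₀⟩ := (isPhi_iff hw le_rfl hI0).1 p₀
  obtain ⟨c₁, h₁, e₁⟩ := (isPhi_iff hw le_rfl hI1).1 p₁
  obtain ⟨c₂, h₂, e₂⟩ := (isPhi_iff hw (by omega) (fun l hl => hI1 l (by omega))).1 p₂
  refine ⟨c₀, c₁, c₂, h₀, h₁, h₂, fun e he y hy => ?_⟩
  have T0 := (isTower_spanTower hw le_rfl c₀ (K + 1)).sub (isTower_spanTower hw le_rfl c₁ (K + 1))
  have T1 := (isTower_spanTower hw (Nat.le_succ (K + 1)) c₂ (K + 1)).const_mul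
    (alpha w a b (K + 1) t i)
  rw [← T0.LStar_eq hw le_rfl (fun _ _ => rfl) e he y hy,
    T1.LStar_eq hw le_rfl (fun x hx => ?_) e he y hy]
  rw [← e₀ hx, ← e₁ hx, ← e₂ hx]
  exact hφ x hx

theorem alpha_le (hw : WeightsIn a b k m B w) (hk : 1 ≤ k) (ht : IsPartition a b k n t)
    {i : ℕ} (hi : i ≤ n) : alpha w a b k t i ≤ 2 * B * (t (i + k) - t i) := by
  obtain ⟨c₀, c₁, c₂, h₀, h₁, h₂, h⟩ := exists_alpha_spec hw hk ht hi
  have hik := (ht.lt_add hk hi).le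
  have hsub : Icc (t i) (t (i + k)) ⊆ Icc a b :=
    Icc_subset_Icc (ht.mem_Icc hk (by omega)).1 (ht.mem_Icc hk (by omega)).2
  have b₀ := h₀.abs_le hw le_rfl (fun l hl => ht.le_succ (by omega)) hsub
    (fun l hl => ⟨ht.mono (by omega) (by omega), ht.mono (by omega) (by omega)⟩)
    (Nat.sub_le k 1) (t i) ⟨le_rfl, hik⟩
  have b₁ := h₁.abs_le hw le_rfl (fun l hl => ht.le_succ (by omega)) hsub
    (fun l hl => ⟨ht.mono (by omega) (by omega), ht.mono (by omega) (by omega)⟩)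
    (Nat.sub_le k 1) (t i) ⟨le_rfl, hik⟩
  have := h (k - 1) (Nat.sub_le k 1) (t i) (ht.mem_Icc hk (by omega))
  have htop := spanTower_top (w := w) (a := a) (k := k) (k - 1) c₂ (t i)
  rw [Nat.sub_add_cancel hk, h₂.1] at htop
  rw [htop, mul_one] at this
  rw [show k - (k - 1) = 1 by omega, pow_one] at b₀ b₁
  rw [← this]
  linarith [(abs_le.1 b₀).2, (abs_le.1 b₁).1]

/-- `φ_{i+1,k+1}` vanishes at `t_{i+k}`, to the order counted from `t_i`, and there the relation
between the functions `φ` determines `α_i`. -/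
theorem alpha_pos_of_spec (hw : WeightsIn a b k m B w) (hk : 1 ≤ k) (ht : IsPartition a b k n t)
    {i : ℕ} (hi : i ≤ n) {c₀ c₁ c₂ : ℕ → ℝ}
    (h₀ : IsPhiCoeff w a k k (fun l => t (i + l)) c₀)
    (h₁ : IsPhiCoeff w a k k (fun l => t (i + 1 + l)) c₁)
    (h₂ : IsPhiCoeff w a k (k - 1) (fun l => t (i + 1 + l)) c₂)
    (h : ∀ e ≤ k, ∀ y ∈ Icc a b, spanTower w a k (k + 1) c₀ e y -
      spanTower w a k (k + 1) c₁ e y = alpha w a b k t i * spanTower w a k k c₂ e y) :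
    0 < alpha w a b k t i ∧
    spanTower w a k (k + 1) c₀ (mult (fun l => t (i + l)) k) (t (i + k)) =
      alpha w a b k t i * spanTower w a k k c₂ (mult (fun l => t (i + l)) k) (t (i + k)) := by
  have hlt := ht.lt_add hk hi
  have hI := ht.mem_Icc hk (i := i + k) (by omega)
  set d := mult (fun l => t (i + l)) k with hd
  have e1 : (fun l => t (i + (l + 1))) = fun l => t (i + 1 + l) := by
    ext l; rw [add_comm l 1, add_assoc]
  have hd' : d = mult (fun l => t (i + 1 + l)) (k - 1) := by
    have := mult_succ_eq_shift (fun l => t (i + l)) (k - 1)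
    rw [Nat.sub_add_cancel hk, if_neg (by simpa using hlt.ne), e1] at this
    simpa using this
  have hdk : d ≤ k - 1 := hd' ▸ mult_le _ _
  have hz : spanTower w a k (k + 1) c₁ d (t (i + k)) = 0 := by
    have := h₁.2 (k - 1) (by omega)
    simp only [show i + 1 + (k - 1) = i + k by omega] at this
    rwa [← hd'] at this
  have hmain := h d (by omega) _ hI
  rw [hz, sub_zero] at hmain
  refine ⟨?_, hmain⟩
  have p₀ := h₀.nonneg hw le_rfl (fun l hl => ht.le_succ (by omega))
    (fun l hl => ht.mem_Icc hk (by omega)) (show d ≤ k by omega) hI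
    (fun l hl => ht.mono (by omega) (by omega))
  have p₂ := h₂.nonneg hw (by omega) (fun l hl => ht.le_succ (by omega))
    (fun l hl => ht.mem_Icc hk (by omega)) hdk hI
    (fun l hl => ht.mono (by omega) (by omega))
  rw [Nat.sub_add_cancel hk] at p₂
  have hne : spanTower w a k (k + 1) c₀ d (t (i + k)) ≠ 0 := by
    intro h0
    have := spanTower_coeff_eq_zero hw (τ := fun l => t (i + l)) c₀ (k + 1) le_rfl
      (fun l hl => ht.le_succ (by omega)) (fun l hl => ht.mem_Icc hk (by omega)) (by
        intro l hl
        rcases Nat.lt_succ_iff_lt_or_eq.1 hl with hl | rfl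
        · exact h₀.2 l hl
        · exact h0) k (by omega)
    rw [h₀.1] at this
    exact one_ne_zero this
  have hpos : 0 < alpha w a b k t i * spanTower w a k k c₂ d (t (i + k)) :=
    hmain ▸ lt_of_le_of_ne p₀ hne.symm
  exact pos_of_mul_pos_left hpos p₂

theorem alpha_pos (hw : WeightsIn a b k m B w) (hk : 1 ≤ k) (ht : IsPartition a b k n t)
    {i : ℕ} (hi : i ≤ n) : 0 < alpha w a b k t i := by
  obtain ⟨c₀, c₁, c₂, h₀, h₁, h₂, h⟩ := exists_alpha_spec hw hk ht hi
  exact (alpha_pos_of_spec hw hk ht hi h₀ h₁ h₂ h).1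

end Alpha

/-! ### B-splines: explicit form, support, positivity -/

section Grid

variable {a b : ℝ} {k n : ℕ} {t : ℕ → ℝ}

theorem exists_mem_Ioo_of_ne {t : ℕ → ℝ} {x : ℝ} {p q : ℕ} (hpq : p ≤ q) (hp : t p < x)
    (hq : x < t q) (hne : ∀ i, p ≤ i → i ≤ q → x ≠ t i) :
    ∃ j, p ≤ j ∧ j < q ∧ x ∈ Ioo (t j) (t (j + 1)) := by
  induction q, hpq using Nat.le_induction with
  | base => exact absurd (hp.trans hq) (lt_irrefl _)
  | succ q hpq ih =>
    rcases lt_or_gt_of_ne (hne q hpq (Nat.le_succ q)) with h | h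
    · obtain ⟨j, h1, h2, h3⟩ := ih h fun i h1 h2 => hne i h1 (by omega)
      exact ⟨j, h1, by omega, h3⟩
    · exact ⟨q, hpq, Nat.lt_succ_self q, h, hq⟩

/-- Almost every point lies in an open grid interval. -/
theorem IsPartition.ae_mem_Ioo (ht : IsPartition a b k n t) (hk : 1 ≤ k) :
    ∀ᵐ x ∂measI a b, x ∈ Ioo a b ∧ ∃ j, k ≤ j + 1 ∧ j ≤ n ∧ x ∈ Ioo (t j) (t (j + 1)) := by
  have hfin : (volume : Measure ℝ) (t '' Iic (n + k)) = 0 :=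
    ((finite_Iic (n + k)).image t).measure_zero _
  rw [ae_restrict_iff' measurableSet_Icc]
  filter_upwards [compl_mem_ae_iff.2 hfin] with x hx hxI
  have hn := ht.le
  have hne : ∀ i ≤ n + k, x ≠ t i := fun i hi h => hx ⟨i, hi, h.symm⟩
  have hl : t (k - 1) = a := ht.left _ (by omega)
  have hr : t (n + 1) = b := ht.right _ le_rfl (by omega)
  have h1 : a < x := lt_of_le_of_ne hxI.1 (hl ▸ (hne (k - 1) (by omega)).symm)
  have h2 : x < b := lt_of_le_of_ne hxI.2 (hr ▸ hne (n + 1) (by omega))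
  obtain ⟨j, j1, j2, j3⟩ := exists_mem_Ioo_of_ne (t := t) (p := k - 1) (q := n + 1) (by omega)
    (hl ▸ h1) (hr ▸ h2) (fun i _ h => hne i (by omega))
  exact ⟨⟨h1, h2⟩, j, by omega, by omega, j3⟩

theorem IsPartition.mult_lt (ht : IsPartition a b k n t) (hk : 1 ≤ k) {i : ℕ} (hi : i ≤ n)
    {l : ℕ} (hl : l ≤ k) : mult (fun l => t (i + l)) l < k := by
  rcases hl.lt_or_eq with hl | rfl
  · exact (mult_le _ _).trans_lt hl
  · have h1 := mult_succ_eq_shift (fun j => t (i + j)) (l - 1)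
    rw [Nat.sub_add_cancel hk, if_neg (by simpa using (ht.lt_add hk hi).ne)] at h1
    have := mult_le (fun j => t (i + (j + 1))) (l - 1)
    omega

theorem IsPartition.eq_or_of_mult_ne_zero (ht : IsPartition a b k n t) {i l : ℕ} (hl : l ≤ k)
    (hi : i ≤ n) (h : mult (fun l => t (i + l)) l ≠ 0) : t (i + l) = a ∨ t (i + l) = b := by
  have : ∃ j < l, t (i + j) = t (i + l) := by
    by_contra! hcon
    exact h (mult_eq_zero hcon)
  obtain ⟨j, hj, he⟩ := this
  rw [← he]
  by_cases h1 : i + j < k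
  · exact Or.inl (ht.left _ h1)
  by_cases h2 : i + j ≤ n
  · have h3 := ht.lt (i + j) (by omega) h2
    have h4 := ht.mono (show i + j + 1 ≤ i + l by omega) (by omega)
    exact absurd he (h3.trans_le h4).ne
  · exact Or.inr (ht.right _ (by omega) (by omega))

end Grid

section BSpline

variable {w : ℕ → ℝ → ℝ} {a b m B : ℝ} {k n : ℕ} {t : ℕ → ℝ}

/-- The B-spline `M_i` as an explicit combination of the functions `g_{k-d}(·, t_l)`. It agrees
with `M_i` on the open interval `(a, b)`. -/
noncomputable def bForm (w : ℕ → ℝ → ℝ) (a : ℝ) (k : ℕ) (t : ℕ → ℝ) (i : ℕ) (x : ℝ) : ℝ :=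
  (-1) ^ k * ∑ l : Fin (k + 1), ddCoeff w a k (fun l => t (i + l)) l *
    ((-1) ^ mult (fun l => t (i + l)) l *
      gFun w (k - mult (fun l => t (i + l)) l) x (t (i + l)))

theorem bSpline_eq_bForm (hw : WeightsIn a b k m B w) (hk : 1 ≤ k) (ht : IsPartition a b k n t)
    {i : ℕ} (hi : i ≤ n) {x : ℝ} (hx : x ∈ Ioo a b) :
    bSpline w a b k t i x = bForm w a k t i x := by
  rw [bSpline, if_neg hx.1.ne', if_neg hx.2.ne, bSplineAux,
    divDiff_eq_sum hw (τ := fun l => t (i + l)) (fun l hl => ht.le_succ (by omega))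
      (fun l hl => ht.mem_Icc hk (by omega)), bForm]
  congr 1
  refine Finset.sum_congr rfl fun l _ => ?_
  rw [LStar_gFun hw (Ioo_subset_Icc_self hx) (ht.mem_Icc hk (by omega))
    (ht.mult_lt hk hi (by omega))]
  by_cases h0 : mult (fun l => t (i + l)) l = 0
  · exact Or.inl h0
  · right
    rcases ht.eq_or_of_mult_ne_zero (by omega) hi h0 with h | h <;> rw [h]
    · exact hx.1.ne'
    · exact hx.2.ne

/-- Integration against `M_i` is a divided difference of an iterated integral, and so takes a
value of the integrand. -/
theorem exists_integral_bForm_mul (hw : WeightsIn a b k m B w) (hk : 1 ≤ k)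
    (ht : IsPartition a b k n t) {i : ℕ} (hi : i ≤ n) {f : ℝ → ℝ}
    (hf : ContinuousOn f (Icc a b)) :
    IntervalIntegrable (fun x => bForm w a k t i x * f x) volume a b ∧
    ∃ ξ ∈ Icc a b, ∫ x in a..b, bForm w a k t i x * f x = f ξ := by
  set τ : ℕ → ℝ := fun l => t (i + l) with hτ
  have hb : b ∈ Icc a b := right_mem_Icc.2 hw.lt.le
  have hτI : ∀ l ≤ k, τ l ∈ Icc a b := fun l hl => ht.mem_Icc hk (by omega)
  have hlt : ∀ l : Fin (k + 1), mult τ l < k := fun l => ht.mult_lt hk hi (by omega)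
  have hg := fun l : Fin (k + 1) => integral_gFun_mul hw (hτI l (by omega)) hf
    (j := k - mult τ l) (by have := hlt l; omega) (by omega)
  have hform : (fun x => bForm w a k t i x * f x) = fun x =>
      ∑ l : Fin (k + 1), ((-1) ^ k * ddCoeff w a k τ l * (-1) ^ mult τ l) *
        (gFun w (k - mult τ l) x (τ l) * f x) := by
    ext x
    rw [bForm, Finset.mul_sum, Finset.sum_mul]
    exact Finset.sum_congr rfl fun l _ => by ring
  rw [hform]
  have hsum := IntervalIntegrable.sum Finset.univ fun l _ => (hg l).1.const_mul
    ((-1) ^ k * ddCoeff w a k τ l * (-1) ^ mult τ l)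
  refine ⟨by simpa only [Finset.sum_fn] using hsum, ?_⟩
  obtain ⟨ξ, hξ, hξ'⟩ := exists_sum_ddCoeff_eq hw (τ := τ) (fun l hl => ht.le_succ (by omega)) hτI
    (isTower_primitives hw hb hf)
  refine ⟨ξ, hξ, ?_⟩
  rw [Nat.sub_self] at hξ'
  change _ = f ξ at hξ'
  rw [← hξ', intervalIntegral.integral_finsetSum fun l _ => (hg l).1.const_mul _]
  refine Finset.sum_congr rfl fun l _ => ?_
  rw [intervalIntegral.integral_const_mul, (hg l).2]
  have hs : ((-1 : ℝ) ^ k * (-1) ^ mult τ l) * (-1) ^ (k - mult τ l) = 1 := by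
    rw [mul_assoc, ← pow_add, ← pow_add,
      show k + (mult τ l + (k - mult τ l)) = k + k by have := hlt l; omega, ← two_mul, pow_mul]
    simp
  calc _ = ((-1 : ℝ) ^ k * (-1) ^ mult τ l) * (-1) ^ (k - mult τ l) *
        (ddCoeff w a k τ l * primitives w b f 0 (k - mult τ l) (τ l)) := by ring
    _ = _ := by rw [hs, one_mul]

theorem gFun_eq_of_mem_Ioo (ht : IsPartition a b k n t) (j : ℕ) {p q : ℕ} (hq : q ≤ n + k)
    (hj : j + 1 ≤ n + k) {x : ℝ} (hx : x ∈ Ioo (t j) (t (j + 1))) :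
    gFun w p x (t q) = if q ≤ j then hFun w p x (t q) else 0 := by
  by_cases h : q ≤ j
  · rw [if_pos h, gFun, if_pos ((ht.mono h (by omega)).trans hx.1.le)]
  · rw [if_neg h, gFun, if_neg (not_le.2 (hx.2.trans_le (ht.mono (by omega) hq)))]

/-- The coefficient of `(-1)^e h_{k-e}(·, z)` in `M_i` on the grid interval `(t_j, t_{j+1})`. -/
noncomputable def localCoeff (w : ℕ → ℝ → ℝ) (a : ℝ) (k : ℕ) (t : ℕ → ℝ) (i j : ℕ) (z : ℝ)
    (e : ℕ) : ℝ :=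
  (-1) ^ k * ∑ l : Fin (k + 1), if i + l ≤ j then ddCoeff w a k (fun l => t (i + l)) l *
    dualTower w z k e (mult (fun l => t (i + l)) l) (t (i + l)) else 0

theorem bForm_eq_localCoeff (hw : WeightsIn a b k m B w) (hk : 1 ≤ k) (ht : IsPartition a b k n t)
    {i j : ℕ} (hi : i ≤ n) (hj : j + 1 ≤ n + k) {z : ℝ} (hz : z ∈ Icc a b) {x : ℝ}
    (hx : x ∈ Ioo (t j) (t (j + 1))) :
    bForm w a k t i x =
      ∑ e ∈ Finset.range k, localCoeff w a k t i j z e * ((-1) ^ e * hFun w (k - e) x z) := by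
  have hxI : x ∈ Icc a b := ⟨(ht.mem_Icc hk (by omega)).1.trans hx.1.le,
    hx.2.le.trans (ht.mem_Icc hk hj).2⟩
  have h1 : ∀ l : Fin (k + 1), (-1) ^ mult (fun l => t (i + l)) l *
      gFun w (k - mult (fun l => t (i + l)) l) x (t (i + l)) =
      if i + l ≤ j then ∑ e ∈ Finset.range k, (-1) ^ e * hFun w (k - e) x z *
        dualTower w z k e (mult (fun l => t (i + l)) l) (t (i + l)) else 0 := by
    intro l
    rw [gFun_eq_of_mem_Ioo ht j (by omega) hj hx, mul_ite, mul_zero,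
      hFun_addition hw hxI (ht.mem_Icc hk (by omega)) hz (ht.mult_lt hk hi (by omega))]
  simp only [bForm, h1, localCoeff, Finset.mul_sum, Finset.sum_mul]
  rw [Finset.sum_comm]
  refine Finset.sum_congr rfl fun l _ => ?_
  split_ifs
  · simp only [Finset.mul_sum]
    exact Finset.sum_congr rfl fun e _ => by ring
  · simp

theorem bForm_continuousOn (hw : WeightsIn a b k m B w) (hk : 1 ≤ k) (ht : IsPartition a b k n t)
    {i j : ℕ} (hi : i ≤ n) (hj : j + 1 ≤ n + k) :
    ContinuousOn (bForm w a k t i) (Ioo (t j) (t (j + 1))) := by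
  have ha : a ∈ Icc a b := left_mem_Icc.2 hw.lt.le
  refine ContinuousOn.congr (f := fun x => ∑ e ∈ Finset.range k,
    localCoeff w a k t i j a e * ((-1) ^ e * hFun w (k - e) x a)) ?_
    (fun x hx => bForm_eq_localCoeff hw hk ht hi hj ha hx)
  refine continuousOn_finsetSum _ fun e he => continuousOn_const.mul (continuousOn_const.mul ?_)
  rw [Finset.mem_range] at he
  refine (continuousOn_iterInt hw ha (k - e - 1) 1 le_rfl (by omega)).mono fun x hx => ?_
  exact ⟨(ht.mem_Icc hk (by omega)).1.trans hx.1.le, hx.2.le.trans (ht.mem_Icc hk hj).2⟩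

theorem bForm_nonneg (hw : WeightsIn a b k m B w) (hk : 1 ≤ k) (ht : IsPartition a b k n t)
    {i j : ℕ} (hi : i ≤ n) (hj : j + 1 ≤ n + k) {x : ℝ} (hx : x ∈ Ioo (t j) (t (j + 1))) :
    0 ≤ bForm w a k t i x := by
  by_contra! hneg
  have hnhds : ∀ᶠ y in 𝓝 x, y ∈ Ioo (t j) (t (j + 1)) ∧ bForm w a k t i y < 0 :=
    (show ∀ᶠ y in 𝓝 x, y ∈ Ioo (t j) (t (j + 1)) from Ioo_mem_nhds hx.1 hx.2).and
      (((bForm_continuousOn hw hk ht hi hj).continuousAt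
        (Ioo_mem_nhds hx.1 hx.2)).eventually_lt_const hneg)
  obtain ⟨δ, hδ, hball⟩ := Metric.eventually_nhds_iff_ball.1 hnhds
  -- test against a hat function supported where `bForm` is negative
  set f : ℝ → ℝ := fun y => max 0 (δ / 2 - |y - x|) with hf
  have hfc : Continuous f := by fun_prop
  have hx1 : x - δ / 2 ∈ Icc a b := by
    have := (hball (x - δ / 2) (by
      rw [Metric.mem_ball, Real.dist_eq, abs_lt]; constructor <;> linarith)).1
    exact ⟨(ht.mem_Icc hk (by omega)).1.trans this.1.le, this.2.le.trans (ht.mem_Icc hk hj).2⟩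
  have hx2 : x + δ / 2 ∈ Icc a b := by
    have := (hball (x + δ / 2) (by
      rw [Metric.mem_ball, Real.dist_eq, abs_lt]; constructor <;> linarith)).1
    exact ⟨(ht.mem_Icc hk (by omega)).1.trans this.1.le, this.2.le.trans (ht.mem_Icc hk hj).2⟩
  obtain ⟨hint, ξ, -, hξ⟩ := exists_integral_bForm_mul hw hk ht hi (f := f) hfc.continuousOn
  have hsub1 : uIcc a (x - δ / 2) ⊆ uIcc a b := by
    rw [uIcc_of_le hw.lt.le]; exact uIcc_subset_Icc (left_mem_Icc.2 hw.lt.le) hx1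
  have hsub2 : uIcc (x - δ / 2) (x + δ / 2) ⊆ uIcc a b := by
    rw [uIcc_of_le hw.lt.le]; exact uIcc_subset_Icc hx1 hx2
  have hsub3 : uIcc (x + δ / 2) b ⊆ uIcc a b := by
    rw [uIcc_of_le hw.lt.le]; exact uIcc_subset_Icc hx2 (right_mem_Icc.2 hw.lt.le)
  have i1 := hint.mono_set hsub1
  have i2 := hint.mono_set hsub2
  have i3 := hint.mono_set hsub3
  have e1 : ∫ y in a..(x - δ / 2), bForm w a k t i y * f y = 0 := by
    rw [intervalIntegral.integral_congr (g := fun _ => 0), intervalIntegral.integral_zero]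
    intro y hy
    rw [uIcc_of_le hx1.1] at hy
    have : δ / 2 - |y - x| ≤ 0 := by
      rw [abs_of_nonpos (by linarith [hy.2])]; linarith [hy.2]
    simp [hf, max_eq_left this]
  have e3 : ∫ y in (x + δ / 2)..b, bForm w a k t i y * f y = 0 := by
    rw [intervalIntegral.integral_congr (g := fun _ => 0), intervalIntegral.integral_zero]
    intro y hy
    rw [uIcc_of_le hx2.2] at hy
    have : δ / 2 - |y - x| ≤ 0 := by
      rw [abs_of_nonneg (by linarith [hy.1])]; linarith [hy.1]
    simp [hf, max_eq_left this]
  have e2 : 0 < ∫ y in (x - δ / 2)..(x + δ / 2), -(bForm w a k t i y * f y) := by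
    refine intervalIntegral.intervalIntegral_pos_of_pos_on i2.neg (fun y hy => ?_) (by linarith)
    have habs : |y - x| < δ / 2 := abs_lt.2 ⟨by linarith [hy.1], by linarith [hy.2]⟩
    have h1 := (hball y (by rw [Metric.mem_ball, Real.dist_eq]; linarith)).2
    have h2 : 0 < f y := lt_max_of_lt_right (by linarith)
    nlinarith
  rw [intervalIntegral.integral_neg] at e2
  rw [← intervalIntegral.integral_add_adjacent_intervals (i1.trans i2) i3,
    ← intervalIntegral.integral_add_adjacent_intervals i1 i2, e1, e3] at hξ
  have : 0 ≤ f ξ := le_max_left _ _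
  linarith

theorem bForm_eq_zero (hw : WeightsIn a b k m B w) (hk : 1 ≤ k) (ht : IsPartition a b k n t)
    {i : ℕ} (hi : i ≤ n) {x : ℝ} (hx : x ∈ Icc a b) (h : x < t i ∨ t (i + k) < x) :
    bForm w a k t i x = 0 := by
  rcases h with h | h
  · rw [bForm, Finset.sum_eq_zero, mul_zero]
    intro l _
    rw [gFun, if_neg (not_le.2 (h.trans_le (ht.mono (by omega) (by omega))))]
    simp
  · obtain ⟨ξ, -, hξ⟩ := exists_sum_ddCoeff_eq hw (τ := fun l => t (i + l))
      (fun l hl => ht.le_succ (by omega)) (fun l hl => ht.mem_Icc hk (by omega))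
      (isTower_hTower hw hx k)
    rw [hTower_top hk] at hξ
    rw [bForm, ← mul_zero ((-1 : ℝ) ^ k), ← hξ]
    congr 1
    refine Finset.sum_congr rfl fun l _ => ?_
    rw [hTower_eq hw hx (ht.mem_Icc hk (by omega)) (ht.mult_lt hk hi (by omega)), gFun,
      if_pos ((ht.mono (by omega) (by omega)).trans h.le)]

end BSpline

/-! ### A Markov type inequality in `L¹` -/

section Markov

/-- The element of the Chebyshev space of `w_p, …, w_{p+r}` with coefficients `c` with respect to
its canonical system based at `z`. -/
noncomputable def comb (w : ℕ → ℝ → ℝ) (z : ℝ) (p r : ℕ) (c : ℕ → ℝ) (x : ℝ) : ℝ :=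
  ∑ e ∈ Finset.range (r + 1), c e * iterInt w z p e x

variable {w : ℕ → ℝ → ℝ} {a b m B : ℝ} {k : ℕ}

theorem continuousOn_comb (hw : WeightsIn a b k m B w) {z : ℝ} (hz : z ∈ Icc a b) {p r : ℕ}
    (hp : 1 ≤ p) (hr : p + r ≤ k) (c : ℕ → ℝ) : ContinuousOn (comb w z p r c) (Icc a b) :=
  continuousOn_finsetSum _ fun e he => continuousOn_const.mul
    (continuousOn_iterInt hw hz e p hp (by rw [Finset.mem_range] at he; omega))

theorem comb_zero (z : ℝ) (p : ℕ) (c : ℕ → ℝ) (x : ℝ) : comb w z p 0 c x = c 0 * w p x := by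
  simp [comb, iterInt]

theorem comb_succ (hw : WeightsIn a b k m B w) {z : ℝ} (hz : z ∈ Icc a b) {p r : ℕ}
    (hr : p + (r + 1) ≤ k) (c : ℕ → ℝ) {x : ℝ} (hx : x ∈ Icc a b) :
    comb w z p (r + 1) c x =
      w p x * (c 0 + ∫ s in z..x, comb w z (p + 1) r (fun e => c (e + 1)) s) := by
  have hint : ∫ s in z..x, comb w z (p + 1) r (fun e => c (e + 1)) s =
      ∑ e ∈ Finset.range (r + 1), c (e + 1) * ∫ s in z..x, iterInt w z (p + 1) e s := by
    simp only [comb]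
    rw [intervalIntegral.integral_finsetSum]
    · exact Finset.sum_congr rfl fun e _ => intervalIntegral.integral_const_mul _ _
    · intro e he
      rw [Finset.mem_range] at he
      exact (continuousOn_const.mul ((continuousOn_iterInt hw hz e (p + 1) (by omega)
        (by omega)).mono (uIcc_subset_Icc hz hx))).intervalIntegrable
  rw [hint, comb, Finset.sum_range_succ', mul_add, Finset.mul_sum, add_comm]
  congr 1
  · simp [iterInt, mul_comm]
  · exact Finset.sum_congr rfl fun e _ => by rw [iterInt]; ring

theorem WeightsIn.abs_le (hw : WeightsIn a b k m B w) {i : ℕ} (h1 : 1 ≤ i) (h2 : i ≤ k) {x : ℝ}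
    (hx : x ∈ Icc a b) : |w i x| ≤ B := by
  rw [abs_of_pos (hw.pos.trans_le (hw.ge i h1 h2 x hx))]
  exact hw.le i h1 h2 x hx

theorem WeightsIn.bound_pos (hw : WeightsIn a b k m B w) (hk : 1 ≤ k) : 0 < B :=
  hw.pos.trans_le ((hw.ge 1 le_rfl hk a (left_mem_Icc.2 hw.lt.le)).trans
    (hw.le 1 le_rfl hk a (left_mem_Icc.2 hw.lt.le)))

theorem abs_sub_le_of_mem_uIoc {z x s H : ℝ} (h : |x - z| ≤ H) (hs : s ∈ uIoc z x) :
    |s - z| ≤ H :=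
  (abs_sub_left_of_mem_uIcc (uIoc_subset_uIcc hs)).trans h

theorem abs_iterInt_le (hw : WeightsIn a b k m B w) {z H : ℝ} (hz : z ∈ Icc a b) (hH : 0 ≤ H)
    (r : ℕ) : ∀ p, 1 ≤ p → p + r ≤ k → ∀ x ∈ Icc a b, |x - z| ≤ H →
      |iterInt w z p r x| ≤ B ^ (r + 1) * H ^ r := by
  induction r with
  | zero =>
    intro p h1 h2 x hx _
    simpa [iterInt] using hw.abs_le h1 h2 hx
  | succ r ih =>
    intro p h1 h2 x hx hxz
    have hB := (hw.bound_pos (by omega)).le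
    have h3 : ‖∫ s in z..x, iterInt w z (p + 1) r s‖ ≤ B ^ (r + 1) * H ^ r * |x - z| :=
      intervalIntegral.norm_integral_le_of_norm_le_const fun s hs =>
        ih (p + 1) (by omega) (by omega) s (uIcc_subset_Icc hz hx (uIoc_subset_uIcc hs))
          (abs_sub_le_of_mem_uIoc hxz hs)
    rw [iterInt, abs_mul]
    rw [Real.norm_eq_abs] at h3
    calc _ ≤ B * (B ^ (r + 1) * H ^ r * H) :=
          mul_le_mul (hw.abs_le h1 (by omega) hx) (h3.trans (by gcongr)) (abs_nonneg _) hB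
      _ = _ := by ring

theorem exists_half_const_sign {V : ℝ → ℝ} {x ℓ : ℝ} (hℓ : 0 ≤ ℓ)
    (h : MonotoneOn V (Icc x (x + ℓ)) ∨ AntitoneOn V (Icc x (x + ℓ))) :
    ∃ y, x ≤ y ∧ y + ℓ / 2 ≤ x + ℓ ∧
      ((∀ s ∈ Icc y (y + ℓ / 2), 0 ≤ V s) ∨ ∀ s ∈ Icc y (y + ℓ / 2), V s ≤ 0) := by
  have hmid : x + ℓ / 2 ∈ Icc x (x + ℓ) := ⟨by linarith, by linarith⟩
  have hl : ∀ s ∈ Icc x (x + ℓ / 2), s ∈ Icc x (x + ℓ) := fun s hs =>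
    ⟨hs.1, by linarith [hs.2]⟩
  have hr : ∀ s ∈ Icc (x + ℓ / 2) (x + ℓ / 2 + ℓ / 2), s ∈ Icc x (x + ℓ) := fun s hs =>
    ⟨by linarith [hs.1], by linarith [hs.2]⟩
  rcases h with h | h <;> rcases le_total 0 (V (x + ℓ / 2)) with h0 | h0
  · exact ⟨x + ℓ / 2, by linarith, by linarith,
      Or.inl fun s hs => h0.trans (h hmid (hr s hs) hs.1)⟩
  · exact ⟨x, le_rfl, by linarith, Or.inr fun s hs => (h (hl s hs) hmid hs.2).trans h0⟩
  · exact ⟨x, le_rfl, by linarith, Or.inl fun s hs => h0.trans (h (hl s hs) hmid hs.2)⟩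
  · exact ⟨x + ℓ / 2, by linarith, by linarith,
      Or.inr fun s hs => (h hmid (hr s hs) hs.1).trans h0⟩

/-- An element of a Chebyshev space has constant sign on some subinterval of comparable length. -/
theorem exists_comb_const_sign (hw : WeightsIn a b k m B w) {z : ℝ} (hz : z ∈ Icc a b) {x ℓ : ℝ}
    (hℓ : 0 ≤ ℓ) (hI : Icc x (x + ℓ) ⊆ Icc a b) (r : ℕ) : ∀ p, 1 ≤ p → p + r ≤ k → ∀ c : ℕ → ℝ,
    ∃ y, x ≤ y ∧ y + ℓ / 2 ^ r ≤ x + ℓ ∧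
      ((∀ s ∈ Icc y (y + ℓ / 2 ^ r), 0 ≤ comb w z p r c s) ∨
        ∀ s ∈ Icc y (y + ℓ / 2 ^ r), comb w z p r c s ≤ 0) := by
  induction r with
  | zero =>
    intro p h1 h2 c
    refine ⟨x, le_rfl, by simp, ?_⟩
    simp only [pow_zero, div_one, comb_zero]
    have hpos : ∀ s ∈ Icc x (x + ℓ), 0 ≤ w p s := fun s hs =>
      hw.pos.le.trans (hw.ge p h1 h2 s (hI hs))
    rcases le_total 0 (c 0) with h | h
    · exact Or.inl fun s hs => mul_nonneg h (hpos s hs)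
    · exact Or.inr fun s hs => mul_nonpos_of_nonpos_of_nonneg h (hpos s hs)
  | succ r ih =>
    intro p h1 h2 c
    obtain ⟨y, hy1, hy2, hy⟩ := ih (p + 1) (by omega) (by omega) (fun e => c (e + 1))
    -- the function divided by `w p`; it is monotone where its derivative has constant sign
    set V : ℝ → ℝ := fun x => c 0 + ∫ s in z..x, comb w z (p + 1) r (fun e => c (e + 1)) s with hV
    have hpos : 0 ≤ ℓ / 2 ^ r := by positivity
    have hsub : Icc y (y + ℓ / 2 ^ r) ⊆ Icc a b := (Icc_subset_Icc hy1 hy2).trans hI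
    have hcont := continuousOn_comb hw hz (p := p + 1) (r := r) (by omega) (by omega)
      (fun e => c (e + 1))
    have hdiff : ∀ s ∈ Icc a b, ∀ u ∈ Icc a b,
        V u - V s = ∫ v in s..u, comb w z (p + 1) r (fun e => c (e + 1)) v := by
      intro s hs u hu
      simp only [hV, add_sub_add_left_eq_sub]
      exact intervalIntegral.integral_interval_sub_left
        (hcont.mono (uIcc_subset_Icc hz hu)).intervalIntegrable
        (hcont.mono (uIcc_subset_Icc hz hs)).intervalIntegrable
    obtain ⟨u, hu1, hu2, hu⟩ := exists_half_const_sign (V := V) (x := y) hpos (by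
      rcases hy with hy | hy
      · left
        intro s hs u hu hsu
        rw [← sub_nonneg, hdiff s (hsub hs) u (hsub hu)]
        exact intervalIntegral.integral_nonneg hsu fun v hv =>
          hy v ⟨hs.1.trans hv.1, hv.2.trans hu.2⟩
      · right
        intro s hs u hu hsu
        rw [← sub_nonneg, ← neg_sub, hdiff s (hsub hs) u (hsub hu),
          ← intervalIntegral.integral_neg]
        exact intervalIntegral.integral_nonneg hsu fun v hv =>
          neg_nonneg.2 (hy v ⟨hs.1.trans hv.1, hv.2.trans hu.2⟩))
    rw [show ℓ / 2 ^ r / 2 = ℓ / 2 ^ (r + 1) by rw [pow_succ, div_div]] at hu2 hu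
    refine ⟨u, hy1.trans hu1, hu2.trans hy2, ?_⟩
    have hsub' : Icc u (u + ℓ / 2 ^ (r + 1)) ⊆ Icc a b :=
      (Icc_subset_Icc hu1 hu2).trans hsub
    have hwp : ∀ s ∈ Icc u (u + ℓ / 2 ^ (r + 1)), 0 ≤ w p s := fun s hs =>
      hw.pos.le.trans (hw.ge p h1 (by omega) s (hsub' hs))
    refine hu.imp (fun h s hs => ?_) (fun h s hs => ?_)
    · rw [comb_succ hw hz h2 c (hsub' hs)]
      exact mul_nonneg (hwp s hs) (h s hs)
    · rw [comb_succ hw hz h2 c (hsub' hs)]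
      exact mul_nonpos_of_nonneg_of_nonpos (hwp s hs) (h s hs)

theorem exists_mul_le_integral {f : ℝ → ℝ} {c d : ℝ} (hcd : c ≤ d)
    (hf : ContinuousOn f (Icc c d)) :
    ∃ x ∈ Icc c d, f x * (d - c) ≤ ∫ s in c..d, f s := by
  obtain ⟨x, hx, hmin⟩ := isCompact_Icc.exists_isMinOn (nonempty_Icc.2 hcd) hf
  refine ⟨x, hx, ?_⟩
  have h := intervalIntegral.integral_mono_on (μ := volume) (f := fun _ => f x) hcd
    intervalIntegrable_const
    (ContinuousOn.intervalIntegrable (by rwa [uIcc_of_le hcd])) fun s hs => hmin hs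
  rw [intervalIntegral.integral_const, smul_eq_mul] at h
  linarith

/-- Markov's inequality: the coefficients of an element of a Chebyshev space are controlled by its
`L¹` norm on an interval, with the expected powers of the length. By induction on `r`: on an
interval where the derivative `W` of `V = comb / w_p` has constant sign, the `L¹` norm of `W` is the
increment of `V`, and so is controlled by values of `V`. -/
theorem exists_markov_bound (m B : ℝ) (hm : 0 < m) (hB : 0 < B) (r : ℕ) : ∀ Λ : ℝ, 0 ≤ Λ →
    ∃ C, 0 < C ∧ ∀ (w : ℕ → ℝ → ℝ) (a b : ℝ) (k p : ℕ) (z x ℓ : ℝ) (c : ℕ → ℝ),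
      WeightsIn a b k m B w → 1 ≤ p → p + r ≤ k → z ∈ Icc a b → Icc x (x + ℓ) ⊆ Icc a b → 0 < ℓ →
      (∀ s ∈ Icc x (x + ℓ), |s - z| ≤ Λ * ℓ) →
      ∀ e ≤ r, |c e| * ℓ ^ (e + 1) ≤ C * ∫ s in x..(x + ℓ), |comb w z p r c s| := by
  induction r with
  | zero =>
    intro Λ _
    refine ⟨1 / m, by positivity, ?_⟩
    intro w a b k p z x ℓ c hw h1 h2 hz hI hℓ _ e he
    rw [Nat.le_zero.1 he]
    have hmono := intervalIntegral.integral_mono_on (μ := volume) (f := fun _ => |c 0| * m)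
      (g := fun s => |comb w z p 0 c s|) (show x ≤ x + ℓ by linarith) intervalIntegrable_const
      (ContinuousOn.intervalIntegrable (by
        rw [uIcc_of_le (by linarith)]
        exact ((continuousOn_comb hw hz h1 h2 c).mono hI).abs)) (fun s hs => by
        rw [comb_zero, abs_mul]
        exact mul_le_mul_of_nonneg_left ((hw.ge p h1 h2 s (hI hs)).trans (le_abs_self _))
          (abs_nonneg _))
    rw [intervalIntegral.integral_const, smul_eq_mul] at hmono
    calc |c 0| * ℓ ^ (0 + 1) = 1 / m * ((x + ℓ - x) * (|c 0| * m)) := by field_simp; ring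
      _ ≤ _ := by gcongr
  | succ r ih =>
    intro Λ hΛ
    obtain ⟨C', hC', hIH⟩ := ih (Λ * 2 ^ (r + 1)) (by positivity)
    set C1 : ℝ := (2 ^ (r + 1)) ^ (r + 1) * 2 ^ r * 8 * C' / m with hC1
    set S : ℝ := ∑ e ∈ Finset.range (r + 1), (B * Λ) ^ (e + 1) with hS
    have hC1p : 0 < C1 := by positivity
    have hSp : 0 ≤ S := by positivity
    refine ⟨C1 + 4 * 2 ^ r / m + S * C1, by positivity, ?_⟩
    intro w a b k p z x ℓ c hw h1 h2 hz hI hℓ hΛℓ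
    set W := comb w z (p + 1) r (fun e => c (e + 1)) with hW
    set T := ∫ s in x..(x + ℓ), |comb w z p (r + 1) c s| with hT
    set V : ℝ → ℝ := fun x => c 0 + ∫ s in z..x, W s with hV
    have hWc : ContinuousOn W (Icc a b) := continuousOn_comb hw hz (by omega) (by omega) _
    have hVc : ContinuousOn V (Icc a b) := continuousOn_const.add (continuousOn_integral_Icc hWc hz)
    have hvc : ContinuousOn (comb w z p (r + 1) c) (Icc a b) := continuousOn_comb hw hz h1 h2 c
    have hT0 : 0 ≤ T := intervalIntegral.integral_nonneg (by linarith) fun _ _ => abs_nonneg _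
    -- `V` is controlled by the function itself
    have hVT : ∀ u v, x ≤ u → u ≤ v → v ≤ x + ℓ → ∫ s in u..v, |V s| ≤ T / m := by
      intro u v hu huv hv
      have hsub : Icc u v ⊆ Icc a b := (Icc_subset_Icc hu hv).trans hI
      have i1 : IntervalIntegrable (fun s => |V s|) volume u v :=
        ContinuousOn.intervalIntegrable (by rw [uIcc_of_le huv]; exact (hVc.mono hsub).abs)
      have i2 : IntervalIntegrable (fun s => |comb w z p (r + 1) c s|) volume u v :=
        ContinuousOn.intervalIntegrable (by rw [uIcc_of_le huv]; exact (hvc.mono hsub).abs)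
      have i3 : IntervalIntegrable (fun s => |comb w z p (r + 1) c s|) volume x (x + ℓ) :=
        ContinuousOn.intervalIntegrable (by
          rw [uIcc_of_le (by linarith)]; exact (hvc.mono hI).abs)
      have e1 : ∫ s in u..v, |V s| ≤ ∫ s in u..v, |comb w z p (r + 1) c s| / m := by
        refine intervalIntegral.integral_mono_on huv i1 (i2.div_const m) fun s hs => ?_
        rw [le_div_iff₀ hm, comb_succ hw hz h2 c (hsub hs), abs_mul, mul_comm]
        exact mul_le_mul_of_nonneg_right
          ((hw.ge p h1 (by omega) s (hsub hs)).trans (le_abs_self _)) (abs_nonneg _)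
      rw [intervalIntegral.integral_div] at e1
      refine e1.trans (div_le_div_of_nonneg_right ?_ hm.le)
      exact intervalIntegral.integral_mono_interval hu huv hv
        (Eventually.of_forall fun _ => abs_nonneg _) i3
    obtain ⟨y, hy1, hy2, hy⟩ := exists_comb_const_sign hw hz hℓ.le hI r (p + 1) (by omega)
      (by omega) (fun e => c (e + 1))
    set lam := ℓ / 2 ^ r with hlam
    have hlp : 0 < lam := by positivity
    have hyI : Icc y (y + lam) ⊆ Icc a b := (Icc_subset_Icc hy1 hy2).trans hI
    -- points near the two ends of the interval of constant sign at which `V` is small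
    obtain ⟨u, hu, hu'⟩ := exists_mul_le_integral (f := fun s => |V s|) (c := y) (d := y + lam / 4)
      (by linarith) ((hVc.mono ((Icc_subset_Icc_right (by linarith)).trans hyI)).abs)
    obtain ⟨v, hv, hv'⟩ := exists_mul_le_integral (f := fun s => |V s|) (c := y + 3 * lam / 4)
      (d := y + lam) (by linarith)
      ((hVc.mono ((Icc_subset_Icc_left (by linarith)).trans hyI)).abs)
    have hu2 := hu'.trans (hVT y (y + lam / 4) hy1 (by linarith) (by linarith))
    have hv2 := hv'.trans (hVT (y + 3 * lam / 4) (y + lam) (by linarith) (by linarith) hy2)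
    have huI : u ∈ Icc a b := hyI ⟨hu.1, by linarith [hu.2]⟩
    have hvI : v ∈ Icc a b := hyI ⟨by linarith [hv.1], hv.2⟩
    have huv : u ≤ v := by linarith [hu.2, hv.1]
    have hVuv : V v - V u = ∫ s in u..v, W s := by
      simp only [hV, add_sub_add_left_eq_sub]
      exact intervalIntegral.integral_interval_sub_left
        (hWc.mono (uIcc_subset_Icc hz hvI)).intervalIntegrable
        (hWc.mono (uIcc_subset_Icc hz huI)).intervalIntegrable
    have hWabs : ∫ s in u..v, |W s| = |V v - V u| := by
      rw [hVuv]
      have hin : ∀ s ∈ uIcc u v, s ∈ Icc y (y + lam) := fun s hs => by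
        rw [uIcc_of_le huv] at hs; exact ⟨hu.1.trans hs.1, hs.2.trans hv.2⟩
      rcases hy with hy | hy
      · rw [intervalIntegral.integral_congr (g := W) fun s hs => abs_of_nonneg (hy s (hin s hs)),
          abs_of_nonneg]
        exact intervalIntegral.integral_nonneg huv fun s hs =>
          hy s (hin s (by rwa [uIcc_of_le huv]))
      · rw [intervalIntegral.integral_congr (g := fun s => -W s) fun s hs =>
          abs_of_nonpos (hy s (hin s hs)), intervalIntegral.integral_neg, abs_of_nonpos]
        rw [← neg_nonneg, ← intervalIntegral.integral_neg]
        exact intervalIntegral.integral_nonneg huv fun s hs =>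
          neg_nonneg.2 (hy s (hin s (by rwa [uIcc_of_le huv])))
    have hmid : ∫ s in (y + lam / 4)..(y + lam / 4 + lam / 2), |W s| ≤ 8 * T / (m * lam) := by
      have e1 : ∫ s in (y + lam / 4)..(y + lam / 4 + lam / 2), |W s| ≤ ∫ s in u..v, |W s| := by
        refine intervalIntegral.integral_mono_interval hu.2 (by linarith) (by linarith [hv.1])
          (Eventually.of_forall fun _ => abs_nonneg _) (ContinuousOn.intervalIntegrable ?_)
        exact (hWc.mono (uIcc_subset_Icc huI hvI)).abs
      have e2 : |V v - V u| ≤ |V v| + |V u| := abs_sub _ _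
      have e3 : |V v| ≤ 4 * T / (m * lam) := by
        rw [le_div_iff₀ (by positivity)]
        have := (le_div_iff₀ hm).1 hv2
        calc |V v| * (m * lam) = 4 * (|V v| * (y + lam - (y + 3 * lam / 4)) * m) := by ring
          _ ≤ 4 * T := by linarith
      have e4 : |V u| ≤ 4 * T / (m * lam) := by
        rw [le_div_iff₀ (by positivity)]
        have := (le_div_iff₀ hm).1 hu2
        calc |V u| * (m * lam) = 4 * (|V u| * (y + lam / 4 - y) * m) := by ring
          _ ≤ 4 * T := by linarith
      have e5 : 8 * T / (m * lam) = 4 * T / (m * lam) + 4 * T / (m * lam) := by ring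
      linarith
    have hIH' := hIH w a b k (p + 1) z (y + lam / 4) (lam / 2) (fun e => c (e + 1)) hw (by omega)
      (by omega) hz ((Icc_subset_Icc (by linarith) (by linarith)).trans hyI) (by positivity)
      (fun s hs => by
        have : Λ * 2 ^ (r + 1) * (lam / 2) = Λ * ℓ := by
          rw [hlam, pow_succ]; field_simp
        rw [this]
        exact hΛℓ s ⟨by linarith [hs.1], by linarith [hs.2]⟩)
    have hsucc : ∀ e ≤ r, |c (e + 1)| * ℓ ^ (e + 1 + 1) ≤ C1 * T := by
      intro e he
      have e1 : |c (e + 1)| * (lam / 2) ^ (e + 1) ≤ C' * (8 * T / (m * lam)) :=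
        (hIH' e he).trans (mul_le_mul_of_nonneg_left hmid hC'.le)
      have e2 : ℓ ^ (e + 1 + 1) = (2 ^ (r + 1)) ^ (e + 1) * 2 ^ r * lam * (lam / 2) ^ (e + 1) := by
        have h3 : ℓ = 2 ^ (r + 1) * (lam / 2) := by rw [hlam, pow_succ]; field_simp
        have h4 : ℓ = 2 ^ r * lam := by rw [hlam]; field_simp
        calc ℓ ^ (e + 1 + 1) = ℓ ^ (e + 1) * ℓ := pow_succ _ _
          _ = (2 ^ (r + 1) * (lam / 2)) ^ (e + 1) * (2 ^ r * lam) := by rw [← h3, ← h4]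
          _ = _ := by rw [mul_pow]; ring
      rw [e2]
      calc |c (e + 1)| * ((2 ^ (r + 1)) ^ (e + 1) * 2 ^ r * lam * (lam / 2) ^ (e + 1))
          = ((2 : ℝ) ^ (r + 1)) ^ (e + 1) * 2 ^ r * lam *
            (|c (e + 1)| * (lam / 2) ^ (e + 1)) := by ring
        _ ≤ ((2 : ℝ) ^ (r + 1)) ^ (r + 1) * 2 ^ r * lam * (C' * (8 * T / (m * lam))) := by
            have h5 : (1 : ℝ) ≤ 2 ^ (r + 1) := one_le_pow₀ (by norm_num)
            have h6 : ((2 : ℝ) ^ (r + 1)) ^ (e + 1) ≤ (2 ^ (r + 1)) ^ (r + 1) :=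
              pow_le_pow_right₀ h5 (by omega)
            gcongr
        _ = C1 * T := by rw [hC1]; field_simp
    intro e he
    cases e with
    | succ e =>
      refine (hsucc e (by omega)).trans (mul_le_mul_of_nonneg_right ?_ hT0)
      have : 0 ≤ 4 * 2 ^ r / m := by positivity
      linarith [mul_nonneg hSp hC1p.le]
    | zero =>
      have huz : |u - z| ≤ Λ * ℓ :=
        hΛℓ u ⟨hy1.trans hu.1, by linarith [hu.2]⟩
      have hℓΛ : 0 ≤ Λ * ℓ := by positivity
      have hVu : c 0 = V u - ∫ s in z..u, W s := by simp [hV]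
      have hintW : |∫ s in z..u, W s| * ℓ ≤ S * (C1 * T) := by
        have e1 : ∫ s in z..u, W s =
            ∑ e ∈ Finset.range (r + 1), c (e + 1) * ∫ s in z..u, iterInt w z (p + 1) e s := by
          simp only [hW, comb]
          rw [intervalIntegral.integral_finsetSum]
          · exact Finset.sum_congr rfl fun e _ => intervalIntegral.integral_const_mul _ _
          · intro e he
            rw [Finset.mem_range] at he
            exact (continuousOn_const.mul ((continuousOn_iterInt hw hz e (p + 1) (by omega)
              (by omega)).mono (uIcc_subset_Icc hz huI))).intervalIntegrable
        rw [e1, hS, Finset.sum_mul]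
        refine (mul_le_mul_of_nonneg_right (Finset.abs_sum_le_sum_abs _ _) hℓ.le).trans ?_
        rw [Finset.sum_mul]
        refine Finset.sum_le_sum fun e he => ?_
        rw [Finset.mem_range] at he
        have e2 : |∫ s in z..u, iterInt w z (p + 1) e s| ≤
            B ^ (e + 1) * (Λ * ℓ) ^ e * (Λ * ℓ) := by
          rw [← Real.norm_eq_abs]
          refine (intervalIntegral.norm_integral_le_of_norm_le_const
            (C := B ^ (e + 1) * (Λ * ℓ) ^ e) fun s hs => ?_).trans
            (mul_le_mul_of_nonneg_left huz (by positivity))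
          exact abs_iterInt_le hw hz hℓΛ e (p + 1) (by omega) (by omega) s
            (uIcc_subset_Icc hz huI (uIoc_subset_uIcc hs)) (abs_sub_le_of_mem_uIoc huz hs)
        rw [abs_mul]
        calc |c (e + 1)| * |∫ s in z..u, iterInt w z (p + 1) e s| * ℓ
            ≤ |c (e + 1)| * (B ^ (e + 1) * (Λ * ℓ) ^ e * (Λ * ℓ)) * ℓ := by gcongr
          _ = (B * Λ) ^ (e + 1) * (|c (e + 1)| * ℓ ^ (e + 1 + 1)) := by
              rw [mul_pow, mul_pow]; ring
          _ ≤ _ := mul_le_mul_of_nonneg_left (hsucc e (by omega)) (by positivity)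
      have hVu' : |V u| * ℓ ≤ 4 * 2 ^ r / m * T := by
        have h4 : ℓ = 2 ^ r * lam := by rw [hlam]; field_simp
        have := (le_div_iff₀ hm).1 hu2
        rw [h4, div_mul_eq_mul_div, le_div_iff₀ hm]
        have h5 : |V u| * lam * m ≤ 4 * T := by
          calc |V u| * lam * m = 4 * (|V u| * (y + lam / 4 - y) * m) := by ring
            _ ≤ 4 * T := by linarith
        calc |V u| * (2 ^ r * lam) * m = 2 ^ r * (|V u| * lam * m) := by ring
          _ ≤ 2 ^ r * (4 * T) := by gcongr
          _ = _ := by ring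
      have hc0 : |c 0| ≤ |V u| + |∫ s in z..u, W s| := by rw [hVu]; exact abs_sub _ _
      calc |c 0| * ℓ ^ (0 + 1) ≤ (|V u| + |∫ s in z..u, W s|) * ℓ := by
            rw [zero_add, pow_one]; gcongr
        _ ≤ 4 * 2 ^ r / m * T + S * (C1 * T) := by rw [add_mul]; exact add_le_add hVu' hintW
        _ ≤ _ := by
            rw [add_mul, add_mul, mul_assoc S]
            linarith [mul_nonneg hC1p.le hT0]

end Markov

/-! ### Local dual functionals and the stability of the B-spline basis -/

section Stability

variable {w : ℕ → ℝ → ℝ} {a b m B : ℝ} {k n : ℕ} {t : ℕ → ℝ}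

/-- Earlier knots that differ from the current one do not affect its multiplicity. -/
theorem mult_window (l : ℕ) : ∀ (d i : ℕ), (∀ q < d, t (i + q) ≠ t (i + d + l)) →
    mult (fun l => t (i + l)) (d + l) = mult (fun l => t (i + d + l)) l := by
  intro d
  induction d with
  | zero => intro i _; simp
  | succ d ih =>
    intro i h
    have h1 := mult_succ_eq_shift (fun l => t (i + l)) (d + l)
    have h0 : ¬ t (i + 0) = t (i + (d + l + 1)) := by
      have := h 0 (by omega)
      rwa [show i + (d + 1) + l = i + (d + l + 1) by omega] at this
    rw [if_neg h0, add_zero] at h1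
    have e1 : (fun l => t (i + (l + 1))) = fun l => t (i + 1 + l) := by
      ext l; rw [add_comm l 1, add_assoc]
    rw [e1] at h1
    have h2 := ih (i + 1) (fun q hq => by
      have := h (q + 1) (by omega)
      rwa [show i + (q + 1) = i + 1 + q by omega,
        show i + (d + 1) + l = i + 1 + d + l by omega] at this)
    rw [show d + 1 + l = d + l + 1 by omega, h1, h2]
    simp only [show ∀ l, i + 1 + d + l = i + (d + 1) + l by intro l; omega]

/-- `φ_{l+1,k}` vanishes at `t_i, …, t_{l+k-1}`, with multiplicities counted from any `i > l`. -/
theorem IsPhiCoeff.zeros_of_le (ht : IsPartition a b k n t) {l : ℕ} (hl : l ≤ n) {c₂ : ℕ → ℝ}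
    (hk : 1 ≤ k) (h₂ : IsPhiCoeff w a k (k - 1) (fun q => t (l + 1 + q)) c₂) {i : ℕ}
    (hi : l + 1 ≤ i) : ∀ q, i + q + 1 ≤ l + k →
      spanTower w a k k c₂ (mult (fun q => t (i + q)) q) (t (i + q)) = 0 := by
  induction i, hi using Nat.le_induction with
  | base =>
    intro q hq
    have := h₂.2 q (by omega)
    rwa [Nat.sub_add_cancel hk] at this
  | succ i hi ih =>
    intro q hq
    have := zeros_tail (F := spanTower w a k k c₂) (τ := fun q => t (i + q)) (s := l + k - i)
      (fun q hq => ht.le_succ (by omega)) (fun q hq => ih q (by omega)) (l := q) (by omega)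
    have e1 : (fun l => t (i + (l + 1))) = fun l => t (i + 1 + l) := by
      ext l; rw [add_comm l 1, add_assoc]
    rwa [e1, show i + (q + 1) = i + 1 + q by omega] at this

/-- The divided differences of the truncation of `φ_{l+1,k}` to the left of a grid interval inside
`[t_l, t_{l+k}]`: only the one belonging to `M_l` does not vanish. -/
theorem sum_truncated (hw : WeightsIn a b k m B w) (hk : 1 ≤ k) (ht : IsPartition a b k n t)
    {i j l : ℕ} (hi : i ≤ n) (hl : l ≤ n) (hlj : l ≤ j) (hjl : j < l + k) (hj : t j < t (j + 1))
    {c₀ c₁ c₂ : ℕ → ℝ}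
    (h₀ : IsPhiCoeff w a k k (fun q => t (l + q)) c₀)
    (h₁ : IsPhiCoeff w a k k (fun q => t (l + 1 + q)) c₁)
    (h₂ : IsPhiCoeff w a k (k - 1) (fun q => t (l + 1 + q)) c₂)
    (h : ∀ e ≤ k, ∀ y ∈ Icc a b, spanTower w a k (k + 1) c₀ e y -
      spanTower w a k (k + 1) c₁ e y = alpha w a b k t l * spanTower w a k k c₂ e y) :
    ∑ q : Fin (k + 1), (if i + q ≤ j then ddCoeff w a k (fun q => t (i + q)) q *
      spanTower w a k k c₂ (mult (fun q => t (i + q)) q) (t (i + q)) else 0) =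
      if i = l then -(alpha w a b k t l)⁻¹ else 0 := by
  rcases lt_or_ge l i with hli | hil
  · rw [if_neg hli.ne']
    refine Finset.sum_eq_zero fun q _ => ?_
    split_ifs with hq
    · rw [h₂.zeros_of_le ht hl hk hli q (by omega), mul_zero]
    · rfl
  -- the untruncated divided difference vanishes; truncation removes only the point `t_{l+k}`
  have htot := sum_ddCoeff_spanTower hw (τ := fun q => t (i + q))
    (fun q hq => ht.le_succ (by omega)) (fun q hq => ht.mem_Icc hk (by omega)) (R := k) (by omega) c₂
  rw [if_neg (by omega)] at htot
  -- beyond the interval `φ` still vanishes at all knots before `t_{l+k}`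
  have hright : ∀ q : ℕ, j < i + q → i + q + 1 ≤ l + k →
      spanTower w a k k c₂ (mult (fun q => t (i + q)) q) (t (i + q)) = 0 := by
    intro q h1 h2
    obtain ⟨p, hp⟩ : ∃ p, i + q = j + 1 + p := ⟨i + q - (j + 1), by omega⟩
    have hm := mult_window (t := t) p (j + 1 - i) i (fun s hs => by
      have e1 : t (i + s) ≤ t j := ht.mono (by omega) (by omega)
      have e2 : t (j + 1) ≤ t (i + (j + 1 - i) + p) := ht.mono (by omega) (by omega)
      exact (e1.trans_lt (hj.trans_le e2)).ne)
    rw [show j + 1 - i + p = q by omega] at hm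
    simp only [show ∀ l, i + (j + 1 - i) + l = j + 1 + l by intro l; omega] at hm
    rw [hm, hp]
    exact h₂.zeros_of_le ht hl hk (by omega) p (by omega)
  have hsplit : ∀ q : Fin (k + 1), (if i + q ≤ j then ddCoeff w a k (fun q => t (i + q)) q *
      spanTower w a k k c₂ (mult (fun q => t (i + q)) q) (t (i + q)) else 0) =
      ddCoeff w a k (fun q => t (i + q)) q *
        spanTower w a k k c₂ (mult (fun q => t (i + q)) q) (t (i + q)) -
      if i = l ∧ q = Fin.last k then ddCoeff w a k (fun q => t (l + q)) (Fin.last k) *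
        spanTower w a k k c₂ (mult (fun q => t (l + q)) k) (t (l + k)) else 0 := by
    intro q
    by_cases hq : i + q ≤ j
    · rw [if_pos hq, if_neg, sub_zero]
      rintro ⟨rfl, rfl⟩
      simp at hq; omega
    · rw [if_neg hq]
      by_cases hlast : i = l ∧ q = Fin.last k
      · rw [if_pos hlast]
        obtain ⟨rfl, rfl⟩ := hlast
        simp
      · rw [if_neg hlast, hright q (by omega), mul_zero, sub_zero]
        by_contra hcon
        exact hlast ⟨by omega, Fin.ext (by simp; omega)⟩
  rw [Finset.sum_congr rfl fun q _ => hsplit q, Finset.sum_sub_distrib, htot, zero_sub]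
  by_cases hil' : i = l
  · subst hil'
    rw [if_pos rfl]
    simp only [true_and, Finset.sum_ite_eq', Finset.mem_univ, if_true]
    obtain ⟨hαp, hα⟩ := alpha_pos_of_spec hw hk ht hi h₀ h₁ h₂ h
    have hone := sum_ddCoeff_spanTower hw (τ := fun q => t (i + q))
      (fun q hq => ht.le_succ (by omega)) (fun q hq => ht.mem_Icc hk (by omega)) le_rfl c₀
    rw [if_pos rfl, h₀.1, Fin.sum_univ_castSucc, Finset.sum_eq_zero, zero_add] at hone
    · simp only [Fin.val_last] at hone
      rw [hα] at hone
      rw [neg_inj]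
      refine eq_inv_of_mul_eq_one_left ?_
      rw [← hone]
      ring
    · intro q _
      have := h₀.2 q q.2
      rw [Fin.val_castSucc, this, mul_zero]
  · rw [if_neg hil']
    simp [hil']

/-- The functional `∑ A_e (-1)^e h_{k-e}(·, z) ↦ ∑ A_e L*_e φ_{l+1,k}(z)` on the local
representations is, up to sign, dual to the basis `α_i M_i`. -/
theorem sum_localCoeff_mul (hw : WeightsIn a b k m B w) (hk : 1 ≤ k) (ht : IsPartition a b k n t)
    {i j l : ℕ} (hi : i ≤ n) (hl : l ≤ n) (hlj : l ≤ j) (hjl : j < l + k) (hj : t j < t (j + 1))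
    {z : ℝ} (hz : z ∈ Icc a b) {c₀ c₁ c₂ : ℕ → ℝ}
    (h₀ : IsPhiCoeff w a k k (fun q => t (l + q)) c₀)
    (h₁ : IsPhiCoeff w a k k (fun q => t (l + 1 + q)) c₁)
    (h₂ : IsPhiCoeff w a k (k - 1) (fun q => t (l + 1 + q)) c₂)
    (h : ∀ e ≤ k, ∀ y ∈ Icc a b, spanTower w a k (k + 1) c₀ e y -
      spanTower w a k (k + 1) c₁ e y = alpha w a b k t l * spanTower w a k k c₂ e y) :
    ∑ e ∈ Finset.range k, localCoeff w a k t i j z e * spanTower w a k k c₂ e z =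
      if i = l then (-1) ^ (k + 1) * (alpha w a b k t l)⁻¹ else 0 := by
  have hT := isTower_spanTower hw (R := k) (by omega) c₂ k
  have htay : ∀ q : Fin (k + 1), spanTower w a k k c₂ (mult (fun q => t (i + q)) q) (t (i + q)) =
      ∑ e ∈ Finset.range k, spanTower w a k k c₂ e z *
        dualTower w z k e (mult (fun q => t (i + q)) q) (t (i + q)) := by
    intro q
    refine hT.taylor hw (fun y _ => Finset.sum_eq_zero fun r hr => ?_) hz
      (ht.mult_lt hk hi (by omega)).le _ (ht.mem_Icc hk (by omega))
    rw [dualTower_of_lt a (Finset.mem_range.1 hr), mul_zero]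
  have hmain := sum_truncated hw hk ht hi hl hlj hjl hj h₀ h₁ h₂ h
  have : ∑ e ∈ Finset.range k, localCoeff w a k t i j z e * spanTower w a k k c₂ e z =
      (-1) ^ k * ∑ q : Fin (k + 1), (if i + q ≤ j then ddCoeff w a k (fun q => t (i + q)) q *
      spanTower w a k k c₂ (mult (fun q => t (i + q)) q) (t (i + q)) else 0) := by
    simp only [htay, localCoeff, Finset.mul_sum, Finset.sum_mul]
    rw [Finset.sum_comm]
    refine Finset.sum_congr rfl fun q _ => ?_
    split_ifs
    · rw [Finset.mul_sum]
      exact Finset.sum_congr rfl fun e _ => by ring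
    · simp
  rw [this, hmain]
  split_ifs
  · rw [pow_succ]; ring
  · simp

/-- The combination `∑ A_e (-1)^e h_{k-e}(·, z)` in terms of the canonical system. -/
theorem sum_hFun_eq_comb (z : ℝ) (hk : 1 ≤ k) (A : ℕ → ℝ) (x : ℝ) :
    ∑ e ∈ Finset.range k, A e * ((-1) ^ e * hFun w (k - e) x z) =
      comb w z 1 (k - 1) (fun e => A (k - 1 - e) * (-1) ^ (k - 1 - e)) x := by
  rw [comb, Nat.sub_add_cancel hk, ← Finset.sum_range_reflect]
  refine Finset.sum_congr rfl fun e he => ?_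
  rw [Finset.mem_range] at he
  rw [hFun, show k - (k - 1 - e) - 1 = e by omega]
  ring

theorem intervalIntegrable_bForm (hw : WeightsIn a b k m B w) (hk : 1 ≤ k)
    (ht : IsPartition a b k n t) {i : ℕ} (hi : i ≤ n) :
    IntervalIntegrable (bForm w a k t i) volume a b := by
  simpa using (exists_integral_bForm_mul hw hk ht hi (f := fun _ => 1) continuousOn_const).1

theorem intervalIntegrable_sum_bForm (hw : WeightsIn a b k m B w) (hk : 1 ≤ k)
    (ht : IsPartition a b k n t) (c : ℕ → ℝ) :
    IntervalIntegrable (fun x => ∑ i ∈ Finset.range (n + 1), c i * bForm w a k t i x)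
      volume a b := by
  have := IntervalIntegrable.sum (Finset.range (n + 1))
    (f := fun i x => c i * bForm w a k t i x) (μ := volume) (a := a) (b := b) fun i hi =>
      (intervalIntegrable_bForm hw hk ht (by rw [Finset.mem_range] at hi; omega)).const_mul (c i)
  simpa only [Finset.sum_fn] using this

theorem sum_bForm_eq (hw : WeightsIn a b k m B w) (hk : 1 ≤ k) (ht : IsPartition a b k n t)
    {j : ℕ} (hj : j + 1 ≤ n + k) {z : ℝ} (hz : z ∈ Icc a b) (c : ℕ → ℝ) {x : ℝ}
    (hx : x ∈ Ioo (t j) (t (j + 1))) :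
    ∑ i ∈ Finset.range (n + 1), c i * bForm w a k t i x =
      comb w z 1 (k - 1) (fun e => (∑ i ∈ Finset.range (n + 1),
        c i * localCoeff w a k t i j z (k - 1 - e)) * (-1) ^ (k - 1 - e)) x := by
  rw [← sum_hFun_eq_comb (A := fun e => ∑ i ∈ Finset.range (n + 1),
    c i * localCoeff w a k t i j z e) z hk]
  simp only [Finset.sum_mul]
  rw [Finset.sum_comm]
  refine Finset.sum_congr rfl fun i hi => ?_
  rw [Finset.mem_range] at hi
  rw [bForm_eq_localCoeff hw hk ht (by omega) hj hz hx, Finset.mul_sum]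
  exact Finset.sum_congr rfl fun e _ => by ring

theorem exists_long_interval (t : ℕ → ℝ) (hk : 1 ≤ k) (l : ℕ) :
    ∃ j, l ≤ j ∧ j < l + k ∧ t (l + k) - t l ≤ k * (t (j + 1) - t j) := by
  have hsum : ∑ q ∈ Finset.range k, (t (l + (q + 1)) - t (l + q)) = t (l + k) - t l :=
    Finset.sum_range_sub (fun q => t (l + q)) k
  obtain ⟨q, hq, hle⟩ := Finset.exists_le_of_sum_le (s := Finset.range k)
    (f := fun _ => (t (l + k) - t l) / k) (g := fun q => t (l + (q + 1)) - t (l + q))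
    ⟨0, Finset.mem_range.2 (by omega)⟩ (by
      rw [hsum, Finset.sum_const, Finset.card_range, nsmul_eq_mul]
      have : (k : ℝ) ≠ 0 := by positivity
      rw [mul_div_cancel₀ _ this])
  rw [Finset.mem_range] at hq
  refine ⟨l + q, by omega, by omega, ?_⟩
  have hk' : (0 : ℝ) < k := by exact_mod_cast hk
  rw [div_le_iff₀ hk', mul_comm] at hle
  exact hle

/-- Local stability of the basis `α_i M_i`: a coefficient is bounded by the mean of the absolute
value of the spline over the support of its basis function. -/
theorem exists_stability_bound (k : ℕ) (hk : 1 ≤ k) (m B : ℝ) (hm : 0 < m) (hB : 0 < B) :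
    ∃ D, 0 < D ∧ ∀ (w : ℕ → ℝ → ℝ) (a b : ℝ) (n : ℕ) (t : ℕ → ℝ), WeightsIn a b k m B w →
      IsPartition a b k n t → ∀ (c : ℕ → ℝ) (l : ℕ), l ≤ n →
      |c l| * (t (l + k) - t l) ≤ D * alpha w a b k t l * ∫ x in (t l)..(t (l + k)),
        |∑ i ∈ Finset.range (n + 1), c i * bForm w a k t i x| := by
  obtain ⟨C, hC, hM⟩ := exists_markov_bound m B hm hB (k - 1) 1 zero_le_one
  set S : ℝ := ∑ e ∈ Finset.range k, B ^ e * (k : ℝ) ^ (e + 1) with hS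
  have hk' : (0 : ℝ) < k := by exact_mod_cast hk
  have hS0 : 0 < S := Finset.sum_pos (fun e _ => by positivity) ⟨0, Finset.mem_range.2 (by omega)⟩
  refine ⟨S * C, by positivity, ?_⟩
  intro w a b n t hw ht c l hl
  obtain ⟨j, hlj, hjl, hlong⟩ := exists_long_interval t hk l
  obtain ⟨c₀, c₁, c₂, h₀, h₁, h₂, h⟩ := exists_alpha_spec hw hk ht hl
  have hα := alpha_pos hw hk ht hl
  set H := t (l + k) - t l with hH
  set d := t (j + 1) - t j with hd
  have hHp : 0 < H := sub_pos.2 (ht.lt_add hk hl)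
  have hdp : 0 < d := by
    by_contra! hcon
    exact absurd hlong (not_le.2 ((mul_nonpos_of_nonneg_of_nonpos hk'.le hcon).trans_lt hHp))
  have hj : t j < t (j + 1) := sub_pos.1 hdp
  have hjd : t j + d = t (j + 1) := by rw [hd]; ring
  have hz : t j ∈ Icc a b := ht.mem_Icc hk (by omega)
  have hIj : Icc (t j) (t j + d) ⊆ Icc a b := by
    rw [hjd]; exact Icc_subset_Icc hz.1 (ht.mem_Icc hk (by omega)).2
  set s : ℝ → ℝ := fun x => ∑ i ∈ Finset.range (n + 1), c i * bForm w a k t i x with hs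
  set A : ℕ → ℝ := fun e => ∑ i ∈ Finset.range (n + 1), c i * localCoeff w a k t i j (t j) e
    with hA
  set T := ∫ x in (t l)..(t (l + k)), |s x| with hT
  have hsI : IntervalIntegrable (fun x => |s x|) volume (t l) (t (l + k)) :=
    ((intervalIntegrable_sum_bForm hw hk ht c).mono_set (by
      rw [uIcc_of_le hw.lt.le]
      exact uIcc_subset_Icc (ht.mem_Icc hk (by omega)) (ht.mem_Icc hk (by omega)))).abs
  have hcombT : ∫ x in (t j)..(t j + d), |comb w (t j) 1 (k - 1)
      (fun e => A (k - 1 - e) * (-1) ^ (k - 1 - e)) x| ≤ T := by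
    have e1 : ∫ x in (t j)..(t j + d), |comb w (t j) 1 (k - 1)
        (fun e => A (k - 1 - e) * (-1) ^ (k - 1 - e)) x| = ∫ x in (t j)..(t j + d), |s x| := by
      rw [intervalIntegral.integral_of_le (by linarith), intervalIntegral.integral_of_le
        (by linarith), integral_Ioc_eq_integral_Ioo, integral_Ioc_eq_integral_Ioo]
      refine setIntegral_congr_fun measurableSet_Ioo fun x hx => ?_
      rw [hjd] at hx
      simp only [hs]
      rw [sum_bForm_eq hw hk ht (by omega) hz c hx]
    rw [e1, hjd]
    exact intervalIntegral.integral_mono_interval (ht.mono hlj (by omega)) hj.le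
      (ht.mono (by omega) (by omega)) (Eventually.of_forall fun _ => abs_nonneg _) hsI
  have hmark : ∀ e < k, |A (k - 1 - e)| * d ^ (e + 1) ≤ C * T := by
    intro e he
    have := hM w a b k 1 (t j) (t j) d (fun e => A (k - 1 - e) * (-1) ^ (k - 1 - e)) hw le_rfl
      (by omega) hz hIj hdp (fun x hx => by
        rw [abs_of_nonneg (sub_nonneg.2 hx.1)]; linarith [hx.2]) e (by omega)
    rw [abs_mul, abs_pow, abs_neg, abs_one, one_pow, mul_one] at this
    exact this.trans (mul_le_mul_of_nonneg_left hcombT hC.le)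
  have hφ : ∀ e < k, |spanTower w a k k c₂ (k - 1 - e) (t j)| ≤ (B * H) ^ e := by
    intro e he
    have hsub : Icc (t l) (t (l + k)) ⊆ Icc a b :=
      Icc_subset_Icc (ht.mem_Icc hk (by omega)).1 (ht.mem_Icc hk (by omega)).2
    have := h₂.abs_le hw (by omega) (fun q hq => ht.le_succ (by omega)) hsub
      (fun q hq => ⟨ht.mono (by omega) (by omega), ht.mono (by omega) (by omega)⟩)
      (Nat.sub_le (k - 1) e) (t j) ⟨ht.mono hlj (by omega), ht.mono (by omega) (by omega)⟩
    rwa [Nat.sub_add_cancel hk, show k - 1 - (k - 1 - e) = e by omega] at this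
  -- the local functional recovers the coefficient
  have hrec : ∑ e ∈ Finset.range k, A e * spanTower w a k k c₂ e (t j) =
      c l * ((-1) ^ (k + 1) * (alpha w a b k t l)⁻¹) := by
    simp only [hA, Finset.sum_mul]
    rw [Finset.sum_comm]
    have : ∀ i ∈ Finset.range (n + 1), ∑ e ∈ Finset.range k,
        c i * localCoeff w a k t i j (t j) e * spanTower w a k k c₂ e (t j) =
        if i = l then c l * ((-1) ^ (k + 1) * (alpha w a b k t l)⁻¹) else 0 := by
      intro i hi
      rw [Finset.mem_range] at hi
      simp only [mul_assoc]
      rw [← Finset.mul_sum, sum_localCoeff_mul hw hk ht (by omega) hl hlj hjl hj hz h₀ h₁ h₂ h]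
      split_ifs with hil
      · rw [hil]
      · rw [mul_zero]
    rw [Finset.sum_congr rfl this, Finset.sum_ite_eq', if_pos (Finset.mem_range.2 (by omega))]
  have hcl : |c l| = alpha w a b k t l *
      |∑ e ∈ Finset.range k, A e * spanTower w a k k c₂ e (t j)| := by
    rw [hrec, abs_mul, abs_mul, abs_pow, abs_neg, abs_one, one_pow, one_mul, abs_inv,
      abs_of_pos hα]
    field_simp
  have hbound : |∑ e ∈ Finset.range k, A e * spanTower w a k k c₂ e (t j)| * H ≤ S * C * T := by
    rw [← Finset.sum_range_reflect, mul_assoc, hS, Finset.sum_mul]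
    refine (mul_le_mul_of_nonneg_right (Finset.abs_sum_le_sum_abs _ _) hHp.le).trans ?_
    rw [Finset.sum_mul]
    refine Finset.sum_le_sum fun e he => ?_
    rw [Finset.mem_range] at he
    rw [abs_mul]
    calc |A (k - 1 - e)| * |spanTower w a k k c₂ (k - 1 - e) (t j)| * H
        ≤ |A (k - 1 - e)| * (B * H) ^ e * H := by gcongr; exact hφ e he
      _ = B ^ e * (|A (k - 1 - e)| * H ^ (e + 1)) := by rw [mul_pow]; ring
      _ ≤ B ^ e * (|A (k - 1 - e)| * (k * d) ^ (e + 1)) := by gcongr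
      _ = B ^ e * k ^ (e + 1) * (|A (k - 1 - e)| * d ^ (e + 1)) := by rw [mul_pow]; ring
      _ ≤ B ^ e * k ^ (e + 1) * (C * T) :=
          mul_le_mul_of_nonneg_left (hmark e he) (by positivity)
  calc |c l| * H = alpha w a b k t l *
        (|∑ e ∈ Finset.range k, A e * spanTower w a k k c₂ e (t j)| * H) := by rw [hcl]; ring
    _ ≤ alpha w a b k t l * (S * C * T) := mul_le_mul_of_nonneg_left hbound hα.le
    _ = _ := by ring

end Stability

/-! ### The B-splines span the spline space -/

section Smoothness

variable {w : ℕ → ℝ → ℝ} {a b m B : ℝ} {k n : ℕ} {t : ℕ → ℝ}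

theorem WeightsBounded.weightsIn (h : WeightsBounded a b k m B w) (hab : a < b) (hm : 0 < m) :
    WeightsIn a b k m B w := by
  refine ⟨hab, hm, fun i h1 h2 => (h i h1 h2).1.continuousOn, fun i h1 h2 => (h i h1 h2).2.1,
    fun i h1 h2 x hx => ?_⟩
  have := (h i h1 h2).2.2 0 (Nat.zero_le _) x hx
  rw [iteratedDerivWithin_zero] at this
  exact (le_abs_self _).trans this

theorem contDiffOn_integral_Icc (hab : a < b) {g : ℝ → ℝ} {r : ℕ}
    (hg : ContDiffOn ℝ (r : WithTop ℕ∞) g (Icc a b)) {z : ℝ} (hz : z ∈ Icc a b) :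
    ContDiffOn ℝ ((r + 1 : ℕ) : WithTop ℕ∞) (fun y => ∫ s in z..y, g s) (Icc a b) := by
  push_cast
  rw [contDiffOn_succ_iff_derivWithin (uniqueDiffOn_Icc hab)]
  refine ⟨fun y hy => (hasDerivWithinAt_integral_Icc hg.continuousOn hz hy).differentiableWithinAt,
    by simp, hg.congr fun y hy => ?_⟩
  exact (hasDerivWithinAt_integral_Icc hg.continuousOn hz hy).derivWithin
    (uniqueDiffOn_Icc hab y hy)

theorem contDiffOn_iterInt (hw : WeightsIn a b k m B w) (hW : WeightsBounded a b k m B w) {y : ℝ}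
    (hy : y ∈ Icc a b) (r : ℕ) : ∀ p, 1 ≤ p → p + r ≤ k →
      ContDiffOn ℝ ((k - p + 1 : ℕ) : WithTop ℕ∞) (iterInt w y p r) (Icc a b) := by
  induction r with
  | zero => intro p h1 h2; exact (hW p h1 h2).1
  | succ r ih =>
    intro p h1 h2
    have := contDiffOn_integral_Icc hw.lt (ih (p + 1) (by omega) (by omega)) hy
    rw [show k - (p + 1) + 1 + 1 = k - p + 1 by omega] at this
    exact (hW p h1 (by omega)).1.mul this

/-- The truncation of `iterInt w y p r` to the right of `y`. -/
noncomputable def truncInt (w : ℕ → ℝ → ℝ) (y : ℝ) (p r : ℕ) (x : ℝ) : ℝ :=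
  if y ≤ x then iterInt w y p r x else 0

theorem truncInt_succ (w : ℕ → ℝ → ℝ) (y : ℝ) (p r : ℕ) (x : ℝ) :
    truncInt w y p (r + 1) x = w p x * ∫ s in y..(max x y), iterInt w y (p + 1) r s := by
  rw [truncInt]
  split_ifs with h
  · rw [max_eq_left h, iterInt]
  · rw [max_eq_right (not_le.1 h).le, intervalIntegral.integral_same, mul_zero]

theorem integral_truncInt (hw : WeightsIn a b k m B w) {y : ℝ} (hy : y ∈ Icc a b) {p r : ℕ}
    (hp : 1 ≤ p) (hr : p + r ≤ k) {x : ℝ} (hx : x ∈ Icc a b) :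
    ∫ s in a..x, truncInt w y p r s = ∫ s in y..(max x y), iterInt w y p r s := by
  have h0 : ∀ u, a ≤ u → u ≤ y → ∫ s in a..u, truncInt w y p r s = 0 := by
    intro u h1 h2
    rw [intervalIntegral.integral_of_le h1, integral_Ioc_eq_integral_Ioo]
    refine setIntegral_eq_zero_of_forall_eq_zero fun s hs => ?_
    rw [truncInt, if_neg (not_le.2 (hs.2.trans_le h2))]
  have hc := continuousOn_iterInt hw hy r p hp hr
  rcases le_total x y with h | h
  · rw [max_eq_right h, intervalIntegral.integral_same, h0 x hx.1 h]
  · have i1 : IntervalIntegrable (truncInt w y p r) volume a y := by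
      refine (intervalIntegrable_const (c := (0 : ℝ))).congr_ae ?_
      rw [uIoc_of_le hy.1]
      refine (ae_restrict_iff' measurableSet_Ioc).2 ?_
      filter_upwards [compl_mem_ae_iff.2 (measure_singleton y)] with s hs1 hs2
      rw [truncInt, if_neg (not_le.2 (lt_of_le_of_ne hs2.2 hs1))]
    have i2 : IntervalIntegrable (truncInt w y p r) volume y x := by
      refine ((hc.mono (uIcc_subset_Icc hy hx)).intervalIntegrable).congr fun s hs => ?_
      rw [uIoc_of_le h] at hs
      rw [truncInt, if_pos hs.1.le]
    rw [max_eq_left h, ← intervalIntegral.integral_add_adjacent_intervals i1 i2,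
      h0 y hy.1 le_rfl, zero_add]
    refine intervalIntegral.integral_congr fun s hs => ?_
    rw [uIcc_of_le h] at hs
    simp only [truncInt, if_pos hs.1]

theorem contDiffOn_truncInt (hw : WeightsIn a b k m B w) (hW : WeightsBounded a b k m B w) {y : ℝ}
    (hy : y ∈ Icc a b) (r : ℕ) : ∀ p, 1 ≤ p → p + (r + 1) ≤ k →
      ContDiffOn ℝ (r : WithTop ℕ∞) (truncInt w y p (r + 1)) (Icc a b) := by
  induction r with
  | zero =>
    intro p h1 h2
    have hc : ContinuousOn (fun x => ∫ s in y..(max x y), iterInt w y (p + 1) 0 s) (Icc a b) :=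
      (continuousOn_integral_Icc (continuousOn_iterInt hw hy 0 (p + 1) (by omega) (by omega))
        hy).comp (f := fun x => max x y) (by fun_prop)
        fun x hx => ⟨hx.1.trans (le_max_left _ _), max_le hx.2 hy.2⟩
    rw [Nat.cast_zero, contDiffOn_zero]
    exact ((hw.cont p h1 (by omega)).mul hc).congr fun x _ => truncInt_succ w y p 0 x
  | succ r ih =>
    intro p h1 h2
    have hi := contDiffOn_integral_Icc hw.lt (ih (p + 1) (by omega) (by omega))
      (left_mem_Icc.2 hw.lt.le)
    have hwp : ContDiffOn ℝ ((r + 1 : ℕ) : WithTop ℕ∞) (w p) (Icc a b) :=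
      (hW p h1 (by omega)).1.of_le (by exact_mod_cast (by omega : r + 1 ≤ k - p + 1))
    refine (hwp.mul hi).congr fun x hx => ?_
    rw [truncInt_succ, integral_truncInt hw hy (by omega) (by omega) hx]

theorem gFun_eq_truncInt (y x : ℝ) : gFun w k x y = truncInt w y 1 (k - 1) x := rfl

/-- If a `C^r` function vanishes on one side of `z` and is an element of the Chebyshev space of
`w_p, …, w_{p+r+1}` on the other, only the last canonical function based at `z` occurs: continuity
at `z` kills the coefficient of `w_p`, and dividing by `w_p` and differentiating lowers `r`. -/
theorem comb_coeff_eq_zero_of_contDiffOn (hw : WeightsIn a b k m B w)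
    (hW : WeightsBounded a b k m B w) {α β z : ℝ} (hz : z ∈ Ioo α β) (hU : Ioo α β ⊆ Icc a b)
    (r : ℕ) : ∀ (p : ℕ) (f : ℝ → ℝ) (c : ℕ → ℝ), 1 ≤ p → p + (r + 1) ≤ k →
      ContDiffOn ℝ (r : WithTop ℕ∞) f (Ioo α β) → (∀ x ∈ Ioo α z, f x = 0) →
      (∀ x ∈ Ioo z β, f x = comb w z p (r + 1) c x) → ∀ e ≤ r, c e = 0 := by
  have hzI : z ∈ Icc a b := hU hz
  have hbase : ∀ (r p : ℕ) (f : ℝ → ℝ) (c : ℕ → ℝ), 1 ≤ p → p + r ≤ k →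
      ContinuousOn f (Ioo α β) → (∀ x ∈ Ioo α z, f x = 0) →
      (∀ x ∈ Ioo z β, f x = comb w z p r c x) → c 0 = 0 := by
    intro r p f c h1 h2 hf hl hr
    have hfz : ContinuousAt f z := hf.continuousAt (Ioo_mem_nhds hz.1 hz.2)
    have e1 : f z = 0 := by
      refine tendsto_nhds_unique (hfz.tendsto.mono_left nhdsWithin_le_nhds :
        Tendsto f (𝓝[<] z) _) ?_
      refine tendsto_const_nhds.congr' ?_
      filter_upwards [Ioo_mem_nhdsLT hz.1] with x hx using (hl x hx).symm
    have hcz : ContinuousAt (comb w z p r c) z :=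
      ((continuousOn_comb hw hzI h1 h2 c).mono hU).continuousAt (Ioo_mem_nhds hz.1 hz.2)
    have e2 : f z = comb w z p r c z := by
      refine tendsto_nhds_unique (hfz.tendsto.mono_left nhdsWithin_le_nhds :
        Tendsto f (𝓝[>] z) _) ?_
      refine (hcz.tendsto.mono_left nhdsWithin_le_nhds).congr' ?_
      filter_upwards [Ioo_mem_nhdsGT hz.2] with x hx using (hr x hx).symm
    have e3 : comb w z p r c z = c 0 * w p z := by
      rw [comb, Finset.sum_range_succ', Finset.sum_eq_zero, zero_add]
      · rfl
      · intro e _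
        simp [iterInt]
    have hpos : w p z ≠ 0 := (hw.pos.trans_le (hw.ge p h1 (by omega) z hzI)).ne'
    exact (mul_eq_zero.1 (e3.symm.trans (e2.symm.trans e1))).resolve_right hpos
  induction r with
  | zero =>
    intro p f c h1 h2 hf hl hr e he
    rw [Nat.le_zero.1 he]
    exact hbase 1 p f c h1 h2 hf.continuousOn hl hr
  | succ r ih =>
    intro p f c h1 h2 hf hl hr
    have hc0 := hbase (r + 1 + 1) p f c h1 h2 hf.continuousOn hl hr
    have hne : ∀ x ∈ Ioo α β, w p x ≠ 0 := fun x hx =>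
      (hw.pos.trans_le (hw.ge p h1 (by omega) x (hU hx))).ne'
    have hwp : ContDiffOn ℝ ((r + 1 : ℕ) : WithTop ℕ∞) (w p) (Ioo α β) :=
      ((hW p h1 (by omega)).1.of_le (by exact_mod_cast (by omega : r + 1 ≤ k - p + 1))).mono hU
    have hg : ContDiffOn ℝ ((r + 1 : ℕ) : WithTop ℕ∞) (fun x => f x / w p x) (Ioo α β) :=
      hf.div hwp hne
    push_cast at hg
    rw [contDiffOn_succ_iff_deriv_of_isOpen isOpen_Ioo] at hg
    have hcont := continuousOn_comb hw hzI (p := p + 1) (r := r + 1) (by omega) (by omega)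
      (fun e => c (e + 1))
    have key := ih (p + 1) (deriv fun x => f x / w p x) (fun e => c (e + 1)) (by omega) (by omega)
      hg.2.2 (fun x hx => by
        have : (fun x => f x / w p x) =ᶠ[𝓝 x] fun _ => 0 := by
          filter_upwards [Ioo_mem_nhds hx.1 hx.2] with s hs
          rw [hl s hs, zero_div]
        rw [this.deriv_eq, deriv_const]) (fun x hx => by
        have hsub : Ioo z β ⊆ Ioo α β := Ioo_subset_Ioo_left hz.1.le
        have : (fun x => f x / w p x) =ᶠ[𝓝 x] fun x =>
            c 0 + ∫ s in z..x, comb w z (p + 1) (r + 1) (fun e => c (e + 1)) s := by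
          filter_upwards [Ioo_mem_nhds hx.1 hx.2] with s hs
          rw [hr s hs, comb_succ hw hzI h2 c (hU (hsub hs)),
            mul_div_cancel_left₀ _ (hne s (hsub hs))]
        rw [this.deriv_eq]
        have hd := (hasDerivWithinAt_integral_Icc hcont hzI (hU (hsub hx))).hasDerivAt
          (mem_of_superset (Ioo_mem_nhds hx.1 hx.2) (hsub.trans hU))
        exact (hd.const_add (c 0)).deriv)
    intro e he
    cases e with
    | zero => exact hc0
    | succ e => exact key e (by omega)

end Smoothness

section Span

variable {w : ℕ → ℝ → ℝ} {a b m B : ℝ} {k n : ℕ} {t : ℕ → ℝ}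

/-- The truncated power basis of the spline space: `u_1, …, u_k` and `g_k(·, t_q)` for the interior
knots `t_q`, `k ≤ q ≤ n`. -/
noncomputable def truncBasis (w : ℕ → ℝ → ℝ) (a : ℝ) (k : ℕ) (t : ℕ → ℝ) (q : ℕ) (x : ℝ) : ℝ :=
  if q < k then hFun w (q + 1) x a else gFun w k x (t q)

/-- The span of the truncated power basis. -/
noncomputable def truncSpan (w : ℕ → ℝ → ℝ) (a : ℝ) (k n : ℕ) (t : ℕ → ℝ) :
    Submodule ℝ (ℝ → ℝ) :=
  Submodule.span ℝ (truncBasis w a k t '' Iic n)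

theorem exists_mem_uSpace_hFun (hw : WeightsIn a b k m B w) (hk : 1 ≤ k) {y : ℝ}
    (hy : y ∈ Icc a b) : ∃ v ∈ uSpace w a k, EqOn (fun x => hFun w k x y) v (Icc a b) := by
  refine ⟨∑ e ∈ Finset.range k, ((-1) ^ e * dualTower w a k e 0 y) • uFun w a (k - e),
    Submodule.sum_mem _ fun e he => Submodule.smul_mem _ _ (Submodule.subset_span
      ⟨k - e, ⟨by rw [Finset.mem_range] at he; omega, Nat.sub_le k e⟩, rfl⟩), fun x hx => ?_⟩
  have := hFun_addition hw hx hy (left_mem_Icc.2 hw.lt.le) (d := 0) (by omega)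
  simp only [pow_zero, one_mul, Nat.sub_zero] at this
  simp only [this, Finset.sum_apply, Pi.smul_apply, smul_eq_mul, uFun]
  exact Finset.sum_congr rfl fun e _ => by ring

/-- The canonical system can be based at any point of the interval. -/
theorem exists_comb_of_mem_uSpace (hw : WeightsIn a b k m B w) (hk : 1 ≤ k) {z : ℝ}
    (hz : z ∈ Icc a b) {v : ℝ → ℝ} (hv : v ∈ uSpace w a k) :
    ∃ c, EqOn v (comb w z 1 (k - 1) c) (Icc a b) := by
  induction hv using Submodule.span_induction with
  | mem v hv =>
    obtain ⟨i, hi, rfl⟩ := hv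
    have hi1 : 1 ≤ i := hi.1
    have hik : i ≤ k := hi.2
    refine ⟨fun e => if e < i then (-1) ^ (i - 1 - e) * dualTower w z i (i - 1 - e) 0 a else 0,
      fun x hx => ?_⟩
    have := hFun_addition (hw.mono hik) hx (left_mem_Icc.2 hw.lt.le) hz (d := 0) (by omega)
    simp only [pow_zero, one_mul, Nat.sub_zero] at this
    rw [uFun, this, comb, Nat.sub_add_cancel hk, ← Finset.sum_range_reflect]
    have hsub : Finset.range i ⊆ Finset.range k := Finset.range_mono hik
    rw [← Finset.sum_subset hsub (fun e _ he => by
      rw [if_neg (by simpa using he), zero_mul])]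
    refine Finset.sum_congr rfl fun e he => ?_
    rw [Finset.mem_range] at he
    rw [if_pos he, hFun, show i - (i - 1 - e) - 1 = e by omega]
    ring
  | zero => exact ⟨fun _ => 0, fun x _ => by simp [comb]⟩
  | add u v _ _ hu hv =>
    obtain ⟨c, hc⟩ := hu
    obtain ⟨d, hd⟩ := hv
    refine ⟨fun e => c e + d e, fun x hx => ?_⟩
    rw [Pi.add_apply, hc hx, hd hx, comb, comb, comb, ← Finset.sum_add_distrib]
    exact Finset.sum_congr rfl fun e _ => by ring
  | smul r v _ hv =>
    obtain ⟨c, hc⟩ := hv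
    refine ⟨fun e => r * c e, fun x hx => ?_⟩
    rw [Pi.smul_apply, hc hx, comb, comb, smul_eq_mul, Finset.mul_sum]
    exact Finset.sum_congr rfl fun e _ => by ring

theorem IsPartition.Ioo_subset (ht : IsPartition a b k n t) (hk : 1 ≤ k) {j : ℕ}
    (hj : j + 1 ≤ n + k) : Ioo (t j) (t (j + 1)) ⊆ Icc a b := fun _ hx =>
  ⟨(ht.mem_Icc hk (by omega)).1.trans hx.1.le, hx.2.le.trans (ht.mem_Icc hk hj).2⟩

theorem truncSpan_le_splineSpace (hw : WeightsIn a b k m B w) (hW : WeightsBounded a b k m B w)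
    (hk : 1 ≤ k) (ht : IsPartition a b k n t) :
    truncSpan w a k n t ≤ splineSpace w a b k n t := by
  have ha : a ∈ Icc a b := left_mem_Icc.2 hw.lt.le
  refine Submodule.span_le.2 ?_
  rintro _ ⟨q, hq, rfl⟩
  have hqn : q ≤ n := hq
  by_cases hqk : q < k
  · have e : truncBasis w a k t q = iterInt w a 1 q := by
      ext x; rw [truncBasis, if_pos hqk, hFun, Nat.add_sub_cancel]
    rw [e]
    refine ⟨fun h2 => (contDiffOn_iterInt hw hW ha q 1 le_rfl (by omega)).of_le
      (by exact_mod_cast (by omega : k - 2 ≤ k - 1 + 1)), fun j _ _ => ⟨iterInt w a 1 q, ?_,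
      fun _ _ => rfl⟩⟩
    refine Submodule.subset_span ⟨q + 1, ⟨by omega, by omega⟩, ?_⟩
    ext x
    rw [uFun, hFun, Nat.add_sub_cancel]
  · have hqI : t q ∈ Icc a b := ht.mem_Icc hk (by omega)
    have e : truncBasis w a k t q = truncInt w (t q) 1 (k - 1) := by
      ext x; rw [truncBasis, if_neg hqk, gFun_eq_truncInt]
    refine ⟨fun h2 => ?_, fun j h1 h2 => ?_⟩
    · rw [e, show k - 1 = k - 2 + 1 by omega]
      exact contDiffOn_truncInt hw hW hqI (k - 2) 1 le_rfl (by omega)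
    · have hg : ∀ x ∈ Ioo (t j) (t (j + 1)), truncBasis w a k t q x =
          if q ≤ j then hFun w k x (t q) else 0 := fun x hx => by
        rw [truncBasis, if_neg hqk, gFun_eq_of_mem_Ioo ht j (by omega) (by omega) hx]
      by_cases hqj : q ≤ j
      · obtain ⟨v, hv, hv'⟩ := exists_mem_uSpace_hFun hw hk hqI
        refine ⟨v, hv, fun x hx => ?_⟩
        rw [hg x hx, if_pos hqj, ← hv' (ht.Ioo_subset hk (by omega) hx)]
      · refine ⟨0, Submodule.zero_mem _, fun x hx => ?_⟩
        rw [hg x hx, if_neg hqj, Pi.zero_apply]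

/-- A spline is a combination of the truncated power basis, on all grid intervals at once. -/
theorem exists_mem_truncSpan (hw : WeightsIn a b k m B w) (hW : WeightsBounded a b k m B w)
    (hk : 1 ≤ k) (ht : IsPartition a b k n t) {s : ℝ → ℝ} (hs : s ∈ splineSpace w a b k n t) :
    ∀ j, k - 1 ≤ j → j ≤ n → ∃ v ∈ truncSpan w a k n t,
      ∀ i, k ≤ i + 1 → i ≤ j → EqOn s v (Ioo (t i) (t (i + 1))) := by
  have hn := ht.le
  intro j hj
  induction j, hj using Nat.le_induction with
  | base =>
    intro _
    obtain ⟨v, hv, hv'⟩ := hs.2 (k - 1) (by omega) (by omega)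
    refine ⟨v, ?_, fun i h1 h2 => ?_⟩
    · refine (Submodule.span_mono ?_ : uSpace w a k ≤ truncSpan w a k n t) hv
      rintro _ ⟨i, ⟨hi1, hi2⟩, rfl⟩
      refine ⟨i - 1, by simp; omega, ?_⟩
      ext x
      rw [truncBasis, if_pos (by omega), uFun, Nat.sub_add_cancel hi1]
    · rw [show i = k - 1 by omega]; exact hv'
  | succ j hj ih =>
    intro hjn
    obtain ⟨v, hv, hsv⟩ := ih (by omega)
    have hr : s - v ∈ splineSpace w a b k n t :=
      Submodule.sub_mem _ hs (truncSpan_le_splineSpace hw hW hk ht hv)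
    obtain ⟨u, hu, hru⟩ := hr.2 (j + 1) (by omega) hjn
    have hz : t (j + 1) ∈ Icc a b := ht.mem_Icc hk (by omega)
    obtain ⟨c, hc⟩ := exists_comb_of_mem_uSpace hw hk hz hu
    have h1 : t j < t (j + 1) := ht.lt j (by omega) (by omega)
    have h2 : t (j + 1) < t (j + 1 + 1) := ht.lt (j + 1) (by omega) hjn
    -- smoothness leaves only a multiple of `g_k(·, t_{j+1})` as correction
    have hc0 : ∀ e, e + 1 < k → c e = 0 := by
      intro e he
      have hU : Ioo (t j) (t (j + 1 + 1)) ⊆ Icc a b := fun x hx =>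
        ⟨(ht.mem_Icc hk (by omega)).1.trans hx.1.le,
          hx.2.le.trans (ht.mem_Icc hk (by omega)).2⟩
      refine comb_coeff_eq_zero_of_contDiffOn hw hW (z := t (j + 1)) ⟨h1, h2⟩ hU (k - 2) 1 (s - v) c
        le_rfl (by omega) ((hr.1 (by omega)).mono hU) (fun x hx => ?_) (fun x hx => ?_) e (by omega)
      · rw [Pi.sub_apply, hsv j (by omega) le_rfl hx, sub_self]
      · rw [hru hx, hc (ht.Ioo_subset hk (by omega) hx), show k - 2 + 1 = k - 1 by omega]
    refine ⟨v + c (k - 1) • truncBasis w a k t (j + 1), Submodule.add_mem _ hv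
      (Submodule.smul_mem _ _ (Submodule.subset_span ⟨j + 1, hjn, rfl⟩)), fun i hi1 hi2 x hx => ?_⟩
    have hT : truncBasis w a k t (j + 1) x = if j + 1 ≤ i then hFun w k x (t (j + 1)) else 0 := by
      rw [truncBasis, if_neg (by omega), gFun_eq_of_mem_Ioo ht i (by omega) (by omega) hx]
    rw [Pi.add_apply, Pi.smul_apply, hT, smul_eq_mul]
    rcases Nat.lt_or_ge i (j + 1) with hij | hij
    · rw [if_neg (by omega), mul_zero, add_zero, hsv i hi1 (by omega) hx]
    · obtain rfl : i = j + 1 := by omega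
      rw [if_pos le_rfl]
      have e1 : s x - v x = comb w (t (j + 1)) 1 (k - 1) c x := by
        rw [← hc (ht.Ioo_subset hk (by omega) hx), ← hru hx, Pi.sub_apply]
      rw [comb, Finset.sum_range_succ, Finset.sum_eq_zero, zero_add] at e1
      · rw [hFun, ← e1]; ring
      · intro e he
        rw [Finset.mem_range] at he
        rw [hc0 e (by omega), zero_mul]

theorem exists_mem_truncSpan_bForm (hk : 1 ≤ k) (ht : IsPartition a b k n t) {i : ℕ} (hi : i ≤ n) :
    ∃ v ∈ truncSpan w a k n t, EqOn (bForm w a k t i) v (Ioo a b) := by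
  have hn := ht.le
  have hterm : ∀ q : Fin (k + 1), ∃ v ∈ truncSpan w a k n t,
      EqOn (fun x => gFun w (k - mult (fun l => t (i + l)) q) x (t (i + q))) v (Ioo a b) := by
    intro q
    have hlt := ht.mult_lt hk hi (l := q) (by omega)
    by_cases h1 : i + q < k
    · refine ⟨truncBasis w a k t (k - mult (fun l => t (i + l)) q - 1),
        Submodule.subset_span ⟨_, by simp; omega, rfl⟩, fun x hx => ?_⟩
      simp only
      rw [truncBasis, if_pos (by omega), gFun, ht.left _ h1, if_pos hx.1.le,
        Nat.sub_add_cancel (by omega)]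
    by_cases h2 : i + q ≤ n
    · have hm : mult (fun l => t (i + l)) q = 0 := by
        by_contra hcon
        have h3 := ht.lt (i + q) (by omega) h2
        have h4 := ht.lt (i + q - 1) (by omega) (by omega)
        rw [show i + q - 1 + 1 = i + q by omega] at h4
        rcases ht.eq_or_of_mult_ne_zero (by omega) hi hcon with h | h
        · exact absurd (ht.mem_Icc hk (i := i + q - 1) (by omega)).1 (not_le.2 (h ▸ h4))
        · exact absurd (ht.mem_Icc hk (i := i + q + 1) (by omega)).2 (not_le.2 (h ▸ h3))
      refine ⟨truncBasis w a k t (i + q), Submodule.subset_span ⟨_, h2, rfl⟩, fun x _ => ?_⟩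
      simp only
      rw [truncBasis, if_neg h1, hm, Nat.sub_zero]
    · refine ⟨0, Submodule.zero_mem _, fun x hx => ?_⟩
      simp only
      rw [gFun, ht.right _ (by omega) (by omega), if_neg (not_le.2 hx.2), Pi.zero_apply]
  choose v hv hv' using hterm
  refine ⟨(-1 : ℝ) ^ k • ∑ q : Fin (k + 1), (ddCoeff w a k (fun l => t (i + l)) q *
    (-1) ^ mult (fun l => t (i + l)) q) • v q, Submodule.smul_mem _ _ (Submodule.sum_mem _
      fun q _ => Submodule.smul_mem _ _ (hv q)), fun x hx => ?_⟩
  rw [bForm, Pi.smul_apply, Finset.sum_apply, smul_eq_mul]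
  congr 1
  refine Finset.sum_congr rfl fun q _ => ?_
  have := hv' q hx
  simp only at this
  rw [this, Pi.smul_apply, smul_eq_mul]
  ring

/-- The B-splines are linearly independent on the open grid intervals. -/
theorem bForm_coeff_eq_zero (hw : WeightsIn a b k m B w)
    (hk : 1 ≤ k) (ht : IsPartition a b k n t) {c : ℕ → ℝ}
    (h : ∀ j, k ≤ j + 1 → j ≤ n → ∀ x ∈ Ioo (t j) (t (j + 1)),
      ∑ i ∈ Finset.range (n + 1), c i * bForm w a k t i x = 0) : ∀ l ≤ n, c l = 0 := by
  intro l hl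
  obtain ⟨D, _, hD⟩ := exists_stability_bound k hk m B hw.pos (hw.bound_pos hk)
  have h1 := hD w a b n t hw ht c l hl
  have h2 : ∫ x in (t l)..(t (l + k)),
      |∑ i ∈ Finset.range (n + 1), c i * bForm w a k t i x| = 0 := by
    rw [intervalIntegral.integral_of_le (ht.lt_add hk hl).le, integral_eq_zero_of_ae]
    have hsub : Ioc (t l) (t (l + k)) ⊆ Icc a b := fun x hx =>
      ⟨(ht.mem_Icc hk (by omega)).1.trans hx.1.le, hx.2.trans (ht.mem_Icc hk (by omega)).2⟩
    refine ae_restrict_of_ae_restrict_of_subset hsub ?_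
    filter_upwards [ht.ae_mem_Ioo hk] with x hx
    obtain ⟨-, j, hj1, hj2, hxj⟩ := hx
    simp [h j hj1 hj2 x hxj]
  rw [h2, mul_zero] at h1
  have h3 : 0 < t (l + k) - t l := sub_pos.2 (ht.lt_add hk hl)
  have h4 : |c l| ≤ 0 := by
    by_contra! hcon
    exact absurd h1 (not_le.2 (mul_pos hcon h3))
  exact abs_eq_zero.1 (le_antisymm h4 (abs_nonneg _))

/-- Every spline is a combination of the B-splines on the open grid intervals. -/
theorem exists_coeff_of_mem_splineSpace (hw : WeightsIn a b k m B w)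
    (hW : WeightsBounded a b k m B w) (hk : 1 ≤ k) (ht : IsPartition a b k n t) {s : ℝ → ℝ}
    (hs : s ∈ splineSpace w a b k n t) :
    ∃ c : ℕ → ℝ, ∀ j, k ≤ j + 1 → j ≤ n → ∀ x ∈ Ioo (t j) (t (j + 1)),
      s x = ∑ i ∈ Finset.range (n + 1), c i * bForm w a k t i x := by
  have hn := ht.le
  -- restrict everything to the union `G` of the open grid intervals, and count dimensions
  set G : Set ℝ := {x | ∃ j, k ≤ j + 1 ∧ j ≤ n ∧ x ∈ Ioo (t j) (t (j + 1))} with hG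
  have hGI : G ⊆ Ioo a b := by
    rintro x ⟨j, h1, h2, hx⟩
    exact ⟨(ht.mem_Icc hk (by omega)).1.trans_lt hx.1,
      hx.2.trans_le (ht.mem_Icc hk (by omega)).2⟩
  let R : (ℝ → ℝ) →ₗ[ℝ] (G → ℝ) := LinearMap.funLeft ℝ ℝ (fun x : G => (x : ℝ))
  let N : Fin (n + 1) → G → ℝ := fun i => R (bForm w a k t i)
  let T : Fin (n + 1) → G → ℝ := fun q => R (truncBasis w a k t q)
  have hmapT : (truncSpan w a k n t).map R ≤ Submodule.span ℝ (range T) := by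
    rw [truncSpan, Submodule.map_span]
    refine Submodule.span_mono ?_
    rintro _ ⟨_, ⟨q, hq, rfl⟩, rfl⟩
    exact ⟨⟨q, Nat.lt_succ_of_le hq⟩, rfl⟩
  have hNT : Submodule.span ℝ (range N) ≤ Submodule.span ℝ (range T) := by
    refine Submodule.span_le.2 ?_
    rintro _ ⟨i, rfl⟩
    obtain ⟨v, hv, hv'⟩ := exists_mem_truncSpan_bForm hk ht (i := i) (by omega)
    have : N i = R v := by ext x; exact hv' (hGI x.2)
    rw [this]
    exact hmapT (Submodule.mem_map_of_mem hv)
  have hli : LinearIndependent ℝ N := by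
    rw [Fintype.linearIndependent_iff]
    intro g hg i
    have key := bForm_coeff_eq_zero hw hk ht (c := fun i => if h : i < n + 1 then g ⟨i, h⟩ else 0)
      (fun j h1 h2 x hx => by
        have := congrFun hg ⟨x, j, h1, h2, hx⟩
        rw [Finset.sum_apply] at this
        rw [Finset.sum_range]
        simp only [Fin.is_lt, dite_true, Fin.eta]
        exact this) i (by omega)
    simpa only [i.2, dite_true, Fin.eta] using key
  have hfin : Module.finrank ℝ (Submodule.span ℝ (range T)) ≤
      Module.finrank ℝ (Submodule.span ℝ (range N)) := by
    rw [finrank_span_eq_card hli]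
    exact finrank_range_le_card T
  have : FiniteDimensional ℝ (Submodule.span ℝ (range T)) :=
    FiniteDimensional.span_of_finite ℝ (finite_range T)
  have heq := Submodule.eq_of_le_of_finrank_le hNT hfin
  obtain ⟨v, hv, hsv⟩ := exists_mem_truncSpan hw hW hk ht hs n (by omega) le_rfl
  have hvN : R v ∈ Submodule.span ℝ (range N) := heq ▸ hmapT (Submodule.mem_map_of_mem hv)
  obtain ⟨g, hg⟩ := (Submodule.mem_span_range_iff_exists_fun ℝ).1 hvN
  refine ⟨fun i => if h : i < n + 1 then g ⟨i, h⟩ else 0, fun j h1 h2 x hx => ?_⟩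
  have := congrFun hg ⟨x, j, h1, h2, hx⟩
  rw [hsv j h1 h2 hx, Finset.sum_range]
  simp only [Fin.is_lt, dite_true, Fin.eta]
  rw [Finset.sum_apply] at this
  exact this.symm

end Span

/-! ### Partition of unity and bounds for the B-splines -/

section Unity

variable {w : ℕ → ℝ → ℝ} {a b m B : ℝ} {k n : ℕ} {t : ℕ → ℝ}

theorem comb_coeff_unique (hw : WeightsIn a b k m B w) (hk : 1 ≤ k) {z x y : ℝ} (hz : z ∈ Icc a b)
    (hxy : x < y) (hI : Icc x y ⊆ Icc a b) {c d : ℕ → ℝ}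
    (h : ∀ s ∈ Ioo x y, comb w z 1 (k - 1) c s = comb w z 1 (k - 1) d s) :
    ∀ e < k, c e = d e := by
  intro e he
  obtain ⟨C, -, hM⟩ := exists_markov_bound m B hw.pos (hw.bound_pos hk) (k - 1)
    ((b - a) / (y - x)) (div_nonneg (sub_nonneg.2 hw.lt.le) (sub_nonneg.2 hxy.le))
  have hpos : 0 < y - x := sub_pos.2 hxy
  have h1 := hM w a b k 1 z x (y - x) (fun e => c e - d e) hw le_rfl (by omega) hz
    (by rwa [add_sub_cancel]) hpos (fun s hs => by
      rw [add_sub_cancel] at hs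
      rw [div_mul_cancel₀ _ hpos.ne']
      have := hI hs
      exact abs_sub_le_iff.2 ⟨by linarith [this.2, hz.1], by linarith [this.1, hz.2]⟩) e (by omega)
  have h2 : ∫ s in x..(x + (y - x)), |comb w z 1 (k - 1) (fun e => c e - d e) s| = 0 := by
    rw [add_sub_cancel, intervalIntegral.integral_of_le hxy.le, integral_Ioc_eq_integral_Ioo]
    refine setIntegral_eq_zero_of_forall_eq_zero fun s hs => ?_
    have : comb w z 1 (k - 1) (fun e => c e - d e) s =
        comb w z 1 (k - 1) c s - comb w z 1 (k - 1) d s := by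
      simp only [comb, ← Finset.sum_sub_distrib, sub_mul]
    rw [this, h s hs, sub_self, abs_zero]
  rw [h2, mul_zero] at h1
  have h3 : |c e - d e| ≤ 0 := by
    by_contra! hcon
    exact absurd h1 (not_le.2 (mul_pos hcon (pow_pos hpos _)))
  exact sub_eq_zero.1 (abs_eq_zero.1 (le_antisymm h3 (abs_nonneg _)))

/-- The renormalized B-splines `α_i M_i` sum up to `u_1 = w_1`. The local functional dual to
`α_l M_l` takes the value of the leading coefficient of `φ_{l+1,k}`, up to sign, on `u_1`. -/
theorem sum_alpha_mul_bForm (hw : WeightsIn a b k m B w) (hW : WeightsBounded a b k m B w)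
    (hk : 1 ≤ k) (ht : IsPartition a b k n t) {j : ℕ} (hj1 : k ≤ j + 1) (hj2 : j ≤ n) {x : ℝ}
    (hx : x ∈ Ioo (t j) (t (j + 1))) :
    ∑ i ∈ Finset.range (n + 1), alpha w a b k t i * bForm w a k t i x = w 1 x := by
  have h1 : uFun w a 1 ∈ splineSpace w a b k n t := by
    refine truncSpan_le_splineSpace hw hW hk ht (Submodule.subset_span ⟨0, Nat.zero_le n, ?_⟩)
    ext x
    rw [truncBasis, if_pos (by omega), uFun]
  obtain ⟨c, hc⟩ := exists_coeff_of_mem_splineSpace hw hW hk ht h1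
  suffices h : ∀ l ≤ n, c l = alpha w a b k t l by
    have h2 := hc j hj1 hj2 x hx
    change w 1 x = _ at h2
    rw [h2]
    exact Finset.sum_congr rfl fun i hi => by
      rw [h i (by rw [Finset.mem_range] at hi; omega)]
  intro l hl
  obtain ⟨i, hli, hil, hlong⟩ := exists_long_interval t hk l
  obtain ⟨c₀, c₁, c₂, h₀, h₁, h₂, h⟩ := exists_alpha_spec hw hk ht hl
  have hi : t i < t (i + 1) := by
    have hlt := ht.lt_add hk hl
    by_contra! hcon
    have : (k : ℝ) * (t (i + 1) - t i) ≤ 0 :=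
      mul_nonpos_of_nonneg_of_nonpos (Nat.cast_nonneg k) (by linarith)
    linarith
  have hki : k ≤ i + 1 := by
    by_contra! hcon
    rw [ht.left i (by omega), ht.left (i + 1) hcon] at hi
    exact lt_irrefl _ hi
  have hin : i ≤ n := by
    by_contra! hcon
    rw [ht.right i (by omega) (by omega), ht.right (i + 1) (by omega) (by omega)] at hi
    exact lt_irrefl _ hi
  have hz : t i ∈ Icc a b := ht.mem_Icc hk (by omega)
  -- compare the local representations of `w_1` and of its B-spline expansion
  have huniq := comb_coeff_unique hw hk hz hi
    (Icc_subset_Icc hz.1 (ht.mem_Icc hk (by omega)).2)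
    (c := fun e => (∑ q ∈ Finset.range (n + 1),
      c q * localCoeff w a k t q i (t i) (k - 1 - e)) * (-1) ^ (k - 1 - e))
    (d := fun e => if e = 0 then 1 else 0) (fun s hs => by
      rw [← sum_bForm_eq hw hk ht (by omega) hz c hs, ← hc i hki hin s hs, comb,
        Finset.sum_range_succ', Finset.sum_eq_zero (fun e _ => by simp)]
      simp [uFun, hFun, iterInt])
  have hrec : ∑ e ∈ Finset.range k, (∑ q ∈ Finset.range (n + 1),
      c q * localCoeff w a k t q i (t i) e) * spanTower w a k k c₂ e (t i) =
      c l * ((-1) ^ (k + 1) * (alpha w a b k t l)⁻¹) := by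
    simp only [Finset.sum_mul]
    rw [Finset.sum_comm]
    have : ∀ q ∈ Finset.range (n + 1), ∑ e ∈ Finset.range k,
        c q * localCoeff w a k t q i (t i) e * spanTower w a k k c₂ e (t i) =
        if q = l then c l * ((-1) ^ (k + 1) * (alpha w a b k t l)⁻¹) else 0 := by
      intro q hq
      rw [Finset.mem_range] at hq
      simp only [mul_assoc]
      rw [← Finset.mul_sum, sum_localCoeff_mul hw hk ht (by omega) hl hli hil hi hz h₀ h₁ h₂ h]
      split_ifs with hql
      · rw [hql]
      · rw [mul_zero]
    rw [Finset.sum_congr rfl this, Finset.sum_ite_eq', if_pos (Finset.mem_range.2 (by omega))]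
  have hA : ∀ e < k, ∑ q ∈ Finset.range (n + 1), c q * localCoeff w a k t q i (t i) e =
      if e = k - 1 then (-1) ^ (k - 1) else 0 := by
    intro e he
    have := huniq (k - 1 - e) (by omega)
    simp only [show k - 1 - (k - 1 - e) = e by omega] at this
    have hs : ((-1 : ℝ) ^ e) * (-1) ^ e = 1 := by rw [← mul_pow]; simp
    have h3 : ∑ q ∈ Finset.range (n + 1), c q * localCoeff w a k t q i (t i) e =
        (∑ q ∈ Finset.range (n + 1), c q * localCoeff w a k t q i (t i) e) * (-1) ^ e *
          (-1) ^ e := by rw [mul_assoc, hs, mul_one]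
    rw [h3, this]
    by_cases hek : e = k - 1
    · rw [if_pos (by omega), if_pos hek, one_mul, hek]
    · rw [if_neg (by omega), if_neg hek, zero_mul]
  rw [Finset.sum_congr rfl fun e he => by rw [hA e (Finset.mem_range.1 he)]] at hrec
  simp only [ite_mul, zero_mul] at hrec
  rw [Finset.sum_ite_eq', if_pos (Finset.mem_range.2 (by omega))] at hrec
  have htop := spanTower_top (w := w) (a := a) (k := k) (k - 1) c₂ (t i)
  rw [Nat.sub_add_cancel hk, h₂.1] at htop
  rw [htop, mul_one, show k + 1 = k - 1 + 2 by omega, pow_add] at hrec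
  have hne : ((-1 : ℝ) ^ (k - 1)) ≠ 0 := pow_ne_zero _ (by norm_num)
  have hα := (alpha_pos hw hk ht hl).ne'
  have h4 : (-1 : ℝ) ^ (k - 1) * (c l * (alpha w a b k t l)⁻¹) = (-1) ^ (k - 1) * 1 := by
    rw [mul_one]
    nth_rewrite 2 [hrec]
    ring
  have h5 := mul_left_cancel₀ hne h4
  field_simp at h5
  exact h5

theorem alpha_mul_bForm_le (hw : WeightsIn a b k m B w) (hW : WeightsBounded a b k m B w)
    (hk : 1 ≤ k) (ht : IsPartition a b k n t) {i j : ℕ} (hi : i ≤ n) (hj1 : k ≤ j + 1)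
    (hj2 : j ≤ n) {x : ℝ} (hx : x ∈ Ioo (t j) (t (j + 1))) :
    alpha w a b k t i * bForm w a k t i x ≤ B := by
  refine le_trans ?_ (hw.le 1 le_rfl hk x (ht.Ioo_subset hk (by omega) hx))
  rw [← sum_alpha_mul_bForm hw hW hk ht hj1 hj2 hx]
  refine Finset.single_le_sum (f := fun i => alpha w a b k t i * bForm w a k t i x)
    (fun q hq => ?_) (Finset.mem_range.2 (by omega))
  rw [Finset.mem_range] at hq
  exact mul_nonneg (alpha_pos hw hk ht (by omega)).le (bForm_nonneg hw hk ht (by omega)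
    (by omega) hx)

theorem integral_bForm (hw : WeightsIn a b k m B w) (hk : 1 ≤ k) (ht : IsPartition a b k n t)
    {i : ℕ} (hi : i ≤ n) : ∫ x, bForm w a k t i x ∂measI a b = 1 := by
  obtain ⟨-, ξ, -, h⟩ := exists_integral_bForm_mul hw hk ht hi (f := fun _ => 1)
    continuousOn_const
  rw [measI, integral_Icc_eq_integral_Ioc, ← intervalIntegral.integral_of_le hw.lt.le]
  simpa using h

theorem integrable_bForm (hw : WeightsIn a b k m B w) (hk : 1 ≤ k)
    (ht : IsPartition a b k n t) {i : ℕ} (hi : i ≤ n) :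
    Integrable (bForm w a k t i) (measI a b) := by
  rw [measI, ← IntegrableOn, integrableOn_Icc_iff_integrableOn_Ioc,
    ← intervalIntegrable_iff_integrableOn_Ioc_of_le hw.lt.le]
  exact intervalIntegrable_bForm hw hk ht hi

theorem memLp_bForm (hw : WeightsIn a b k m B w) (hW : WeightsBounded a b k m B w)
    (hk : 1 ≤ k) (ht : IsPartition a b k n t) {i : ℕ} (hi : i ≤ n) (p : ℝ≥0∞) :
    MemLp (bForm w a k t i) p (measI a b) := by
  refine MemLp.of_bound (integrable_bForm hw hk ht hi).aestronglyMeasurable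
    (B / alpha w a b k t i) ?_
  filter_upwards [ht.ae_mem_Ioo hk] with x hx
  obtain ⟨-, j, hj1, hj2, hxj⟩ := hx
  rw [Real.norm_of_nonneg (bForm_nonneg hw hk ht hi (by omega) hxj),
    le_div_iff₀ (alpha_pos hw hk ht hi), mul_comm]
  exact alpha_mul_bForm_le hw hW hk ht hi hj1 hj2 hxj

theorem integrable_bForm_mul (hw : WeightsIn a b k m B w) (hW : WeightsBounded a b k m B w)
    (hk : 1 ≤ k) (ht : IsPartition a b k n t) {i l : ℕ} (hi : i ≤ n) (hl : l ≤ n) :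
    Integrable (fun x => bForm w a k t l x * bForm w a k t i x) (measI a b) :=
  (memLp_bForm hw hW hk ht hl 2).integrable_mul (memLp_bForm hw hW hk ht hi 2)

/-- The numbers `⟨N_l, M_i⟩`: the Gram matrix with its columns divided by the `α_i`. -/
noncomputable def mixedGram (w : ℕ → ℝ → ℝ) (a b : ℝ) (k : ℕ) (t : ℕ → ℝ) (l i : ℕ) : ℝ :=
  alpha w a b k t l * ∫ x, bForm w a k t l x * bForm w a k t i x ∂measI a b

theorem mixedGram_nonneg (hw : WeightsIn a b k m B w)
    (hk : 1 ≤ k) (ht : IsPartition a b k n t) {i l : ℕ} (hi : i ≤ n) (hl : l ≤ n) :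
    0 ≤ mixedGram w a b k t l i := by
  refine mul_nonneg (alpha_pos hw hk ht hl).le (integral_nonneg_of_ae ?_)
  filter_upwards [ht.ae_mem_Ioo hk] with x hx
  obtain ⟨-, j, hj1, hj2, hxj⟩ := hx
  exact mul_nonneg (bForm_nonneg hw hk ht hl (by omega) hxj)
    (bForm_nonneg hw hk ht hi (by omega) hxj)

theorem sum_mixedGram_le (hw : WeightsIn a b k m B w) (hW : WeightsBounded a b k m B w)
    (hk : 1 ≤ k) (ht : IsPartition a b k n t) {i : ℕ} (hi : i ≤ n) :
    ∑ l ∈ Finset.range (n + 1), mixedGram w a b k t l i ≤ B := by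
  have hint : ∀ l ∈ Finset.range (n + 1), Integrable (fun x => alpha w a b k t l *
      (bForm w a k t l x * bForm w a k t i x)) (measI a b) := fun l hl =>
    (integrable_bForm_mul hw hW hk ht hi (by rw [Finset.mem_range] at hl; omega)).const_mul _
  simp only [mixedGram, ← integral_const_mul]
  rw [← integral_finsetSum _ hint]
  calc _ ≤ ∫ x, B * bForm w a k t i x ∂measI a b := by
        refine integral_mono_ae (integrable_finsetSum _ hint)
          ((integrable_bForm hw hk ht hi).const_mul B) ?_
        filter_upwards [ht.ae_mem_Ioo hk] with x hx
        obtain ⟨-, j, hj1, hj2, hxj⟩ := hx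
        simp only [← mul_assoc, ← Finset.sum_mul]
        rw [sum_alpha_mul_bForm hw hW hk ht hj1 hj2 hxj]
        exact mul_le_mul_of_nonneg_right
          (hw.le 1 le_rfl hk x (ht.Ioo_subset hk (by omega) hxj))
          (bForm_nonneg hw hk ht hi (by omega) hxj)
    _ = B := by rw [integral_const_mul, integral_bForm hw hk ht hi, mul_one]

theorem mixedGram_eq_zero (hw : WeightsIn a b k m B w)
    (hk : 1 ≤ k) (ht : IsPartition a b k n t) {i l : ℕ} (hi : i ≤ n) (hl : l ≤ n)
    (h : i + k ≤ l ∨ l + k ≤ i) : mixedGram w a b k t l i = 0 := by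
  have hmain : ∀ {p q : ℕ}, p ≤ n → q ≤ n → p + k ≤ q → ∀ {x : ℝ} {j : ℕ}, k ≤ j + 1 → j ≤ n →
      x ∈ Ioo (t j) (t (j + 1)) → bForm w a k t p x = 0 ∨ bForm w a k t q x = 0 := by
    intro p q hp hq hpq x j hj1 hj2 hx
    have hxI := ht.Ioo_subset hk (by omega) hx
    rcases Nat.lt_or_ge j q with hjq | hjq
    · exact Or.inr (bForm_eq_zero hw hk ht hq hxI (Or.inl
        (hx.2.trans_le (ht.mono (by omega) (by omega)))))
    · exact Or.inl (bForm_eq_zero hw hk ht hp hxI (Or.inr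
        ((ht.mono (by omega) (by omega)).trans_lt hx.1)))
  rw [mixedGram, integral_eq_zero_of_ae, mul_zero]
  filter_upwards [ht.ae_mem_Ioo hk] with x hx
  obtain ⟨-, j, hj1, hj2, hxj⟩ := hx
  rw [Pi.zero_apply, mul_eq_zero]
  rcases h with h | h
  · exact (hmain hi hl h hj1 hj2 hxj).symm
  · exact hmain hl hi h hj1 hj2 hxj

end Unity

/-! ### The `ℓ¹` lower bound from the norm of the projection -/

section Projection

variable {w : ℕ → ℝ → ℝ} {a b m B : ℝ} {k n : ℕ} {t : ℕ → ℝ}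

theorem sum_bForm_mem_splineL2 (hw : WeightsIn a b k m B w) (hW : WeightsBounded a b k m B w)
    (hk : 1 ≤ k) (ht : IsPartition a b k n t) (c : ℕ → ℝ) {f : Lp ℝ 2 (measI a b)}
    (hf : f =ᵐ[measI a b] fun x => ∑ i ∈ Finset.range (n + 1), c i * bForm w a k t i x) :
    f ∈ splineL2 w a b k n t := by
  choose! v hv hv' using fun i (hi : i ≤ n) => exists_mem_truncSpan_bForm hk ht hi
  refine ⟨∑ i ∈ Finset.range (n + 1), c i • v i, Submodule.sum_mem _ fun i hi =>
    Submodule.smul_mem _ _ (truncSpan_le_splineSpace hw hW hk ht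
      (hv i (by rw [Finset.mem_range] at hi; omega))), hf.trans ?_⟩
  filter_upwards [ht.ae_mem_Ioo hk] with x hx
  rw [Finset.sum_apply]
  refine Finset.sum_congr rfl fun i hi => ?_
  rw [Pi.smul_apply, smul_eq_mul, hv' i (by rw [Finset.mem_range] at hi; omega) hx.1]

theorem exists_coeff_of_mem_splineL2 (hw : WeightsIn a b k m B w)
    (hW : WeightsBounded a b k m B w) (hk : 1 ≤ k) (ht : IsPartition a b k n t)
    {f : Lp ℝ 2 (measI a b)} (hf : f ∈ splineL2 w a b k n t) :
    ∃ c : ℕ → ℝ, f =ᵐ[measI a b] fun x =>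
      ∑ i ∈ Finset.range (n + 1), c i * bForm w a k t i x := by
  obtain ⟨s, hs, hfs⟩ := hf
  obtain ⟨c, hc⟩ := exists_coeff_of_mem_splineSpace hw hW hk ht hs
  refine ⟨c, hfs.trans ?_⟩
  filter_upwards [ht.ae_mem_Ioo hk] with x hx
  obtain ⟨-, j, hj1, hj2, hxj⟩ := hx
  exact hc j hj1 hj2 x hxj

theorem splineL2_topologicalClosure (hw : WeightsIn a b k m B w)
    (hW : WeightsBounded a b k m B w) (hk : 1 ≤ k) (ht : IsPartition a b k n t) :
    (splineL2 w a b k n t).topologicalClosure = splineL2 w a b k n t := by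
  let N : Fin (n + 1) → Lp ℝ 2 (measI a b) := fun i =>
    (memLp_bForm hw hW hk ht (show (i : ℕ) ≤ n by omega) 2).toLp
  have hle : splineL2 w a b k n t ≤ Submodule.span ℝ (range N) := by
    intro f hf
    obtain ⟨c, hc⟩ := exists_coeff_of_mem_splineL2 hw hW hk ht hf
    refine (Submodule.mem_span_range_iff_exists_fun ℝ).2 ⟨fun i => c i, ?_⟩
    refine Lp.ext (EventuallyEq.trans ?_ hc.symm)
    have h1 : ∀ i : Fin (n + 1), (c i • N i : Lp ℝ 2 (measI a b)) =ᵐ[measI a b]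
        fun x => c i * bForm w a k t i x := fun i => by
      filter_upwards [Lp.coeFn_smul (c i) (N i), MemLp.coeFn_toLp
        (memLp_bForm hw hW hk ht (show (i : ℕ) ≤ n by omega) 2)] with x h1 h2
      rw [h1, Pi.smul_apply, smul_eq_mul, h2]
    have h2 : (∑ i : Fin (n + 1), c i • N i : Lp ℝ 2 (measI a b)) =ᵐ[measI a b]
        ∑ i : Fin (n + 1), ((c i • N i : Lp ℝ 2 (measI a b)) : ℝ → ℝ) :=
      Lp.coeFn_finsetSum _ _
    filter_upwards [h2, eventually_countable_forall.2 h1] with x h3 h4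
    rw [h3, Finset.sum_apply, Finset.sum_range]
    exact Finset.sum_congr rfl fun i _ => h4 i
  have : FiniteDimensional ℝ (Submodule.span ℝ (range N)) :=
    FiniteDimensional.span_of_finite ℝ (finite_range N)
  have : FiniteDimensional ℝ (splineL2 w a b k n t) := Submodule.finiteDimensional_of_le hle
  exact (Submodule.closed_of_finiteDimensional _).submodule_topologicalClosure_eq

theorem IsPartition.sum_integral_le (ht : IsPartition a b k n t) (hk : 1 ≤ k) {f : ℝ → ℝ}
    (hf : IntervalIntegrable f volume a b) (hf0 : ∀ x, 0 ≤ f x) :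
    ∑ i ∈ Finset.range (n + 1), ∫ x in (t i)..(t (i + k)), f x ≤ k * ∫ x in a..b, f x := by
  have hint : ∀ {p q : ℕ}, p ≤ n + k → q ≤ n + k → IntervalIntegrable f volume (t p) (t q) := by
    intro p q hp hq
    refine hf.mono_set ?_
    have h1 := ht.mem_Icc hk hp
    rw [uIcc_of_le (h1.1.trans h1.2)]
    exact uIcc_subset_Icc h1 (ht.mem_Icc hk hq)
  have h1 : ∀ i ∈ Finset.range (n + 1), ∫ x in (t i)..(t (i + k)), f x =
      ∑ q ∈ Finset.range k, ∫ x in (t (q + i))..(t (q + (i + 1))), f x := by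
    intro i hi
    rw [Finset.mem_range] at hi
    have := intervalIntegral.sum_integral_adjacent_intervals (f := f) (μ := volume)
      (a := fun q => t (i + q)) (n := k) fun q hq => hint (by omega) (by omega)
    rw [Nat.add_zero] at this
    rw [← this]
    refine Finset.sum_congr rfl fun q _ => ?_
    rw [show q + (i + 1) = i + (q + 1) by omega, add_comm q i]
  rw [Finset.sum_congr rfl h1, Finset.sum_comm]
  have h2 : ∀ q ∈ Finset.range k, ∑ i ∈ Finset.range (n + 1),
      ∫ x in (t (q + i))..(t (q + (i + 1))), f x ≤ ∫ x in a..b, f x := by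
    intro q hq
    rw [Finset.mem_range] at hq
    rw [intervalIntegral.sum_integral_adjacent_intervals (a := fun i => t (q + i))
      fun i hi => hint (by omega) (by omega)]
    exact intervalIntegral.integral_mono_interval (ht.mem_Icc hk (by omega)).1
      (ht.mono (by omega) (by omega)) (ht.mem_Icc hk (by omega)).2
      (Eventually.of_forall fun x => hf0 x) hf
  refine (Finset.sum_le_sum h2).trans ?_
  rw [Finset.sum_const, Finset.card_range, nsmul_eq_mul]

/-- The `L∞` bound for `P_Δ`, tested on the sign of a spline `∑ x_i M_i`, bounds the `ℓ¹` norm of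
its coefficients by that of its inner products with the `N_l`. -/
theorem exists_l1_bound (k : ℕ) (hk : 1 ≤ k) (m B K : ℝ) (hm : 0 < m) (hB : 0 < B) :
    ∃ κ, 0 < κ ∧ ∀ (w : ℕ → ℝ → ℝ) (a b : ℝ) (n : ℕ) (t : ℕ → ℝ), WeightsIn a b k m B w →
      WeightsBounded a b k m B w → IsPartition a b k n t →
      projNorm w a b k n t ≤ ENNReal.ofReal K → ∀ c : ℕ → ℝ,
      ∑ i ∈ Finset.range (n + 1), |c i| ≤ κ * ∑ l ∈ Finset.range (n + 1),
        |∑ i ∈ Finset.range (n + 1), mixedGram w a b k t l i * c i| := by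
  obtain ⟨D, hD, hstab⟩ := exists_stability_bound k hk m B hm hB
  set K' := max K 0 with hK'
  have hK0 : 0 ≤ K' := le_max_right _ _
  refine ⟨2 * B * D * k * (D * K') + 1, by positivity, ?_⟩
  intro w a b n t hw hW ht hproj c
  set μ := measI a b with hμ
  set s : ℝ → ℝ := fun x => ∑ i ∈ Finset.range (n + 1), c i * bForm w a k t i x with hs
  have hsM : MemLp s 2 μ := memLp_finsetSum _ fun i hi =>
    (memLp_bForm hw hW hk ht (by rw [Finset.mem_range] at hi; omega) 2).const_mul (c i)
  set S : Lp ℝ 2 μ := hsM.toLp with hS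
  have hSs : S =ᵐ[μ] s := hsM.coeFn_toLp
  -- the sign of the spline
  set σ : ℝ → ℝ := fun x => if 0 ≤ S x then 1 else -1 with hσ
  have hSmeas : Measurable S := (Lp.stronglyMeasurable S).measurable
  have hσm : Measurable σ :=
    Measurable.ite (measurableSet_le measurable_const hSmeas) measurable_const measurable_const
  have hσ1 : ∀ x, ‖σ x‖ ≤ 1 := fun x => by simp only [hσ]; split_ifs <;> simp
  have hσM : MemLp σ 2 μ := MemLp.of_bound hσm.aestronglyMeasurable 1
    (Eventually.of_forall hσ1)
  set F : Lp ℝ 2 μ := hσM.toLp with hF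
  have hFσ : F =ᵐ[μ] σ := hσM.coeFn_toLp
  have hF1 : eLpNorm F ∞ μ ≤ 1 := by
    rw [eLpNorm_congr_ae hFσ, eLpNorm_exponent_top]
    refine eLpNormEssSup_le_of_ae_enorm_bound (Eventually.of_forall fun x => ?_)
    rw [← ofReal_norm, ← ENNReal.ofReal_one]
    exact ENNReal.ofReal_le_ofReal (hσ1 x)
  set G : Lp ℝ 2 μ := proj w a b k n t F with hG
  have hGK : ∀ᵐ x ∂μ, |G x| ≤ K' := by
    have h1 : eLpNorm G ∞ μ ≤ ENNReal.ofReal K' :=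
      ((le_iSup₂ (f := fun (f : Lp ℝ 2 μ) (_ : eLpNorm f ∞ μ ≤ 1) =>
        eLpNorm (proj w a b k n t f) ∞ μ) F hF1).trans hproj).trans
        (ENNReal.ofReal_le_ofReal (le_max_left _ _))
    rw [eLpNorm_exponent_top] at h1
    filter_upwards [ae_le_eLpNormEssSup (f := G) (μ := μ)] with x hx
    have h2 := hx.trans h1
    rw [← ofReal_norm, ENNReal.ofReal_le_ofReal_iff hK0] at h2
    exact h2
  have hGmem : G ∈ splineL2 w a b k n t := by
    have : G ∈ (splineL2 w a b k n t).topologicalClosure :=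
      Submodule.starProjection_apply_mem _ _
    rwa [splineL2_topologicalClosure hw hW hk ht] at this
  obtain ⟨d, hd⟩ := exists_coeff_of_mem_splineL2 hw hW hk ht hGmem
  have hsub : ∀ i ≤ n, Ioc (t i) (t (i + k)) ⊆ Icc a b := fun i hi x hx =>
    ⟨(ht.mem_Icc hk (by omega)).1.trans hx.1.le, hx.2.trans (ht.mem_Icc hk (by omega)).2⟩
  -- the coefficients of the projection are bounded
  have hdl : ∀ l ≤ n, |d l| ≤ D * K' * alpha w a b k t l := by
    intro l hl
    have hH : 0 < t (l + k) - t l := sub_pos.2 (ht.lt_add hk hl)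
    have h1 := hstab w a b n t hw ht d l hl
    have h2 : ∫ x in (t l)..(t (l + k)), |∑ i ∈ Finset.range (n + 1), d i * bForm w a k t i x| ≤
        K' * (t (l + k) - t l) := by
      refine (le_abs_self _).trans ?_
      rw [← Real.norm_eq_abs, ← abs_of_pos hH]
      refine intervalIntegral.norm_integral_le_of_norm_le_const_ae ?_
      rw [uIoc_of_le (sub_pos.1 hH).le]
      have h3 : ∀ᵐ x ∂μ, |∑ i ∈ Finset.range (n + 1), d i * bForm w a k t i x| ≤ K' := by
        filter_upwards [hGK, hd] with x hx1 hx2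
        rwa [← hx2]
      have h4 := (ae_restrict_iff' measurableSet_Icc).1 h3
      filter_upwards [h4] with x hx hxI
      rw [Real.norm_eq_abs, abs_abs]
      exact hx (hsub l hl hxI)
    have hα := alpha_pos hw hk ht hl
    have h3 : |d l| * (t (l + k) - t l) ≤ D * K' * alpha w a b k t l * (t (l + k) - t l) :=
      h1.trans (by
        calc _ ≤ D * alpha w a b k t l * (K' * (t (l + k) - t l)) := by gcongr
          _ = _ := by ring)
    exact le_of_mul_le_mul_right h3 hH
  -- duality: the projection does not change the pairing with a spline
  have hpair : ∫ x, |s x| ∂μ = ∑ l ∈ Finset.range (n + 1), d l *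
      ∑ i ∈ Finset.range (n + 1), c i * ∫ x, bForm w a k t l x * bForm w a k t i x ∂μ := by
    have hSmem : S ∈ splineL2 w a b k n t := sum_bForm_mem_splineL2 hw hW hk ht c hSs
    have hSfix : proj w a b k n t S = S := by
      refine Submodule.starProjection_eq_self_iff.2 ?_
      rw [splineL2_topologicalClosure hw hW hk ht]
      exact hSmem
    have h1 : inner ℝ S F = inner ℝ S G := by
      conv_lhs => rw [← hSfix]
      exact Submodule.inner_starProjection_left_eq_right _ _ _
    have h2 : inner ℝ S F = ∫ x, |s x| ∂μ := by
      rw [L2.inner_def]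
      refine integral_congr_ae ?_
      filter_upwards [hSs, hFσ] with x hx1 hx2
      rw [hx2, ← hx1]
      simp only [hσ]
      split_ifs with h0
      · rw [abs_of_nonneg h0]; simp
      · rw [abs_of_neg (not_le.1 h0)]; simp
    have h3 : inner ℝ S G = ∫ x, ∑ l ∈ Finset.range (n + 1), ∑ i ∈ Finset.range (n + 1),
        d l * (c i * (bForm w a k t l x * bForm w a k t i x)) ∂μ := by
      rw [L2.inner_def]
      refine integral_congr_ae ?_
      filter_upwards [hSs, hd] with x hx1 hx2
      rw [hx1, hx2]
      simp only [hs, RCLike.inner_apply, conj_trivial, Finset.sum_mul_sum]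
      exact Finset.sum_congr rfl fun l _ => Finset.sum_congr rfl fun i _ => by ring
    rw [← h2, h1, h3]
    have hint : ∀ l ∈ Finset.range (n + 1), ∀ i ∈ Finset.range (n + 1), Integrable (fun x =>
        d l * (c i * (bForm w a k t l x * bForm w a k t i x))) μ := by
      intro l hl i hi
      rw [Finset.mem_range] at hl hi
      exact ((integrable_bForm_mul hw hW hk ht (by omega) (by omega)).const_mul _).const_mul _
    rw [integral_finsetSum _ fun l hl => integrable_finsetSum _ (hint l hl)]
    refine Finset.sum_congr rfl fun l hl => ?_
    rw [integral_finsetSum _ (hint l hl), Finset.mul_sum]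
    exact Finset.sum_congr rfl fun i _ => by rw [integral_const_mul, integral_const_mul]
  have hbound : ∫ x, |s x| ∂μ ≤ D * K' * ∑ l ∈ Finset.range (n + 1),
      |∑ i ∈ Finset.range (n + 1), mixedGram w a b k t l i * c i| := by
    rw [hpair, Finset.mul_sum]
    refine Finset.sum_le_sum fun l hl => ?_
    rw [Finset.mem_range] at hl
    have hα := alpha_pos hw hk ht (show l ≤ n by omega)
    have e1 : ∑ i ∈ Finset.range (n + 1), mixedGram w a b k t l i * c i = alpha w a b k t l *
        ∑ i ∈ Finset.range (n + 1), c i * ∫ x, bForm w a k t l x * bForm w a k t i x ∂μ := by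
      rw [Finset.mul_sum]
      exact Finset.sum_congr rfl fun i _ => by rw [mixedGram]; ring
    rw [e1, abs_mul, abs_of_pos hα]
    refine (le_abs_self _).trans ?_
    rw [abs_mul]
    calc _ ≤ (D * K' * alpha w a b k t l) * |∑ i ∈ Finset.range (n + 1),
          c i * ∫ x, bForm w a k t l x * bForm w a k t i x ∂μ| :=
          mul_le_mul_of_nonneg_right (hdl l (by omega)) (abs_nonneg _)
      _ = _ := by ring
  -- the coefficients of the spline itself are bounded by its `L¹` norm
  have hci : ∀ i ∈ Finset.range (n + 1), |c i| ≤ 2 * B * D * ∫ x in (t i)..(t (i + k)), |s x| := by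
    intro i hi
    rw [Finset.mem_range] at hi
    have hH : 0 < t (i + k) - t i := sub_pos.2 (ht.lt_add hk (by omega))
    have h1 := hstab w a b n t hw ht c i (by omega)
    have h2 := alpha_le hw hk ht (show i ≤ n by omega)
    have h3 : 0 ≤ ∫ x in (t i)..(t (i + k)), |s x| :=
      intervalIntegral.integral_nonneg (sub_pos.1 hH).le fun _ _ => abs_nonneg _
    refine le_of_mul_le_mul_right (h1.trans ?_) hH
    calc D * alpha w a b k t i * ∫ x in (t i)..(t (i + k)), |s x|
        ≤ D * (2 * B * (t (i + k) - t i)) * ∫ x in (t i)..(t (i + k)), |s x| := by gcongr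
      _ = _ := by ring
  have hsI : ∫ x in a..b, |s x| = ∫ x, |s x| ∂μ := by
    rw [intervalIntegral.integral_of_le hw.lt.le, hμ, measI, integral_Icc_eq_integral_Ioc]
  have hsum := ht.sum_integral_le hk (f := fun x => |s x|)
    (intervalIntegrable_sum_bForm hw hk ht c).abs fun x => abs_nonneg _
  set R := ∑ l ∈ Finset.range (n + 1), |∑ i ∈ Finset.range (n + 1), mixedGram w a b k t l i * c i|
    with hR
  have hR0 : 0 ≤ R := Finset.sum_nonneg fun _ _ => abs_nonneg _
  calc ∑ i ∈ Finset.range (n + 1), |c i|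
      ≤ ∑ i ∈ Finset.range (n + 1), 2 * B * D * ∫ x in (t i)..(t (i + k)), |s x| :=
        Finset.sum_le_sum hci
    _ = 2 * B * D * ∑ i ∈ Finset.range (n + 1), ∫ x in (t i)..(t (i + k)), |s x| := by
        rw [Finset.mul_sum]
    _ ≤ 2 * B * D * (k * (D * K' * R)) := by
        gcongr
        exact hsum.trans (mul_le_mul_of_nonneg_left (hsI.trans_le hbound) (Nat.cast_nonneg k))
    _ ≤ (2 * B * D * k * (D * K') + 1) * R := by linarith

end Projection

/-! ### Exponential decay for inverses of band matrices -/

section Decay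

/-- If a band matrix `A` with bounded column sums is bounded below in `ℓ¹`, the columns of its
inverse decay exponentially away from the diagonal: the tail sums `T_s` of a column satisfy
`T_s ≤ κ B (T_s - T_{s + 2k})`. -/
theorem exists_decay_of_l1_bound (k : ℕ) (hk : 1 ≤ k) (κ B : ℝ) (hκ : 0 < κ) (hB : 0 < B) :
    ∃ C q : ℝ, 0 < C ∧ 0 < q ∧ q < 1 ∧ ∀ (n : ℕ) (A : ℕ → ℕ → ℝ),
      (∀ l < n, ∀ i < n, i + k ≤ l ∨ l + k ≤ i → A l i = 0) →
      (∀ i < n, ∑ l ∈ Finset.range n, |A l i| ≤ B) →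
      (∀ x : ℕ → ℝ, ∑ i ∈ Finset.range n, |x i| ≤
        κ * ∑ l ∈ Finset.range n, |∑ i ∈ Finset.range n, A l i * x i|) →
      ∀ (j : ℕ) (x : ℕ → ℝ), j < n →
        (∀ l < n, ∑ i ∈ Finset.range n, A l i * x i = if l = j then 1 else 0) →
        ∀ i < n, |x i| ≤ C * q ^ ((i : ℤ) - (j : ℤ)).natAbs := by
  set θ : ℝ := κ * B + 1 with hθ
  have hθ1 : 1 < θ := by rw [hθ]; linarith [mul_pos hκ hB]
  have hk' : (1 : ℝ) ≤ k := by exact_mod_cast hk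
  have hden : 1 < 2 * k * θ := by nlinarith
  set ρ : ℝ := 1 - 1 / θ with hρ
  set q : ℝ := 1 - 1 / (2 * k * θ) with hq
  have hρ0 : 0 ≤ ρ := by
    rw [hρ, sub_nonneg, div_le_one (by linarith)]; exact hθ1.le
  have hq0 : 0 < q := by
    rw [hq, sub_pos, div_lt_one (by linarith)]; exact hden
  have hq1 : q < 1 := by
    rw [hq, sub_lt_self_iff]; exact div_pos one_pos (by linarith)
  -- Bernoulli's inequality
  have hρq : ρ ≤ q ^ (2 * k) := by
    have h1 : (-2 : ℝ) ≤ -(1 / (2 * k * θ)) := by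
      have : 1 / (2 * k * θ) < 1 := (div_lt_one (by linarith)).2 hden
      linarith
    have h2 := one_add_mul_le_pow h1 (2 * k)
    have h3 : 1 + ((2 * k : ℕ) : ℝ) * -(1 / (2 * k * θ)) = ρ := by
      have : (k : ℝ) ≠ 0 := by positivity
      have : θ ≠ 0 := by positivity
      rw [hρ]; push_cast; field_simp; ring
    rw [h3] at h2
    exact h2
  refine ⟨κ / q ^ (2 * k), q, by positivity, hq0, hq1, ?_⟩
  intro n A hband hcol hbelow j x hj hx
  set δ : ℕ → ℕ := fun i => ((i : ℤ) - (j : ℤ)).natAbs with hδ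
  set T : ℕ → ℝ := fun s => ∑ i ∈ Finset.range n, if s ≤ δ i then |x i| else 0 with hT
  have hT0 : T 0 ≤ κ := by
    have h1 : T 0 = ∑ i ∈ Finset.range n, |x i| := by simp [hT]
    have h2 : ∑ l ∈ Finset.range n, |∑ i ∈ Finset.range n, A l i * x i| = 1 := by
      have : ∀ l ∈ Finset.range n, |∑ i ∈ Finset.range n, A l i * x i| =
          if l = j then 1 else 0 := by
        intro l hl
        rw [hx l (Finset.mem_range.1 hl)]
        split_ifs <;> simp
      rw [Finset.sum_congr rfl this, Finset.sum_ite_eq', if_pos (Finset.mem_range.2 hj)]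
    have h3 := hbelow x
    rwa [h2, mul_one, ← h1] at h3
  have hstep : ∀ s, T (s + 2 * k) ≤ ρ * T s := by
    intro s
    have h1 := hbelow fun i => if s ≤ δ i then x i else 0
    have e1 : ∑ i ∈ Finset.range n, |if s ≤ δ i then x i else 0| = T s :=
      Finset.sum_congr rfl fun i _ => by split_ifs <;> simp
    rw [e1] at h1
    have h2 : ∀ l ∈ Finset.range n, |∑ i ∈ Finset.range n, A l i * (if s ≤ δ i then x i else 0)| ≤
        ∑ i ∈ Finset.range n, |A l i| *
          (if s ≤ δ i ∧ δ i < s + 2 * k then |x i| else 0) := by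
      intro l hl
      rw [Finset.mem_range] at hl
      by_cases hfar : s + k ≤ δ l
      · -- in such a row the truncated vector cannot be told from the full one
        have e2 : ∑ i ∈ Finset.range n, A l i * (if s ≤ δ i then x i else 0) =
            ∑ i ∈ Finset.range n, A l i * x i := by
          refine Finset.sum_congr rfl fun i hi => ?_
          rw [Finset.mem_range] at hi
          by_cases hsi : s ≤ δ i
          · rw [if_pos hsi]
          · rw [hband l hl i hi (by simp only [hδ] at hfar hsi; omega), zero_mul, zero_mul]
        rw [e2, hx l hl, if_neg (by rintro rfl; simp [hδ] at hfar; omega), abs_zero]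
        exact Finset.sum_nonneg fun i _ => mul_nonneg (abs_nonneg _) (by split_ifs <;> simp)
      · refine (Finset.abs_sum_le_sum_abs _ _).trans (Finset.sum_le_sum fun i hi => ?_)
        rw [Finset.mem_range] at hi
        rw [abs_mul]
        by_cases hsi : s ≤ δ i
        · by_cases hsi' : δ i < s + 2 * k
          · rw [if_pos hsi, if_pos ⟨hsi, hsi'⟩]
          · rw [hband l hl i hi (by simp only [hδ] at hfar hsi'; omega)]
            simp
        · rw [if_neg hsi, if_neg (fun h => hsi h.1)]
          simp
    have h3 : ∑ l ∈ Finset.range n, |∑ i ∈ Finset.range n, A l i * (if s ≤ δ i then x i else 0)| ≤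
        B * (T s - T (s + 2 * k)) := by
      refine (Finset.sum_le_sum h2).trans ?_
      rw [Finset.sum_comm]
      have e2 : T s - T (s + 2 * k) =
          ∑ i ∈ Finset.range n, if s ≤ δ i ∧ δ i < s + 2 * k then |x i| else 0 := by
        simp only [hT]
        rw [← Finset.sum_sub_distrib]
        refine Finset.sum_congr rfl fun i _ => ?_
        by_cases h4 : s ≤ δ i
        · by_cases h5 : δ i < s + 2 * k
          · rw [if_pos h4, if_neg (by omega), if_pos ⟨h4, h5⟩, sub_zero]
          · rw [if_pos h4, if_pos (by omega), if_neg (fun h => h5 h.2), sub_self]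
        · rw [if_neg h4, if_neg (by omega), if_neg (fun h => h4 h.1), sub_self]
      rw [e2, Finset.mul_sum]
      refine Finset.sum_le_sum fun i hi => ?_
      rw [← Finset.sum_mul]
      exact mul_le_mul_of_nonneg_right (hcol i (Finset.mem_range.1 hi)) (by split_ifs <;> simp)
    have h4 : T (s + 2 * k) ≤ T s := by
      refine Finset.sum_le_sum fun i _ => ?_
      split_ifs with h5 h6
      · exact le_rfl
      · omega
      · exact abs_nonneg _
      · exact le_rfl
    have h5 : T s ≤ θ * (T s - T (s + 2 * k)) := by
      calc T s ≤ κ * (B * (T s - T (s + 2 * k))) := h1.trans (mul_le_mul_of_nonneg_left h3 hκ.le)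
        _ ≤ _ := by rw [hθ, add_mul, one_mul, mul_assoc]; linarith
    have h6 : T s / θ ≤ T s - T (s + 2 * k) := by
      rw [div_le_iff₀ (by linarith), mul_comm]; exact h5
    rw [hρ, sub_mul, one_mul, div_mul_eq_mul_div, one_mul]
    linarith
  have hiter : ∀ u, T (2 * k * u) ≤ ρ ^ u * κ := by
    intro u
    induction u with
    | zero => simpa using hT0
    | succ u ih =>
      rw [Nat.mul_succ, pow_succ]
      calc _ ≤ ρ * T (2 * k * u) := hstep _
        _ ≤ ρ * (ρ ^ u * κ) := mul_le_mul_of_nonneg_left ih hρ0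
        _ = _ := by ring
  intro i hi
  set u := δ i / (2 * k) with hu
  have h1 : |x i| ≤ T (2 * k * u) := by
    have h2 : 2 * k * u ≤ δ i := Nat.mul_div_le _ _
    have h3 := Finset.single_le_sum (f := fun i => if 2 * k * u ≤ δ i then |x i| else 0)
      (s := Finset.range n) (fun i _ => by split_ifs <;> simp)
      (Finset.mem_range.2 hi)
    simp only [if_pos h2] at h3
    exact h3
  have h2 : ρ ^ u ≤ q ^ (2 * k * u) := by
    rw [pow_mul]; exact pow_le_pow_left₀ hρ0 hρq u
  have h3 : q ^ (2 * k * u) * q ^ (2 * k) ≤ q ^ δ i := by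
    rw [← pow_add]
    refine pow_le_pow_of_le_one hq0.le hq1.le ?_
    have := Nat.lt_mul_div_succ (δ i) (show 0 < 2 * k by omega)
    rw [← hu, Nat.mul_add, mul_one] at this
    exact this.le
  calc |x i| ≤ ρ ^ u * κ := h1.trans (hiter u)
    _ ≤ q ^ (2 * k * u) * κ := by gcongr
    _ ≤ q ^ δ i / q ^ (2 * k) * κ := by
        gcongr
        rw [le_div_iff₀ (by positivity)]
        exact h3
    _ = _ := by ring

end Decay

/-! ### The Gram matrix -/

section Gram

variable {w : ℕ → ℝ → ℝ} {a b m B : ℝ} {k n : ℕ} {t : ℕ → ℝ}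

theorem gram_apply (hw : WeightsIn a b k m B w) (hk : 1 ≤ k) (ht : IsPartition a b k n t)
    (l i : Fin (n + 1)) :
    gram w a b k n t l i = mixedGram w a b k t l i * alpha w a b k t i := by
  rw [gram, Matrix.of_apply, intervalIntegral.integral_of_le hw.lt.le,
    ← integral_Icc_eq_integral_Ioc, mixedGram, mul_assoc, mul_comm (∫ _, _ ∂_),
    ← mul_assoc, ← integral_const_mul]
  refine integral_congr_ae ?_
  filter_upwards [ht.ae_mem_Ioo hk] with x hx
  rw [nSpline, nSpline, bSpline_eq_bForm hw hk ht (by omega) hx.1,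
    bSpline_eq_bForm hw hk ht (by omega) hx.1]
  ring

theorem gram_isSymm (w : ℕ → ℝ → ℝ) (a b : ℝ) (k n : ℕ) (t : ℕ → ℝ) :
    (gram w a b k n t).IsSymm := by
  ext i j
  simp only [gram, Matrix.transpose_apply, Matrix.of_apply]
  exact intervalIntegral.integral_congr fun x _ => mul_comm _ _

/-- The scaling that turns a vector for the Gram matrix into one for `mixedGram`. -/
theorem sum_mixedGram_mul (hw : WeightsIn a b k m B w) (hk : 1 ≤ k) (ht : IsPartition a b k n t)
    (v : Fin (n + 1) → ℝ) {l : ℕ} (hl : l < n + 1) :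
    ∑ i ∈ Finset.range (n + 1), mixedGram w a b k t l i *
      (if h : i < n + 1 then alpha w a b k t i * v ⟨i, h⟩ else 0) =
      (gram w a b k n t).mulVec v ⟨l, hl⟩ := by
  rw [Finset.sum_range, Matrix.mulVec, dotProduct]
  refine Finset.sum_congr rfl fun i _ => ?_
  rw [gram_apply hw hk ht, dif_pos i.2]
  ring

end Gram

end ChebSpline

theorem corollary5 (k : ℕ) (hk : 1 ≤ k) (a b : ℝ) (hab : a < b)
    (m B : ℝ) (hm : 0 < m) (K : ℝ) :
    ∃ C q : ℝ, 0 < C ∧ 0 < q ∧ q < 1 ∧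
      ∀ w : ℕ → ℝ → ℝ, ChebSpline.WeightsBounded a b k m B w →
      ∀ (n : ℕ) (t : ℕ → ℝ), ChebSpline.IsPartition a b k n t →
        ChebSpline.projNorm w a b k n t ≤ ENNReal.ofReal K →
          IsUnit (ChebSpline.gram w a b k n t).det ∧
          ∀ i j : Fin (n + 1),
            |(ChebSpline.gram w a b k n t)⁻¹ i j| ≤
              C * q ^ ((i : ℤ) - (j : ℤ)).natAbs /
                (ChebSpline.alpha w a b k t i + ChebSpline.alpha w a b k t j) := by
  rcases le_or_gt B 0 with hB | hB
  · -- there are no weights in this case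
    refine ⟨1, 1 / 2, one_pos, by norm_num, by norm_num, fun w hW => ?_⟩
    exact absurd ((hW.weightsIn hab hm).bound_pos hk) (not_lt.2 hB)
  obtain ⟨κ, hκ, hl1⟩ := ChebSpline.exists_l1_bound k hk m B K hm hB
  obtain ⟨C, q, hC, hq0, hq1, hdecay⟩ := ChebSpline.exists_decay_of_l1_bound k hk κ B hκ hB
  refine ⟨2 * C, q, by positivity, hq0, hq1, fun w hW n t ht hproj => ?_⟩
  have hw := hW.weightsIn hab hm
  have hbelow := hl1 w a b n t hw hW ht hproj
  have hα : ∀ i : Fin (n + 1), 0 < ChebSpline.alpha w a b k t i := fun i =>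
    ChebSpline.alpha_pos hw hk ht (by omega)
  have hunit : IsUnit (ChebSpline.gram w a b k n t).det := by
    rw [isUnit_iff_ne_zero]
    intro h0
    obtain ⟨v, hv, hv0⟩ := Matrix.exists_mulVec_eq_zero_iff.2 h0
    apply hv
    have h1 := hbelow fun i =>
      if h : i < n + 1 then ChebSpline.alpha w a b k t i * v ⟨i, h⟩ else 0
    have h3 : ∀ l ∈ Finset.range (n + 1),
        |∑ i ∈ Finset.range (n + 1), ChebSpline.mixedGram w a b k t l i *
          if h : i < n + 1 then ChebSpline.alpha w a b k t i * v ⟨i, h⟩ else 0| = 0 := by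
      intro l hl
      rw [ChebSpline.sum_mixedGram_mul hw hk ht v (Finset.mem_range.1 hl), hv0, Pi.zero_apply,
        abs_zero]
    rw [Finset.sum_eq_zero h3, mul_zero] at h1
    ext i
    have h2 := (Finset.sum_eq_zero_iff_of_nonneg fun _ _ => abs_nonneg _).1
      (le_antisymm h1 (Finset.sum_nonneg fun _ _ => abs_nonneg _)) i (Finset.mem_range.2 i.2)
    rw [abs_eq_zero, dif_pos i.2] at h2
    exact (mul_eq_zero.1 h2).resolve_left (hα i).ne'
  refine ⟨hunit, fun i j => ?_⟩
  set V := (ChebSpline.gram w a b k n t)⁻¹ with hV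
  have hcol : ∀ i j : Fin (n + 1),
      ChebSpline.alpha w a b k t i * |V i j| ≤ C * q ^ ((i : ℤ) - (j : ℤ)).natAbs := by
    intro i j
    have h := hdecay (n + 1) (ChebSpline.mixedGram w a b k t)
      (fun l hl i hi h => ChebSpline.mixedGram_eq_zero hw hk ht (by omega) (by omega) h)
      (fun i hi => by
        rw [Finset.sum_congr rfl fun l hl => abs_of_nonneg (ChebSpline.mixedGram_nonneg hw hk ht
          (show i ≤ n by omega) (by rw [Finset.mem_range] at hl; omega))]
        exact ChebSpline.sum_mixedGram_le hw hW hk ht (by omega))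
      hbelow j (fun i => if h : i < n + 1 then ChebSpline.alpha w a b k t i * V ⟨i, h⟩ j else 0)
      j.2 (fun l hl => by
        rw [ChebSpline.sum_mixedGram_mul hw hk ht (fun i => V i j) hl]
        have h1 := congrFun (congrFun (Matrix.mul_nonsing_inv _ hunit) ⟨l, hl⟩) j
        rw [Matrix.one_apply] at h1
        simp only [Fin.ext_iff] at h1
        exact h1) i i.2
    rw [dif_pos i.2, abs_mul, abs_of_pos (hα i)] at h
    exact h
  have hsymm : V j i = V i j := by
    have h1 : V.transpose = V := by
      rw [hV, Matrix.transpose_nonsing_inv, (ChebSpline.gram_isSymm w a b k n t).eq]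
    exact congrFun (congrFun h1 i) j
  have h1 := hcol i j
  have h2 := hcol j i
  rw [hsymm, show ((j : ℤ) - (i : ℤ)).natAbs = ((i : ℤ) - (j : ℤ)).natAbs by omega] at h2
  rw [le_div_iff₀ (add_pos (hα i) (hα j))]
  linarith
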